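/- Let $k$ be a commutative noetherian $\mathbb{Q}$-algebra, $R=k[x_1,\dots,x_n]$, and let $W\in R$ be a potential, i.e. $R/(\partial_{x_1}W,\dots,\partial_{x_n}W)$ is a finitely generated free $k$-module and $\partial_{x_1}W,\dots,\partial_{x_n}W$ is a regular sequence (the unit ideal being allowed). Let $G$ be a finite group of $k$-algebra automorphisms of $R$ which fix $W$. **Notation.** A matrix factorisation of $w\in Q$ is a $\mathbb{Z}_2$-graded free $Q$-module $X=X^0\oplus X^1$ ($X^0,X^1$ free) with an odd $Q$-linear map $d_X$ with $d_X^2=w$. $\mathrm{HMF}(Q,w)$ is the category of matrix factorisations with even maps commuting with the differentials, modulo homotopy. $\mathrm{hmf}(Q,w)$ is its full subcategory of objects of finite rank, and $\mathrm{hmf}(Q,w)^\omega$ the full subcategory of direct summands in $\mathrm{HMF}(Q,w)$ of objects of $\mathrm{hmf}(Q,w)$. For commutative $k$-algebras $T,S,C$ and $U\in T$, $V\in S$, $V'\in C$, factorisations $D$ of $U\otimes1-1\otimes V$ over $T\otimes_kS$ and $X$ of $V\otimes1-1\otimes V'$ over $S\otimes_kC$ have the product $D\otimes_SX$, a factorisation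 of $U\otimes1-1\otimes V'$ over $T\otimes_kC$ with differential $d\otimes1+1\otimes d$ (Koszul signs). Let $R^e=R\otimes_kR=k[x,x']$, $\widetilde W=W\otimes1-1\otimes W$. The unit defect is $$I=\bigwedge\Big(\bigoplus_{i=1}^nR^e\theta_i\Big),\qquad d_I=\sum_i\big((x_i-x_i')\theta_i^*+\partial_{[i]}W\,\theta_i\wedge(-)\big),$$ $$\partial_{[i]}W=\frac{W(x_1',\dots,x_{i-1}',x_i,\dots,x_n)-W(x_1',\dots,x_i',x_{i+1},\dots,x_n)}{x_i-x_i'},$$ and $\lambda_X:I\otimes X\to X$, $\rho_D:D\otimes I\to D$ project $I$ to $\theta$-degree zero and multiply. For $g\in G$, ${}_gX$ is $X$ with $r\in R$ acting as $g^{-1}(r)$ (through the left factor if $X$ is a defect). $\mathrm{hmf}(R,W)^G$ has as objects the $X\in\mathrm{hmf}(R,W)$ with isomorphisms $\varphi_g:{}_gX\to X$ $(g\in G)$ in $\mathrm{hmf}(R,W)$ such that $\varphi_e=1$ and $\varphi_{gh}=\varphi_g\circ{}_g(\varphi_h)$; its morphisms are the $\Psi:X\to Y$ in $\mathrm{hmf}(R,W)$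 with $\Psi\circ\varphi_g^{X}=\varphi_g^{Y}\circ{}_g\Psi$ for all $g$. Define $(\mathrm{hmf}(R,W)^\omega)^G$ in the same way with $\mathrm{hmf}(R,W)^\omega$ in place of $\mathrm{hmf}(R,W)$. Let $A_G=\bigoplus_{g\in G}{}_gI$, with multiplication $\mu=\sum_{g,h}\mu_{g,h}$, where $\mu_{g,h}={}_g(\lambda_{{}_hI}):{}_gI\otimes{}_hI\to{}_{gh}I$, with unit the inclusion $I={}_eI\hookrightarrow A_G$, with comultiplication $\Delta=\frac1{|G|}\sum_{g,h}\mu_{g,h}^{-1}$, and with counit $|G|$ times the projection $A_G\twoheadrightarrow I$. A left $A_G$-module is a 1-morphism $X:(k,0)\to(R,W)$, i.e. a matrix factorisation of $W\otimes1-1\otimes0$ over $R\otimes_kk\cong R$, with a morphism $A_G\otimes X\to X$ in the homotopy category that is associative and unital (with respect to $\lambda_X$); morphisms are module maps. **Theorem.** 1. $A_G$ is a matrix factorisation of $\widetilde W$ of finite rank, every $\mu_{g,h}$ is an isomorphism in $\mathrm{HMF}(R^e,\widetilde W)$, and with the structure maps above $A_G$ is a separable Frobenius algebra: it is an associative unital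 algebra and a coassociative counital coalgebra, it satisfies both Frobenius relations, and $\mu\circ\Delta=1$. 2. $\mathrm{hmf}(R,W)^G$ is equivalent to the category of left $A_G$-modules with underlying object in $\mathrm{hmf}(R,W)$. 3. $(\mathrm{hmf}(R,W)^\omega)^G$ is equivalent to the category $\mathrm{mod}(A_G)$ of left $A_G$-modules with underlying object in $\mathrm{hmf}(R,W)^\omega$, i.e. to $\mathcal{LG}_{\mathrm{eq}}((0,I),(W,A_G))$. The equivalences in 2 and 3 commute, up to natural isomorphism, with the functors to the homotopy category that forget the equivariant structure, respectively the action. -/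

import Mathlib

open CategoryTheory TensorProduct

universe u

noncomputable section

/-! ## Factorisations and their homotopy category -/

/-- A factorisation of `w : Q`: a `ℤ/2`-graded `Q`-module with an odd differential squaring to `w`.
The grading is given by the parity operator `par` (`+1` on even, `-1` on odd elements); over a
`ℚ`-algebra this is the same as a decomposition into even and odd part
(see `LF.isCompl_even_odd`). A matrix factorisation is a factorisation whose even and odd parts are
free, see `LF.IsMF`. -/
structure LF (Q : Type u) [CommRing Q] (w : Q) where
  carrier : Type u
  [grp : AddCommGroup carrier]
  [mod : Module Q carrier]
  par : carrier →ₗ[Q] carrier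
  d : carrier →ₗ[Q] carrier
  par_par : ∀ x, par (par x) = x
  par_d : ∀ x, par (d x) = -d (par x)
  d_d : ∀ x, d (d x) = w • x

namespace LF

section Basic

variable {Q : Type u} [CommRing Q] {w : Q}

instance (X : LF Q w) : AddCommGroup X.carrier := X.grp
instance (X : LF Q w) : Module Q X.carrier := X.mod

/-- The even part `X⁰`. -/
def even (X : LF Q w) : Submodule Q X.carrier := LinearMap.ker (X.par - LinearMap.id)

/-- The odd part `X¹`. -/
def odd (X : LF Q w) : Submodule Q X.carrier := LinearMap.ker (X.par + LinearMap.id)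

theorem isCompl_even_odd [Algebra ℚ Q] (X : LF Q w) : IsCompl X.even X.odd := by
  have h2 : algebraMap ℚ Q (1 / 2) + algebraMap ℚ Q (1 / 2) = 1 := by
    rw [← map_add]; norm_num
  have key : ∀ x : X.carrier,
      algebraMap ℚ Q (1 / 2) • x + algebraMap ℚ Q (1 / 2) • x = x := fun x => by
    rw [← add_smul, h2, one_smul]
  constructor
  · rw [Submodule.disjoint_def]
    intro x hx hy
    simp only [even, odd, LinearMap.mem_ker, LinearMap.sub_apply, LinearMap.add_apply,
      LinearMap.id_apply] at hx hy
    have h : x + x = 0 := by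
      have h1 : X.par x = x := sub_eq_zero.1 hx
      rwa [h1] at hy
    rw [← key x, ← smul_add, h, smul_zero]
  · rw [codisjoint_iff, Submodule.eq_top_iff']
    intro x
    refine Submodule.mem_sup.2 ⟨algebraMap ℚ Q (1 / 2) • (x + X.par x), ?_,
      algebraMap ℚ Q (1 / 2) • (x - X.par x), ?_, ?_⟩
    · simp only [even, LinearMap.mem_ker, LinearMap.sub_apply, LinearMap.id_apply, map_smul,
        map_add, X.par_par]
      rw [sub_add_sub_cancel, sub_self, smul_zero]
    · simp only [odd, LinearMap.mem_ker, LinearMap.add_apply, LinearMap.id_apply, map_smul,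
        map_sub, X.par_par]
      rw [add_comm (X.par x) x, sub_self, smul_zero]
    · rw [← smul_add, add_add_sub_cancel, smul_add, key]

/-- Matrix factorisations: even and odd part are free modules (of arbitrary rank). -/
def IsMF (X : LF Q w) : Prop := Module.Free Q X.even ∧ Module.Free Q X.odd

/-- Matrix factorisations of finite rank. -/
def IsFiniteRankMF (X : LF Q w) : Prop :=
  X.IsMF ∧ Module.Finite Q X.even ∧ Module.Finite Q X.odd

/-- A morphism of factorisations: an even linear map commuting with the differentials. -/
@[ext] structure Hom (X Y : LF Q w) where
  lin : X.carrier →ₗ[Q] Y.carrier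
  par_comm : ∀ x, lin (X.par x) = Y.par (lin x)
  d_comm : ∀ x, lin (X.d x) = Y.d (lin x)

instance : Category (LF Q w) where
  Hom := Hom
  id X := ⟨LinearMap.id, fun _ => rfl, fun _ => rfl⟩
  comp f g := ⟨g.lin ∘ₗ f.lin, fun x => by simp [f.par_comm, g.par_comm],
    fun x => by simp [f.d_comm, g.d_comm]⟩

/-- The underlying linear map of a morphism. -/
def lin {X Y : LF Q w} (f : X ⟶ Y) : X.carrier →ₗ[Q] Y.carrier := Hom.lin f

theorem lin_par {X Y : LF Q w} (f : X ⟶ Y) (x : X.carrier) :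
    lin f (X.par x) = Y.par (lin f x) := Hom.par_comm f x

theorem lin_d {X Y : LF Q w} (f : X ⟶ Y) (x : X.carrier) :
    lin f (X.d x) = Y.d (lin f x) := Hom.d_comm f x

@[ext] theorem hom_ext {X Y : LF Q w} {f g : X ⟶ Y} (h : ∀ x, lin f x = lin g x) : f = g :=
  Hom.ext (LinearMap.ext h)

/-- Build a morphism from a linear map. -/
def mkHom {X Y : LF Q w} (l : X.carrier →ₗ[Q] Y.carrier)
    (hp : ∀ x, l (X.par x) = Y.par (l x)) (hd : ∀ x, l (X.d x) = Y.d (l x)) : X ⟶ Y :=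
  Hom.mk l hp hd

@[simp] theorem lin_mkHom {X Y : LF Q w} (l : X.carrier →ₗ[Q] Y.carrier) (hp) (hd) :
    lin (mkHom l hp hd : X ⟶ Y) = l := rfl

@[simp] theorem lin_id (X : LF Q w) : lin (𝟙 X) = LinearMap.id := rfl

@[simp] theorem lin_comp {X Y Z : LF Q w} (f : X ⟶ Y) (g : Y ⟶ Z) :
    lin (f ≫ g) = lin g ∘ₗ lin f := rfl

theorem lin_injective {X Y : LF Q w} :
    Function.Injective (lin : (X ⟶ Y) → (X.carrier →ₗ[Q] Y.carrier)) :=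
  fun _ _ h => Hom.ext h

instance (X Y : LF Q w) : Zero (X ⟶ Y) := ⟨mkHom 0 (by simp) (by simp)⟩
instance (X Y : LF Q w) : Add (X ⟶ Y) :=
  ⟨fun f g => mkHom (lin f + lin g) (by simp [lin_par]) (by simp [lin_d])⟩
instance (X Y : LF Q w) : Neg (X ⟶ Y) :=
  ⟨fun f => mkHom (-lin f) (by simp [lin_par]) (by simp [lin_d])⟩
instance (X Y : LF Q w) : Sub (X ⟶ Y) :=
  ⟨fun f g => mkHom (lin f - lin g) (by simp [lin_par]) (by simp [lin_d])⟩
instance (X Y : LF Q w) : SMul Q (X ⟶ Y) :=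
  ⟨fun c f => mkHom (c • lin f) (by simp [lin_par]) (by simp [lin_d])⟩
instance (X Y : LF Q w) : SMul ℕ (X ⟶ Y) :=
  ⟨fun c f => mkHom (c • lin f) (by simp [lin_par]) (by simp [lin_d])⟩
instance (X Y : LF Q w) : SMul ℤ (X ⟶ Y) :=
  ⟨fun c f => mkHom (c • lin f) (by simp [lin_par]) (by simp [lin_d])⟩

instance (X Y : LF Q w) : AddCommGroup (X ⟶ Y) :=
  lin_injective.addCommGroup lin rfl (fun _ _ => rfl) (fun _ => rfl) (fun _ _ => rfl)
    (fun _ _ => rfl) (fun _ _ => rfl)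

@[simp] theorem lin_add {X Y : LF Q w} (f g : X ⟶ Y) : lin (f + g) = lin f + lin g := rfl
@[simp] theorem lin_smul {X Y : LF Q w} (c : Q) (f : X ⟶ Y) : lin (c • f) = c • lin f := rfl

/-- `lin` as a homomorphism of additive groups. -/
def linAddHom (X Y : LF Q w) : (X ⟶ Y) →+ (X.carrier →ₗ[Q] Y.carrier) where
  toFun := lin
  map_zero' := rfl
  map_add' _ _ := rfl

instance (X Y : LF Q w) : Module Q (X ⟶ Y) :=
  lin_injective.module Q (linAddHom X Y) (fun _ _ => rfl)

instance : Preadditive (LF Q w) where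
  add_comp _ _ _ f f' g := by ext x; simp
  comp_add _ _ _ f g g' := by ext x; simp

instance : Linear Q (LF Q w) where
  smul_comp _ _ _ r f g := by ext x; simp
  comp_smul _ _ _ f r g := by ext x; simp

/-- `f` and `g` are homotopic: `g - f = d h + h d` for some odd linear map `h`. -/
def homotopic (Q : Type u) [CommRing Q] (w : Q) : HomRel (LF Q w) := fun X Y f g =>
  ∃ h : X.carrier →ₗ[Q] Y.carrier, (∀ x, h (X.par x) = -Y.par (h x)) ∧
    ∀ x, lin g x - lin f x = Y.d (h x) + h (X.d x)

instance : Congruence (homotopic Q w) where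
  equivalence {X Y} :=
    { refl := fun f => ⟨0, by simp, by simp⟩
      symm := by
        rintro f g ⟨h, hp, hd⟩
        refine ⟨-h, by simp [hp], fun x => ?_⟩
        rw [← neg_sub, hd x]; simp; abel
      trans := by
        rintro f g e ⟨h, hp, hd⟩ ⟨h', hp', hd'⟩
        refine ⟨h + h', fun x => by simp [hp, hp']; abel, fun x => ?_⟩
        rw [← sub_add_sub_cancel (lin e x) (lin g x), hd, hd']; simp; abel }
  comp_left := by
    rintro X Y Z f g g' ⟨h, hp, hd⟩
    exact ⟨h ∘ₗ lin f, fun x => by simp [lin_par, hp], fun x => by simp [hd, lin_d]⟩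
  comp_right := by
    rintro X Y Z f f' g ⟨h, hp, hd⟩
    refine ⟨lin g ∘ₗ h, fun x => by simp [lin_par, hp], fun x => ?_⟩
    simp only [lin_comp, LinearMap.comp_apply, ← map_sub, hd, map_add, lin_d]

end Basic

end LF

/-- The homotopy category of factorisations of `w`; `HMF(Q, w)` is its full subcategory on the
matrix factorisations. -/
abbrev HF (Q : Type u) [CommRing Q] (w : Q) := CategoryTheory.Quotient (LF.homotopic Q w)

namespace HF

variable {Q : Type u} [CommRing Q] {w : Q}

theorem homotopic_add ⦃X Y : LF Q w⦄ (f₁ f₂ g₁ g₂ : X ⟶ Y) (hf : LF.homotopic Q w f₁ f₂)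
    (hg : LF.homotopic Q w g₁ g₂) : LF.homotopic Q w (f₁ + g₁) (f₂ + g₂) := by
  obtain ⟨h, hp, hd⟩ := hf
  obtain ⟨h', hp', hd'⟩ := hg
  refine ⟨h + h', fun x => by simp [hp, hp']; abel, fun x => ?_⟩
  simp only [LF.lin_add, LinearMap.add_apply, add_sub_add_comm, hd, hd', map_add]
  abel

theorem homotopic_smul (r : Q) ⦃X Y : LF Q w⦄ (f₁ f₂ : X ⟶ Y) (hf : LF.homotopic Q w f₁ f₂) :
    LF.homotopic Q w (r • f₁) (r • f₂) := by
  obtain ⟨h, hp, hd⟩ := hf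
  refine ⟨r • h, fun x => by simp [hp], fun x => ?_⟩
  simp only [LF.lin_smul, LinearMap.smul_apply, ← smul_sub, hd, smul_add, map_smul]

instance : Preadditive (HF Q w) := Quotient.preadditive _ homotopic_add

instance : (CategoryTheory.Quotient.functor (LF.homotopic Q w)).Additive :=
  CategoryTheory.Quotient.functor_additive _ homotopic_add

instance : Linear Q (HF Q w) := Quotient.linear Q _ homotopic_smul

/-- The functor sending a morphism to its homotopy class. -/
abbrev cls (Q : Type u) [CommRing Q] (w : Q) : LF Q w ⥤ HF Q w :=
  CategoryTheory.Quotient.functor (LF.homotopic Q w)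

/-- `HMF(Q, w)`: matrix factorisations of arbitrary rank. -/
def isMF : ObjectProperty (HF Q w) := fun X => X.as.IsMF

/-- `hmf(Q, w)`: matrix factorisations of finite rank. -/
def isFiniteRankMF : ObjectProperty (HF Q w) := fun X => X.as.IsFiniteRankMF

/-- The idempotent closure `hmf(Q, w)^ω` of `hmf(Q, w)` in `HMF(Q, w)`: matrix factorisations
which are direct summands, up to homotopy, of matrix factorisations of finite rank. -/
def isSummandMF : ObjectProperty (HF Q w) := fun X =>
  isMF X ∧ ∃ Y : HF Q w, isFiniteRankMF Y ∧ Nonempty (Retract X Y)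

/-- A functor preserving homotopies descends to homotopy categories. -/
def descend {Z : Type u} [CommRing Z] {z : Z} (F : LF Q w ⥤ LF Z z)
    (hF : ∀ (X Y : LF Q w) (f g : X ⟶ Y), LF.homotopic Q w f g →
      LF.homotopic Z z (F.map f) (F.map g)) : HF Q w ⥤ HF Z z :=
  CategoryTheory.Quotient.lift _ (F ⋙ cls Z z) fun X Y f g h =>
    CategoryTheory.Quotient.sound _ (hF X Y f g h)

end HF

/-! ## Restriction of scalars and twists -/

namespace LF

section Res

variable {Q Z : Type u} [CommRing Q] [CommRing Z] {w : Q} {z : Z}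

/-- Restriction of scalars along `f : Z → Q` with `f z = w`: the same abelian group with the same
differential, and `Z` acting through `f`. -/
def res (f : Z →+* Q) (hf : f z = w) (X : LF Q w) : LF Z z where
  carrier := X.carrier
  grp := X.grp
  mod := Module.compHom X.carrier f
  par := @LinearMap.mk Z Z _ _ (RingHom.id Z) X.carrier X.carrier _ _ (Module.compHom _ f)
    (Module.compHom _ f) X.par.toAddHom (fun r x => X.par.map_smul (f r) x)
  d := @LinearMap.mk Z Z _ _ (RingHom.id Z) X.carrier X.carrier _ _ (Module.compHom _ f)
    (Module.compHom _ f) X.d.toAddHom (fun r x => X.d.map_smul (f r) x)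
  par_par := X.par_par
  par_d := X.par_d
  d_d x := by
    change X.d (X.d x) = f z • x
    rw [X.d_d, hf]

/-- A `Q`-linear map is `Z`-linear. -/
def resLin (f : Z →+* Q) (hf : f z = w) {X Y : LF Q w} (l : X.carrier →ₗ[Q] Y.carrier) :
    (res f hf X).carrier →ₗ[Z] (res f hf Y).carrier where
  toFun x := l x
  map_add' x y := l.map_add x y
  map_smul' r x := l.map_smul (f r) x

/-- Restriction of scalars as a functor. -/
def resFunctor (f : Z →+* Q) (hf : f z = w) : LF Q w ⥤ LF Z z where
  obj X := res f hf X
  map φ := mkHom (resLin f hf (lin φ)) (fun x => lin_par φ x) (fun x => lin_d φ x)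

end Res

end LF

/-- Restriction of scalars on homotopy categories. -/
def HF.res {Q Z : Type u} [CommRing Q] [CommRing Z] {w : Q} {z : Z} (f : Z →+* Q) (hf : f z = w) :
    HF Q w ⥤ HF Z z :=
  HF.descend (LF.resFunctor f hf) fun _ _ _ _ ⟨h, hp, hd⟩ => ⟨LF.resLin f hf h, hp, hd⟩

/-! ## Composition of defects

A defect between `(C, W)` and `(S, V)` is a factorisation of `V ⊗ 1 - 1 ⊗ W` over `S ⊗ C`. -/

/-- The difference potential `V ⊗ 1 - 1 ⊗ W` in `S ⊗ C`. -/
def potDiff (k : Type u) [CommRing k] {S C : Type u} [CommRing S] [CommRing C] [Algebra k S]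
    [Algebra k C] (V : S) (W : C) : S ⊗[k] C := V ⊗ₜ 1 - 1 ⊗ₜ W

namespace LF

section Tensor

variable {k : Type u} [CommRing k]
variable {T S C B : Type u} [CommRing T] [CommRing S] [CommRing C] [CommRing B]
variable [Algebra k T] [Algebra k S] [Algebra k C] [Algebra k B]

/-- The abelian group underlying `D`, as a module over the right-hand ring `S`. -/
def Rt {w : T ⊗[k] S} (D : LF (T ⊗[k] S) w) : Type u := D.carrier

/-- The abelian group underlying `X`, as a module over the left-hand ring `S`. -/
def Lt {w : S ⊗[k] C} (X : LF (S ⊗[k] C) w) : Type u := X.carrier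

section
variable {w : T ⊗[k] S} (D : LF (T ⊗[k] S) w)

instance : AddCommGroup D.Rt := D.grp

instance : Module S D.Rt :=
  Module.compHom D.carrier (Algebra.TensorProduct.includeRight : S →ₐ[k] T ⊗[k] S).toRingHom

theorem Rt_smul (s : S) (y : D.carrier) :
    (show D.carrier from s • (show D.Rt from y)) = ((1 : T) ⊗ₜ[k] s) • y := rfl

/-- An additive map commuting with the action of `T ⊗ S` is linear over `S`. -/
def rtLin {w' : T ⊗[k] S} {D' : LF (T ⊗[k] S) w'} (l : D.carrier →ₗ[T ⊗[k] S] D'.carrier) :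
    D.Rt →ₗ[S] D'.Rt where
  toFun y := l y
  map_add' x y := l.map_add x y
  map_smul' s x := l.map_smul (1 ⊗ₜ s) x

/-- Multiplication by `a : T ⊗ S`. -/
def rtMul (a : T ⊗[k] S) : D.Rt →ₗ[S] D.Rt := D.rtLin (LinearMap.lsmul (T ⊗[k] S) D.carrier a)

end

section
variable {w : S ⊗[k] C} (X : LF (S ⊗[k] C) w)

instance : AddCommGroup X.Lt := X.grp

instance : Module S X.Lt :=
  Module.compHom X.carrier (Algebra.TensorProduct.includeLeft : S →ₐ[k] S ⊗[k] C).toRingHom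

theorem Lt_smul (s : S) (x : X.carrier) :
    (show X.carrier from s • (show X.Lt from x)) = (s ⊗ₜ[k] (1 : C)) • x := rfl

/-- An additive map commuting with the action of `S ⊗ C` is linear over `S`. -/
def ltLin {w' : S ⊗[k] C} {X' : LF (S ⊗[k] C) w'} (l : X.carrier →ₗ[S ⊗[k] C] X'.carrier) :
    X.Lt →ₗ[S] X'.Lt where
  toFun x := l x
  map_add' x y := l.map_add x y
  map_smul' s x := l.map_smul (s ⊗ₜ 1) x

/-- Multiplication by `a : S ⊗ C`. -/
def ltMul (a : S ⊗[k] C) : X.Lt →ₗ[S] X.Lt := X.ltLin (LinearMap.lsmul (S ⊗[k] C) X.carrier a)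

end

variable {U : T} {V : S} {W : C}

/-- The abelian group `D ⊗_S X`. -/
abbrev Ten (D : LF (T ⊗[k] S) (potDiff k U V)) (X : LF (S ⊗[k] C) (potDiff k V W)) : Type u :=
  D.Rt ⊗[S] X.Lt

/-- The pure tensor `y ⊗ x` in `D ⊗_S X`. -/
def pt {D : LF (T ⊗[k] S) (potDiff k U V)} {X : LF (S ⊗[k] C) (potDiff k V W)}
    (y : D.carrier) (x : X.carrier) : Ten D X := (show D.Rt from y) ⊗ₜ[S] (show X.Lt from x)

section
variable (D : LF (T ⊗[k] S) (potDiff k U V)) (X : LF (S ⊗[k] C) (potDiff k V W))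

theorem algebraMap_tmul_one (c : k) :
    (algebraMap k T c) ⊗ₜ[k] (1 : S) = (1 : T) ⊗ₜ[k] (algebraMap k S c) := by
  rw [Algebra.algebraMap_eq_smul_one, Algebra.algebraMap_eq_smul_one, TensorProduct.smul_tmul]

/-- The ring `T ⊗ C` acts on `D ⊗_S X` by `(t ⊗ c) (y ⊗ x) = t y ⊗ c x`. -/
def tenAct : T ⊗[k] C →+* Module.End S (Ten D X) := by
  letI : Algebra k (Module.End S (Ten D X)) :=
    RingHom.toAlgebra' ((algebraMap S (Module.End S (Ten D X))).comp (algebraMap k S))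
      (fun c x => Algebra.commutes (algebraMap k S c) x)
  refine (Algebra.TensorProduct.lift (A := T) (B := C) (S := k)
    { toFun := fun t => (D.rtMul (t ⊗ₜ 1)).rTensor X.Lt
      map_one' := ?_, map_mul' := ?_, map_zero' := ?_, map_add' := ?_, commutes' := ?_ }
    { toFun := fun c => (X.ltMul (1 ⊗ₜ c)).lTensor D.Rt
      map_one' := ?_, map_mul' := ?_, map_zero' := ?_, map_add' := ?_, commutes' := ?_ }
    ?_ : T ⊗[k] C →ₐ[k] Module.End S (Ten D X)).toRingHom
  · refine TensorProduct.ext' fun y x => ?_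
    exact congrArg (fun e : D.Rt => e ⊗ₜ[S] x) (one_smul (T ⊗[k] S) (show D.carrier from y))
  · intro a b
    refine TensorProduct.ext' fun y x => ?_
    refine congrArg (fun e : D.Rt => e ⊗ₜ[S] x) ?_
    change ((a * b) ⊗ₜ[k] (1 : S)) • (show D.carrier from y) =
      (a ⊗ₜ[k] (1 : S)) • (b ⊗ₜ[k] (1 : S)) • (show D.carrier from y)
    rw [smul_smul, Algebra.TensorProduct.tmul_mul_tmul, one_mul]
  · refine TensorProduct.ext' fun y x => ?_
    change (show D.Rt from ((0 : T) ⊗ₜ[k] (1 : S)) • (show D.carrier from y)) ⊗ₜ[S] x = 0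
    rw [TensorProduct.zero_tmul, zero_smul]
    exact TensorProduct.zero_tmul _ _
  · intro a b
    refine TensorProduct.ext' fun y x => ?_
    change (show D.Rt from ((a + b) ⊗ₜ[k] (1 : S)) • (show D.carrier from y)) ⊗ₜ[S] x =
      (show D.Rt from (a ⊗ₜ[k] (1 : S)) • (show D.carrier from y)) ⊗ₜ[S] x +
      (show D.Rt from (b ⊗ₜ[k] (1 : S)) • (show D.carrier from y)) ⊗ₜ[S] x
    rw [TensorProduct.add_tmul, add_smul]
    exact TensorProduct.add_tmul _ _ _
  · intro c
    refine TensorProduct.ext' fun y x => ?_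
    change (show D.Rt from ((algebraMap k T c) ⊗ₜ[k] (1 : S)) • (show D.carrier from y)) ⊗ₜ[S] x =
      (algebraMap k S c) • (y ⊗ₜ[S] x)
    rw [algebraMap_tmul_one]
    rfl
  · refine TensorProduct.ext' fun y x => ?_
    exact congrArg (fun e : X.Lt => y ⊗ₜ[S] e) (one_smul (S ⊗[k] C) (show X.carrier from x))
  · intro a b
    refine TensorProduct.ext' fun y x => ?_
    refine congrArg (fun e : X.Lt => y ⊗ₜ[S] e) ?_
    change ((1 : S) ⊗ₜ[k] (a * b)) • (show X.carrier from x) =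
      ((1 : S) ⊗ₜ[k] a) • ((1 : S) ⊗ₜ[k] b) • (show X.carrier from x)
    rw [smul_smul, Algebra.TensorProduct.tmul_mul_tmul, one_mul]
  · refine TensorProduct.ext' fun y x => ?_
    change y ⊗ₜ[S] (show X.Lt from ((1 : S) ⊗ₜ[k] (0 : C)) • (show X.carrier from x)) = 0
    rw [TensorProduct.tmul_zero, zero_smul]
    exact TensorProduct.tmul_zero _ _
  · intro a b
    refine TensorProduct.ext' fun y x => ?_
    change y ⊗ₜ[S] (show X.Lt from ((1 : S) ⊗ₜ[k] (a + b)) • (show X.carrier from x)) =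
      y ⊗ₜ[S] (show X.Lt from ((1 : S) ⊗ₜ[k] a) • (show X.carrier from x)) +
      y ⊗ₜ[S] (show X.Lt from ((1 : S) ⊗ₜ[k] b) • (show X.carrier from x))
    rw [TensorProduct.tmul_add, add_smul]
    exact TensorProduct.tmul_add _ _ _
  · intro c
    refine TensorProduct.ext' fun y x => ?_
    change y ⊗ₜ[S] (show X.Lt from ((1 : S) ⊗ₜ[k] (algebraMap k C c)) • (show X.carrier from x)) =
      (algebraMap k S c) • (y ⊗ₜ[S] x)
    rw [← algebraMap_tmul_one, ← TensorProduct.tmul_smul]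
    rfl
  · intro t c
    refine TensorProduct.ext' fun y x => ?_
    rfl

theorem tenAct_pt (t : T) (c : C) (y : D.carrier) (x : X.carrier) :
    tenAct D X (t ⊗ₜ c) (pt y x) = pt ((t ⊗ₜ[k] (1 : S)) • y) (((1 : S) ⊗ₜ[k] c) • x) := by
  let _ : Algebra k (Module.End S (Ten D X)) :=
    RingHom.toAlgebra' ((algebraMap S (Module.End S (Ten D X))).comp (algebraMap k S))
      (fun c x => Algebra.commutes (algebraMap k S c) x)
  unfold tenAct
  exact congrArg (fun l : Module.End S (Ten D X) => l (pt y x))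
    (Algebra.TensorProduct.lift_tmul _ _ _ t c)

end

variable {D : LF (T ⊗[k] S) (potDiff k U V)} {X : LF (S ⊗[k] C) (potDiff k V W)}

theorem pt_add_left (y y' : D.carrier) (x : X.carrier) :
    pt (y + y') x = pt y x + pt y' x := TensorProduct.add_tmul _ _ _

theorem pt_add_right (y : D.carrier) (x x' : X.carrier) :
    pt y (x + x') = pt y x + pt y x' := TensorProduct.tmul_add _ _ _

theorem pt_neg_left (y : D.carrier) (x : X.carrier) : pt (-y) x = -pt y x :=
  TensorProduct.neg_tmul _ _

theorem pt_neg_right (y : D.carrier) (x : X.carrier) : pt y (-x) = -pt y x :=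
  TensorProduct.tmul_neg _ _

theorem pt_sub_left (y y' : D.carrier) (x : X.carrier) :
    pt (y - y') x = pt y x - pt y' x := TensorProduct.sub_tmul _ _ _

theorem pt_sub_right (y : D.carrier) (x x' : X.carrier) :
    pt y (x - x') = pt y x - pt y x' := TensorProduct.tmul_sub _ _ _

theorem pt_zero_left (x : X.carrier) : (pt (0 : D.carrier) x : Ten D X) = 0 :=
  TensorProduct.zero_tmul _ _

theorem pt_zero_right (y : D.carrier) : (pt y (0 : X.carrier) : Ten D X) = 0 :=
  TensorProduct.tmul_zero _ _

/-- The tensor product is balanced over `S`. -/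
theorem pt_balanced (s : S) (y : D.carrier) (x : X.carrier) :
    pt (((1 : T) ⊗ₜ[k] s) • y) x = pt y ((s ⊗ₜ[k] (1 : C)) • x) :=
  TensorProduct.smul_tmul s (show D.Rt from y) (show X.Lt from x)

@[elab_as_elim] theorem Ten.induction {p : Ten D X → Prop} (e : Ten D X) (zero : p 0)
    (pure : ∀ y x, p (pt y x)) (add : ∀ a b, p a → p b → p (a + b)) : p e :=
  TensorProduct.induction_on e zero pure add

theorem Ten.addHom_ext {M : Type u} [AddCommGroup M] {f g : Ten D X →+ M}
    (h : ∀ y x, f (pt y x) = g (pt y x)) : f = g := by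
  ext e
  refine Ten.induction e (by simp) h (fun a b ha hb => by simp [ha, hb])

/-- Additive maps out of `D ⊗_S X` from balanced biadditive maps. -/
def Ten.lift {M : Type u} [AddCommGroup M] (f : D.carrier → X.carrier → M)
    (h₁ : ∀ y y' x, f (y + y') x = f y x + f y' x) (h₂ : ∀ y x x', f y (x + x') = f y x + f y x')
    (h₃ : ∀ (s : S) y x, f (((1 : T) ⊗ₜ[k] s) • y) x = f y ((s ⊗ₜ[k] (1 : C)) • x)) :
    Ten D X →+ M :=
  TensorProduct.liftAddHom (R := S) (M := D.Rt) (N := X.Lt)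
    (AddMonoidHom.mk' (fun y => AddMonoidHom.mk' (f y) (h₂ y))
      fun y y' => AddMonoidHom.ext fun x => h₁ y y' x)
    (fun s y x => h₃ s y x)

theorem Ten.lift_pt {M : Type u} [AddCommGroup M] (f : D.carrier → X.carrier → M) (h₁) (h₂) (h₃)
    (y : D.carrier) (x : X.carrier) : Ten.lift f h₁ h₂ h₃ (pt y x) = f y x := rfl

variable (D X)

/-- The additive endomorphism `f ⊗ g` of `D ⊗_S X`. -/
def tenMap {D' : LF (T ⊗[k] S) (potDiff k U V)} {X' : LF (S ⊗[k] C) (potDiff k V W)}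
    (f : D.carrier →ₗ[T ⊗[k] S] D'.carrier) (g : X.carrier →ₗ[S ⊗[k] C] X'.carrier) :
    Ten D X →ₗ[S] Ten D' X' :=
  TensorProduct.map (D.rtLin f) (X.ltLin g)

theorem tenMap_pt {D' : LF (T ⊗[k] S) (potDiff k U V)} {X' : LF (S ⊗[k] C) (potDiff k V W)}
    (f : D.carrier →ₗ[T ⊗[k] S] D'.carrier) (g : X.carrier →ₗ[S ⊗[k] C] X'.carrier)
    (y : D.carrier) (x : X.carrier) : tenMap D X f g (pt y x) = pt (f y) (g x) := rfl

theorem tenMap_act {D' : LF (T ⊗[k] S) (potDiff k U V)} {X' : LF (S ⊗[k] C) (potDiff k V W)}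
    (f : D.carrier →ₗ[T ⊗[k] S] D'.carrier) (g : X.carrier →ₗ[S ⊗[k] C] X'.carrier)
    (r : T ⊗[k] C) (e : Ten D X) :
    tenMap D X f g (tenAct D X r e) = tenAct D' X' r (tenMap D X f g e) := by
  induction r using TensorProduct.induction_on with
  | zero => simp
  | add a b ha hb => simp only [map_add, LinearMap.add_apply, ha, hb]
  | tmul t c =>
    refine Ten.induction e (by simp) (fun y x => ?_) fun a b ha hb => by simp only [map_add, ha, hb]
    simp only [tenAct_pt, tenMap_pt, map_smul]

theorem potDiff_smul {M : Type u} [AddCommGroup M] [Module (T ⊗[k] S) M] (U : T) (V : S) (y : M) :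
    potDiff k U V • y = (U ⊗ₜ[k] (1 : S)) • y - ((1 : T) ⊗ₜ[k] V) • y := sub_smul _ _ _

theorem tenAct_potDiff (y : D.carrier) (x : X.carrier) :
    tenAct D X (potDiff k U W) (pt y x) =
      pt ((U ⊗ₜ[k] (1 : S)) • y) x - pt y (((1 : S) ⊗ₜ[k] W) • x) := by
  have h : tenAct D X (potDiff k U W) = tenAct D X (U ⊗ₜ 1) - tenAct D X (1 ⊗ₜ W) :=
    map_sub _ _ _
  have h1 : ((1 : S) ⊗ₜ[k] (1 : C)) • x = x := one_smul _ x
  have h2 : ((1 : T) ⊗ₜ[k] (1 : S)) • y = y := one_smul _ y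
  rw [h, LinearMap.sub_apply, tenAct_pt, tenAct_pt, h1, h2]

/-- The tensor product `D ⊗ X` of defects, i.e. `D ⊗_S X` with differential `d ⊗ 1 + 1 ⊗ d`
(with the Koszul sign `(1 ⊗ d) (y ⊗ x) = (-1)^|y| y ⊗ d x`). -/
def tensor : LF (T ⊗[k] C) (potDiff k U W) where
  carrier := Ten D X
  mod := Module.compHom (Ten D X) (tenAct D X)
  par := @LinearMap.mk (T ⊗[k] C) (T ⊗[k] C) _ _ (RingHom.id _) (Ten D X) (Ten D X) _ _
    (Module.compHom _ (tenAct D X)) (Module.compHom _ (tenAct D X))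
    (tenMap D X D.par X.par).toAddHom (fun r x => tenMap_act D X _ _ r x)
  d := @LinearMap.mk (T ⊗[k] C) (T ⊗[k] C) _ _ (RingHom.id _) (Ten D X) (Ten D X) _ _
    (Module.compHom _ (tenAct D X)) (Module.compHom _ (tenAct D X))
    (tenMap D X D.d LinearMap.id + tenMap D X D.par X.d).toAddHom
    (fun r x => by
      change tenMap D X _ _ (tenAct D X r x) + tenMap D X _ _ (tenAct D X r x) =
        tenAct D X r (tenMap D X _ _ x + tenMap D X _ _ x)
      rw [tenMap_act, tenMap_act, map_add])
  par_par := fun (e : Ten D X) => by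
    change tenMap D X _ _ (tenMap D X _ _ e) = e
    refine Ten.induction e (by simp) (fun y x => ?_) fun a b ha hb => by simp only [map_add, ha, hb]
    simp only [tenMap_pt, D.par_par, X.par_par]
  par_d := fun (e : Ten D X) => by
    change tenMap D X _ _ (tenMap D X _ _ e + tenMap D X _ _ e) =
      -(tenMap D X _ _ (tenMap D X _ _ e) + tenMap D X _ _ (tenMap D X _ _ e))
    refine Ten.induction e (by simp) (fun y x => ?_) fun a b ha hb => ?_
    · simp only [tenMap_pt, map_add, D.par_d, X.par_d, pt_neg_left, pt_neg_right,
        LinearMap.id_apply, D.par_par]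
      abel
    · simp only [map_add, neg_add_rev] at ha hb ⊢
      rw [show ∀ p q r s : Ten D X, p + q + (r + s) = (p + r) + (q + s) from
        fun p q r s => by abel, ha, hb]
      abel
  d_d := fun (e : Ten D X) => by
    change tenMap D X _ _ (tenMap D X _ _ e + tenMap D X _ _ e) +
      tenMap D X _ _ (tenMap D X _ _ e + tenMap D X _ _ e) = tenAct D X (potDiff k U W) e
    refine Ten.induction e (by simp) (fun y x => ?_) fun a b ha hb => ?_
    · simp only [tenMap_pt, map_add, D.par_d, pt_neg_left, LinearMap.id_apply, D.par_par,
        D.d_d, X.d_d, potDiff_smul, tenAct_potDiff, pt_sub_left, pt_sub_right, pt_balanced]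
      abel
    · simp only [map_add] at ha hb ⊢
      rw [← ha, ← hb]
      abel

variable {D X}

theorem smul_pt (t : T) (c : C) (y : D.carrier) (x : X.carrier) :
    (t ⊗ₜ[k] c) • (show (tensor D X).carrier from pt y x) =
      (show (tensor D X).carrier from pt ((t ⊗ₜ[k] (1 : S)) • y) (((1 : S) ⊗ₜ[k] c) • x)) :=
  tenAct_pt D X t c y x

theorem par_pt (y : D.carrier) (x : X.carrier) :
    (tensor D X).par (pt y x) = pt (D.par y) (X.par x) := rfl

theorem d_pt (y : D.carrier) (x : X.carrier) :
    (tensor D X).d (pt y x) = (show (tensor D X).carrier from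
      pt (D.d y) x + pt (D.par y) (X.d x)) := rfl

/-- `f ⊗ g` as a `T ⊗ C`-linear map. -/
def tenLin {D' : LF (T ⊗[k] S) (potDiff k U V)} {X' : LF (S ⊗[k] C) (potDiff k V W)}
    (f : D.carrier →ₗ[T ⊗[k] S] D'.carrier) (g : X.carrier →ₗ[S ⊗[k] C] X'.carrier) :
    (tensor D X).carrier →ₗ[T ⊗[k] C] (tensor D' X').carrier where
  toFun := tenMap D X f g
  map_add' a b := (tenMap D X f g).map_add a b
  map_smul' r e := tenMap_act D X f g r e

/-- Build a morphism out of `D ⊗ X` from a balanced biadditive map compatible with all structure. -/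
def tenDesc {Y : LF (T ⊗[k] C) (potDiff k U W)} (f : D.carrier → X.carrier → Y.carrier)
    (h₁ : ∀ y y' x, f (y + y') x = f y x + f y' x) (h₂ : ∀ y x x', f y (x + x') = f y x + f y x')
    (h₃ : ∀ (s : S) y x, f (((1 : T) ⊗ₜ[k] s) • y) x = f y ((s ⊗ₜ[k] (1 : C)) • x))
    (h₄ : ∀ (t : T) (c : C) y x,
      f ((t ⊗ₜ[k] (1 : S)) • y) (((1 : S) ⊗ₜ[k] c) • x) = (t ⊗ₜ[k] c) • f y x)
    (hp : ∀ y x, f (D.par y) (X.par x) = Y.par (f y x))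
    (hd : ∀ y x, f (D.d y) x + f (D.par y) (X.d x) = Y.d (f y x)) : tensor D X ⟶ Y :=
  mkHom
    { toFun := Ten.lift f h₁ h₂ h₃
      map_add' := (Ten.lift f h₁ h₂ h₃).map_add
      map_smul' := fun r (e : Ten D X) => by
        change Ten.lift f h₁ h₂ h₃ (tenAct D X r e) = r • Ten.lift f h₁ h₂ h₃ e
        induction r using TensorProduct.induction_on with
        | zero => simp
        | add a b ha hb => simp only [map_add, LinearMap.add_apply, ha, hb, add_smul]
        | tmul t c =>
          refine Ten.induction e (by simp) (fun y x => ?_)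
            fun a b ha hb => by simp only [map_add, ha, hb, smul_add]
          rw [tenAct_pt, Ten.lift_pt, Ten.lift_pt, h₄] }
    (fun (e : Ten D X) => by
      change Ten.lift f h₁ h₂ h₃ (tenMap D X _ _ e) = Y.par (Ten.lift f h₁ h₂ h₃ e)
      refine Ten.induction e (by simp) (fun y x => hp y x)
        fun a b ha hb => by simp only [map_add, ha, hb])
    (fun (e : Ten D X) => by
      change Ten.lift f h₁ h₂ h₃ (tenMap D X _ _ e + tenMap D X _ _ e) =
        Y.d (Ten.lift f h₁ h₂ h₃ e)
      refine Ten.induction e (by simp) (fun y x => ?_) fun a b ha hb => ?_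
      · rw [map_add]; exact hd y x
      · simp only [map_add] at ha hb ⊢
        rw [← ha, ← hb]; abel)

theorem tenDesc_pt {Y : LF (T ⊗[k] C) (potDiff k U W)} (f : D.carrier → X.carrier → Y.carrier)
    (h₁) (h₂) (h₃) (h₄) (hp) (hd) (y : D.carrier) (x : X.carrier) :
    lin (tenDesc f h₁ h₂ h₃ h₄ hp hd) (pt y x) = f y x := rfl

/-- `f ⊗ g : D ⊗ X ⟶ D' ⊗ X'`. -/
def tensorHom {D' : LF (T ⊗[k] S) (potDiff k U V)} {X' : LF (S ⊗[k] C) (potDiff k V W)}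
    (f : D ⟶ D') (g : X ⟶ X') : tensor D X ⟶ tensor D' X' :=
  mkHom (tenLin (lin f) (lin g))
    (fun (e : Ten D X) => by
      change tenMap D X _ _ (tenMap D X _ _ e) = tenMap D' X' _ _ (tenMap D X _ _ e)
      refine Ten.induction e (by simp) (fun y x => ?_)
        fun a b ha hb => by simp only [map_add, ha, hb]
      simp only [tenMap_pt, lin_par])
    (fun (e : Ten D X) => by
      change tenMap D X _ _ (tenMap D X _ _ e + tenMap D X _ _ e) =
        tenMap D' X' _ _ (tenMap D X _ _ e) + tenMap D' X' _ _ (tenMap D X _ _ e)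
      refine Ten.induction e (by simp) (fun y x => ?_) fun a b ha hb => ?_
      · simp only [map_add, tenMap_pt, lin_par, lin_d, LinearMap.id_apply]
      · simp only [map_add] at ha hb ⊢
        rw [add_add_add_comm, ha, hb]; abel)

variable (D X)

/-- The functor `D ⊗ (-)`. -/
def tensorLeft : LF (S ⊗[k] C) (potDiff k V W) ⥤ LF (T ⊗[k] C) (potDiff k U W) where
  obj X := tensor D X
  map g := tensorHom (𝟙 D) g
  map_id X := by
    refine hom_ext fun (e : Ten _ _) => ?_
    change tenMap D X _ _ e = e
    exact Ten.induction e (by simp) (fun _ _ => rfl) fun a b ha hb => by simp only [map_add, ha, hb]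
  map_comp {X Y Z} f g := by
    refine hom_ext fun (e : Ten _ _) => ?_
    change tenMap D X _ _ e = tenMap D Y _ _ (tenMap D X _ _ e)
    exact Ten.induction e (by simp) (fun _ _ => rfl) fun a b ha hb => by simp only [map_add, ha, hb]

/-- The functor `(-) ⊗ X`. -/
def tensorRight : LF (T ⊗[k] S) (potDiff k U V) ⥤ LF (T ⊗[k] C) (potDiff k U W) where
  obj D := tensor D X
  map f := tensorHom f (𝟙 X)
  map_id D := by
    refine hom_ext fun (e : Ten _ _) => ?_
    change tenMap D X _ _ e = e
    exact Ten.induction e (by simp) (fun _ _ => rfl) fun a b ha hb => by simp only [map_add, ha, hb]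
  map_comp {D E F} f g := by
    refine hom_ext fun (e : Ten _ _) => ?_
    change tenMap D X _ _ e = tenMap E X _ _ (tenMap D X _ _ e)
    exact Ten.induction e (by simp) (fun _ _ => rfl) fun a b ha hb => by simp only [map_add, ha, hb]

end Tensor

end LF

namespace HF

variable {k : Type u} [CommRing k]
variable {T S C : Type u} [CommRing T] [CommRing S] [CommRing C]
variable [Algebra k T] [Algebra k S] [Algebra k C] {U : T} {V : S} {W : C}

/-- The functor `D ⊗ (-)` on homotopy categories. -/
def tensorLeft (D : LF (T ⊗[k] S) (potDiff k U V)) :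
    HF (S ⊗[k] C) (potDiff k V W) ⥤ HF (T ⊗[k] C) (potDiff k U W) :=
  HF.descend (LF.tensorLeft D) fun X Y f g ⟨h, hp, hd⟩ =>
    ⟨LF.tenLin D.par h,
      fun (e : LF.Ten _ _) => by
        change LF.tenMap D X _ _ (LF.tenMap D X _ _ e) = -LF.tenMap D Y _ _ (LF.tenMap D X _ _ e)
        refine LF.Ten.induction e (by simp) (fun y x => ?_)
          fun a b ha hb => by simp only [map_add, ha, hb, neg_add]
        simp only [LF.tenMap_pt, hp, LF.pt_neg_right],
      fun (e : LF.Ten _ _) => by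
        suffices H : LF.tenMap D X LinearMap.id (LF.lin g) e -
            LF.tenMap D X LinearMap.id (LF.lin f) e =
          (LF.tenMap D Y D.d LinearMap.id (LF.tenMap D X D.par h e) +
            LF.tenMap D Y D.par Y.d (LF.tenMap D X D.par h e)) +
          LF.tenMap D X D.par h (LF.tenMap D X D.d LinearMap.id e + LF.tenMap D X D.par X.d e)
          from H
        refine LF.Ten.induction e (by simp) (fun y x => ?_) fun a b ha hb => ?_
        · simp only [map_add, LF.tenMap_pt, ← LF.pt_sub_right, hd, LinearMap.id_apply, D.par_par,
            D.par_d, LF.pt_add_right, LF.pt_neg_left]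
          abel
        · simp only [map_add] at ha hb ⊢
          rw [add_sub_add_comm, ha, hb]; abel⟩

/-- The functor `(-) ⊗ X` on homotopy categories. -/
def tensorRight (X : LF (S ⊗[k] C) (potDiff k V W)) :
    HF (T ⊗[k] S) (potDiff k U V) ⥤ HF (T ⊗[k] C) (potDiff k U W) :=
  HF.descend (LF.tensorRight X) fun D E f g ⟨h, hp, hd⟩ =>
    ⟨LF.tenLin h LinearMap.id,
      fun (e : LF.Ten _ _) => by
        change LF.tenMap D X _ _ (LF.tenMap D X _ _ e) = -LF.tenMap E X _ _ (LF.tenMap D X _ _ e)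
        refine LF.Ten.induction e (by simp) (fun y x => ?_)
          fun a b ha hb => by simp only [map_add, ha, hb, neg_add]
        simp only [LF.tenMap_pt, hp, LF.pt_neg_left, LinearMap.id_apply],
      fun (e : LF.Ten _ _) => by
        suffices H : LF.tenMap D X (LF.lin g) LinearMap.id e -
            LF.tenMap D X (LF.lin f) LinearMap.id e =
          (LF.tenMap E X E.d LinearMap.id (LF.tenMap D X h LinearMap.id e) +
            LF.tenMap E X E.par X.d (LF.tenMap D X h LinearMap.id e)) +
          LF.tenMap D X h LinearMap.id
            (LF.tenMap D X D.d LinearMap.id e + LF.tenMap D X D.par X.d e)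
          from H
        refine LF.Ten.induction e (by simp) (fun y x => ?_) fun a b ha hb => ?_
        · simp only [map_add, LF.tenMap_pt, ← LF.pt_sub_left, hd, LinearMap.id_apply, hp,
            LF.pt_add_left, LF.pt_neg_left]
          abel
        · simp only [map_add] at ha hb ⊢
          rw [add_sub_add_comm, ha, hb]; abel⟩

end HF

/-! ## Associator -/

namespace LF

section Assoc

variable {k : Type u} [CommRing k]
variable {T S C B : Type u} [CommRing T] [CommRing S] [CommRing C] [CommRing B]
variable [Algebra k T] [Algebra k S] [Algebra k C] [Algebra k B]
variable {U : T} {V : S} {W : C} {P : B}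

theorem one_tmul_one_smul {M : Type u} [AddCommGroup M] [Module (T ⊗[k] S) M] (x : M) :
    ((1 : T) ⊗ₜ[k] (1 : S)) • x = x := one_smul _ x

theorem Ten.lift_map_add {D : LF (T ⊗[k] S) (potDiff k U V)} {X : LF (S ⊗[k] C) (potDiff k V W)}
    {M : Type u} [AddCommGroup M] (f : D.carrier → X.carrier → M) (h₁) (h₂) (h₃) (a b : Ten D X) :
    Ten.lift f h₁ h₂ h₃ (a + b) = Ten.lift f h₁ h₂ h₃ a + Ten.lift f h₁ h₂ h₃ b := map_add _ _ _

variable (D : LF (T ⊗[k] S) (potDiff k U V)) (E : LF (S ⊗[k] C) (potDiff k V W))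
  (X : LF (C ⊗[k] B) (potDiff k W P))

/-- `(- ⊗ -) ⊗ x ↦ - ⊗ (- ⊗ x)` for fixed `x`. -/
def assocAux (x : X.carrier) : Ten D E →+ Ten D (tensor E X) :=
  Ten.lift (fun y e => pt (X := tensor E X) y (show (tensor E X).carrier from pt e x))
    (fun y y' e => pt_add_left y y' _)
    (fun y e e' => by
      rw [← pt_add_right]
      exact congrArg (fun z => pt (X := tensor E X) y z) (pt_add_left e e' x))
    (fun s y e => by
      rw [pt_balanced]
      refine congrArg (fun z => pt (X := tensor E X) y z) ?_
      rw [smul_pt, one_tmul_one_smul])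

theorem assocAux_pt (x : X.carrier) (y : D.carrier) (e : E.carrier) :
    assocAux D E X x (pt y e) =
      pt (X := tensor E X) y (show (tensor E X).carrier from pt e x) := rfl

/-- `y ⊗ (- ⊗ -) ↦ (y ⊗ -) ⊗ -` for fixed `y`. -/
def assocInvAux (y : D.carrier) : Ten E X →+ Ten (tensor D E) X :=
  Ten.lift (fun e x => pt (D := tensor D E) (show (tensor D E).carrier from pt y e) x)
    (fun e e' x => by
      rw [← pt_add_left]
      exact congrArg (fun z => pt (D := tensor D E) z x) (pt_add_right y e e'))
    (fun e x x' => pt_add_right _ x x')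
    (fun c e x => by
      rw [← pt_balanced]
      refine congrArg (fun z => pt (D := tensor D E) z x) ?_
      rw [smul_pt, one_tmul_one_smul])

theorem assocInvAux_pt (x : X.carrier) (y : D.carrier) (e : E.carrier) :
    assocInvAux D E X y (pt e x) =
      pt (D := tensor D E) (show (tensor D E).carrier from pt y e) x := rfl

/-- The map `(y ⊗ e) ⊗ x ↦ y ⊗ (e ⊗ x)`. -/
def assocHom : tensor (tensor D E) X ⟶ tensor D (tensor E X) :=
  tenDesc (fun (p : Ten D E) x => (show (tensor D (tensor E X)).carrier from assocAux D E X x p))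
    (fun p p' x => (assocAux D E X x).map_add p p')
    (fun (p : Ten D E) x x' => by
      change assocAux D E X (x + x') p = assocAux D E X x p + assocAux D E X x' p
      refine Ten.induction p (by simp) (fun y e => ?_) fun a b ha hb => ?_
      · rw [assocAux_pt, assocAux_pt, assocAux_pt, ← pt_add_right]
        exact congrArg (fun z => pt (X := tensor E X) y z) (pt_add_right e x x')
      · simp only [map_add, ha, hb]; abel)
    (fun c (p : Ten D E) x => by
      change assocAux D E X x (tenAct D E (1 ⊗ₜ c) p) = assocAux D E X ((c ⊗ₜ[k] (1 : B)) • x) p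
      refine Ten.induction p (by simp) (fun y e => ?_) fun a b ha hb => by simp only [map_add, ha, hb]
      rw [tenAct_pt, assocAux_pt, assocAux_pt, one_tmul_one_smul]
      exact congrArg (fun z => pt (X := tensor E X) y z) (pt_balanced c e x))
    (fun t b (p : Ten D E) x => by
      change assocAux D E X ((1 ⊗ₜ b) • x) (tenAct D E (t ⊗ₜ 1) p) =
        tenAct D (tensor E X) (t ⊗ₜ b) (assocAux D E X x p)
      refine Ten.induction p (by simp) (fun y e => ?_) fun a b ha hb => by simp only [map_add, ha, hb]
      rw [tenAct_pt, assocAux_pt, assocAux_pt, tenAct_pt, smul_pt])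
    (fun (p : Ten D E) x => by
      change assocAux D E X (X.par x) (tenMap D E _ _ p) =
        tenMap D (tensor E X) _ _ (assocAux D E X x p)
      refine Ten.induction p (by simp) (fun y e => ?_) fun a b ha hb => by simp only [map_add, ha, hb]
      rfl)
    (fun (p : Ten D E) x => by
      suffices H : assocAux D E X x (tenMap D E D.d LinearMap.id p + tenMap D E D.par E.d p) +
          assocAux D E X (X.d x) (tenMap D E D.par E.par p) =
          tenMap D (tensor E X) D.d LinearMap.id (assocAux D E X x p) +
          tenMap D (tensor E X) D.par (tensor E X).d (assocAux D E X x p) from H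
      refine Ten.induction p (by simp) (fun y e => ?_) fun a b ha hb => ?_
      · simp only [map_add, tenMap_pt, assocAux_pt, LinearMap.id_apply]
        exact (add_assoc _ _ _).trans
          (congrArg₂ (· + ·) rfl (pt_add_right (X := tensor E X) _ _ _).symm)
      · simp only [map_add] at ha hb ⊢
        rw [add_add_add_comm (tenMap D (tensor E X) D.d LinearMap.id (assocAux D E X x a)), ← ha, ← hb]
        abel)

/-- The map `y ⊗ (e ⊗ x) ↦ (y ⊗ e) ⊗ x`. -/
def assocInv : tensor D (tensor E X) ⟶ tensor (tensor D E) X :=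
  tenDesc (fun y (q : Ten E X) =>
      (show (tensor (tensor D E) X).carrier from assocInvAux D E X y q))
    (fun y y' (q : Ten E X) => by
      change assocInvAux D E X (y + y') q = assocInvAux D E X y q + assocInvAux D E X y' q
      refine Ten.induction q (by simp) (fun e x => ?_) fun a b ha hb => ?_
      · rw [assocInvAux_pt, assocInvAux_pt, assocInvAux_pt, ← pt_add_left]
        exact congrArg (fun z => pt (D := tensor D E) z x) (pt_add_left y y' e)
      · simp only [map_add, ha, hb]; abel)
    (fun y q q' => (assocInvAux D E X y).map_add q q')
    (fun s y (q : Ten E X) => by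
      change assocInvAux D E X (((1 : T) ⊗ₜ[k] s) • y) q =
        assocInvAux D E X y (tenAct E X (s ⊗ₜ 1) q)
      refine Ten.induction q (by simp) (fun e x => ?_) fun a b ha hb => by simp only [map_add, ha, hb]
      rw [tenAct_pt, assocInvAux_pt, assocInvAux_pt, one_tmul_one_smul]
      exact congrArg (fun z => pt (D := tensor D E) z x) (pt_balanced s y e))
    (fun t b y (q : Ten E X) => by
      change assocInvAux D E X ((t ⊗ₜ[k] (1 : S)) • y) (tenAct E X (1 ⊗ₜ b) q) =
        tenAct (tensor D E) X (t ⊗ₜ b) (assocInvAux D E X y q)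
      refine Ten.induction q (by simp) (fun e x => ?_) fun a b ha hb => by simp only [map_add, ha, hb]
      rw [tenAct_pt, assocInvAux_pt, assocInvAux_pt, tenAct_pt, smul_pt])
    (fun y (q : Ten E X) => by
      change assocInvAux D E X (D.par y) (tenMap E X _ _ q) =
        tenMap (tensor D E) X _ _ (assocInvAux D E X y q)
      refine Ten.induction q (by simp) (fun e x => ?_) fun a b ha hb => by simp only [map_add, ha, hb]
      rfl)
    (fun y (q : Ten E X) => by
      suffices H : assocInvAux D E X (D.d y) q +
          assocInvAux D E X (D.par y) (tenMap E X E.d LinearMap.id q + tenMap E X E.par X.d q) =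
          tenMap (tensor D E) X (tensor D E).d LinearMap.id (assocInvAux D E X y q) +
          tenMap (tensor D E) X (tensor D E).par X.d (assocInvAux D E X y q) from H
      refine Ten.induction q (by simp) (fun e x => ?_) fun a b ha hb => ?_
      · simp only [map_add, tenMap_pt, assocInvAux_pt, LinearMap.id_apply]
        exact (add_assoc _ _ _).symm.trans
          (congrArg₂ (· + ·) (pt_add_left (D := tensor D E) _ _ _).symm rfl)
      · simp only [map_add] at ha hb ⊢
        rw [add_add_add_comm
          (tenMap (tensor D E) X (tensor D E).d LinearMap.id (assocInvAux D E X y a)), ← ha, ← hb]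
        abel)

/-- The associator `(D ⊗ E) ⊗ X ≅ D ⊗ (E ⊗ X)`. -/
def assoc : tensor (tensor D E) X ≅ tensor D (tensor E X) where
  hom := assocHom D E X
  inv := assocInv D E X
  hom_inv_id := by
    refine hom_ext fun (r : Ten (tensor D E) X) => ?_
    refine Ten.induction r (map_zero _) (fun (p : Ten D E) x => ?_)
      fun a b ha hb => (map_add _ a b).trans (congrArg₂ (· + ·) ha hb)
    refine Ten.induction p ?_ (fun y e => rfl) fun a b ha hb => ?_
    · exact (congrArg _ (pt_zero_left (D := tensor D E) x)).trans
        ((map_zero _).trans (pt_zero_left (D := tensor D E) x).symm)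
    · exact (congrArg _ (pt_add_left (D := tensor D E) a b x)).trans
        ((map_add _ _ _).trans ((congrArg₂ _ ha hb).trans
          (pt_add_left (D := tensor D E) a b x).symm))
  inv_hom_id := by
    refine hom_ext fun (r : Ten D (tensor E X)) => ?_
    refine Ten.induction r (map_zero _) (fun y (q : Ten E X) => ?_)
      fun a b ha hb => (map_add _ a b).trans (congrArg₂ (· + ·) ha hb)
    refine Ten.induction q ?_ (fun y e => rfl) fun a b ha hb => ?_
    · exact (congrArg _ (pt_zero_right (X := tensor E X) y)).trans
        ((map_zero _).trans (pt_zero_right (X := tensor E X) y).symm)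
    · exact (congrArg _ (pt_add_right (X := tensor E X) y a b)).trans
        ((map_add _ _ _).trans ((congrArg₂ _ ha hb).trans
          (pt_add_right (X := tensor E X) y a b).symm))

end Assoc

end LF


/-! ## The unit defect -/

section UnitDefect

open MvPolynomial

variable (k : Type u) [CommRing k] {n : ℕ}

/-- The polynomial ring `R = k[x₁, …, xₙ]`. -/
abbrev Pol (n : ℕ) : Type u := MvPolynomial (Fin n) k

/-- The enveloping ring `Rᵉ = R ⊗ R = k[x, x']`. -/
abbrev PolE (n : ℕ) : Type u := Pol k n ⊗[k] Pol k n

/-- A potential: the Jacobi ring is a finitely generated free `k`-module and the partial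
derivatives form a regular sequence (the unit ideal is allowed). -/
structure IsPotential (W : Pol k n) : Prop where
  free : Module.Free k (Pol k n ⧸ Ideal.span (Set.range fun i => pderiv i W))
  finite : Module.Finite k (Pol k n ⧸ Ideal.span (Set.range fun i => pderiv i W))
  regular : RingTheory.Sequence.IsWeaklyRegular (Pol k n) (List.ofFn fun i => pderiv i W)

/-- The variable `xᵢ` of `Rᵉ`. -/
def varL (i : Fin n) : PolE k n := X i ⊗ₜ 1

/-- The variable `x'ᵢ` of `Rᵉ`. -/
def varR (i : Fin n) : PolE k n := 1 ⊗ₜ X i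

/-- `W ↦ W(x'₁, …, x'ⱼ, xⱼ₊₁, …, xₙ)`, the first `j` variables being replaced. -/
def hybrid (j : ℕ) : Pol k n →ₐ[k] PolE k n :=
  aeval fun l : Fin n => if (l : ℕ) < j then varR k l else varL k l

theorem dvd_hybrid_sub (W : Pol k n) (i : Fin n) :
    varL k i - varR k i ∣ hybrid k i W - hybrid k (i + 1) W := by
  rw [← Ideal.mem_span_singleton, ← Ideal.Quotient.eq]
  set J : Ideal (PolE k n) := Ideal.span {varL k i - varR k i}
  have h : (Ideal.Quotient.mkₐ k J).comp (hybrid k i) =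
      (Ideal.Quotient.mkₐ k J).comp (hybrid k (i + 1)) := by
    refine MvPolynomial.algHom_ext fun l => ?_
    simp only [AlgHom.comp_apply, hybrid, aeval_X, Ideal.Quotient.mkₐ_eq_mk]
    rcases lt_trichotomy (l : ℕ) i with h | h | h
    · rw [if_pos h, if_pos (Nat.lt_succ_of_lt h)]
    · have : l = i := Fin.ext h
      subst this
      rw [if_neg (lt_irrefl _), if_pos (Nat.lt_succ_self _), Ideal.Quotient.eq]
      exact Ideal.mem_span_singleton_self _
    · rw [if_neg (by omega), if_neg (by omega)]
  exact DFunLike.congr_fun h W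

/-- The difference quotient
`∂_[i] W = (W(x'₁,…,x'ᵢ₋₁,xᵢ,…,xₙ) - W(x'₁,…,x'ᵢ,xᵢ₊₁,…,xₙ)) / (xᵢ - x'ᵢ)`.
It is unique because `xᵢ - x'ᵢ` is not a zero divisor in `k[x, x']`. -/
def diffQuot (W : Pol k n) (i : Fin n) : PolE k n := (dvd_hybrid_sub k W i).choose

theorem diffQuot_spec (W : Pol k n) (i : Fin n) :
    hybrid k i W - hybrid k (i + 1) W = (varL k i - varR k i) * diffQuot k W i :=
  (dvd_hybrid_sub k W i).choose_spec

theorem sum_diffQuot (W : Pol k n) :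
    ∑ i, (varL k i - varR k i) * diffQuot k W i = potDiff k W W := by
  simp_rw [← diffQuot_spec]
  rw [Fin.sum_univ_eq_sum_range (fun j => hybrid k j W - hybrid k (j + 1) W) n,
    Finset.sum_range_sub']
  have h0 : hybrid k 0 = (Algebra.TensorProduct.includeLeft : Pol k n →ₐ[k] PolE k n) :=
    MvPolynomial.algHom_ext fun l => by simp [hybrid, varL]
  have hn : hybrid k n = (Algebra.TensorProduct.includeRight : Pol k n →ₐ[k] PolE k n) :=
    MvPolynomial.algHom_ext fun l => by simp [hybrid, varR]
  rw [h0, hn]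
  rfl

/-- The exterior algebra on `θ₁, …, θₙ` over `Rᵉ`. -/
abbrev Koszul (n : ℕ) : Type u := ExteriorAlgebra (PolE k n) (Fin n → PolE k n)

/-- The generator `θᵢ`. -/
def theta (i : Fin n) : Koszul k n := ExteriorAlgebra.ι (PolE k n) (Pi.single i 1)

/-- The contraction operator `θᵢ*`. -/
def thetaStar (i : Fin n) : Koszul k n →ₗ[PolE k n] Koszul k n :=
  CliffordAlgebra.contractLeft (LinearMap.proj i)

/-- The differential `∑ᵢ ((xᵢ - x'ᵢ) θᵢ* + ∂_[i]W θᵢ ∧ (-))`. -/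
def unitD (W : Pol k n) : Koszul k n →ₗ[PolE k n] Koszul k n :=
  ∑ i, ((varL k i - varR k i) • thetaStar k i +
    diffQuot k W i • LinearMap.mulLeft (PolE k n) (theta k i))

/-- The linear form `θᵢ ↦ xᵢ - x'ᵢ`. -/
def diffForm : Module.Dual (PolE k n) (Fin n → PolE k n) :=
  ∑ i, (varL k i - varR k i) • LinearMap.proj i

theorem unitD_apply (W : Pol k n) (a : Koszul k n) :
    unitD k W a = CliffordAlgebra.contractLeft (diffForm k) a +
      ExteriorAlgebra.ι (PolE k n) (diffQuot k W) * a := by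
  have h : (diffQuot k W) = ∑ i, diffQuot k W i • (Pi.single i 1 : Fin n → PolE k n) := by
    funext j
    simp [Finset.sum_apply, Pi.single_apply]
  conv_rhs => rw [h]
  simp only [unitD, diffForm, thetaStar, theta, map_sum, map_smul, LinearMap.sum_apply,
    LinearMap.add_apply, LinearMap.smul_apply, LinearMap.mulLeft_apply, Finset.sum_add_distrib,
    Finset.sum_mul]
  exact congrArg₂ (· + ·) rfl
    (Finset.sum_congr rfl fun i _ => (Algebra.smul_mul_assoc _ _ _).symm)

theorem involute_contractLeft (f : Module.Dual (PolE k n) (Fin n → PolE k n)) (a : Koszul k n) :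
    CliffordAlgebra.involute (CliffordAlgebra.contractLeft f a) =
      -CliffordAlgebra.contractLeft f (CliffordAlgebra.involute a) := by
  induction a using CliffordAlgebra.left_induction with
  | algebraMap r => simp
  | add x y hx hy => simp only [map_add, hx, hy, neg_add]
  | ι_mul x m hx =>
    simp only [CliffordAlgebra.contractLeft_ι_mul, map_sub, map_mul, map_smul,
      CliffordAlgebra.involute_ι, hx, neg_mul, map_neg]
    simp

/-- The unit defect `I_W`. -/
def unitDefect (W : Pol k n) : LF (PolE k n) (potDiff k W W) where
  carrier := Koszul k n
  par := (CliffordAlgebra.involute : Koszul k n →ₐ[PolE k n] Koszul k n).toLinearMap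
  d := unitD k W
  par_par a := CliffordAlgebra.involute_involute a
  par_d a := by
    have h : CliffordAlgebra.involute (ExteriorAlgebra.ι (PolE k n) (diffQuot k W)) =
        -ExteriorAlgebra.ι (PolE k n) (diffQuot k W) := CliffordAlgebra.involute_ι _
    change CliffordAlgebra.involute (unitD k W a) = -unitD k W (CliffordAlgebra.involute a)
    rw [unitD_apply, unitD_apply, map_add, map_mul, involute_contractLeft, h, neg_mul, neg_add]
  d_d a := by
    have h1 := CliffordAlgebra.contractLeft_contractLeft (Q := 0) (diffForm k) a
    have h2 := CliffordAlgebra.contractLeft_ι_mul (Q := 0) (diffForm k) (diffQuot k W) a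
    have h3 : ExteriorAlgebra.ι (PolE k n) (diffQuot k W) *
        ExteriorAlgebra.ι (PolE k n) (diffQuot k W) = 0 := ExteriorAlgebra.ι_sq_zero _
    have h4 : diffForm k (diffQuot k W) = potDiff k W W := by
      rw [← sum_diffQuot]
      simp [diffForm]
    rw [unitD_apply, unitD_apply, map_add, h1, mul_add, ← mul_assoc, h3, zero_mul, add_zero,
      zero_add]
    refine (congrArg (· + _) h2).trans ?_
    rw [h4]
    exact sub_add_cancel _ _

/-- Projection of `I_W` to `θ`-degree zero, followed by multiplication `Rᵉ → R`. -/
def unitProj : Koszul k n →+ Pol k n :=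
  ((Algebra.TensorProduct.lmul' k : PolE k n →ₐ[k] Pol k n) : PolE k n →+ Pol k n).comp
    ((ExteriorAlgebra.algebraMapInv : Koszul k n →ₐ[PolE k n] PolE k n) : Koszul k n →+ PolE k n)

theorem unitProj_smul (r : PolE k n) (a : Koszul k n) :
    unitProj k (r • a) = Algebra.TensorProduct.lmul' k r * unitProj k a := by
  simp [unitProj]

theorem unitProj_par (a : Koszul k n) :
    unitProj k (CliffordAlgebra.involute a) = unitProj k a := by
  have h : (ExteriorAlgebra.algebraMapInv : Koszul k n →ₐ[PolE k n] PolE k n).comp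
      (CliffordAlgebra.involute : Koszul k n →ₐ[PolE k n] Koszul k n) =
        ExteriorAlgebra.algebraMapInv := by
    refine ExteriorAlgebra.hom_ext (LinearMap.ext fun m => ?_)
    simp [ExteriorAlgebra.ι, ExteriorAlgebra.algebraMapInv, ExteriorAlgebra.lift]
  have := DFunLike.congr_fun h a
  simp only [unitProj, AddMonoidHom.comp_apply]
  exact congrArg (Algebra.TensorProduct.lmul' k : PolE k n →ₐ[k] Pol k n) this

theorem unitProj_d (W : Pol k n) (a : Koszul k n) : unitProj k (unitD k W a) = 0 := by
  have key : ∀ m : Fin n → PolE k n, ∀ b : Koszul k n,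
      unitProj k (ExteriorAlgebra.ι (PolE k n) m * b) = 0 := fun m b => by
    simp [unitProj, ExteriorAlgebra.algebraMapInv]
  rw [unitD_apply, map_add, key, add_zero]
  induction a using CliffordAlgebra.left_induction with
  | algebraMap r => simp
  | add x y hx hy => simp only [map_add, hx, hy, add_zero]
  | ι_mul x m hx =>
    rw [CliffordAlgebra.contractLeft_ι_mul, map_sub, unitProj_smul]
    have h : Algebra.TensorProduct.lmul' k (diffForm k m) = 0 := by
      simp [diffForm, varL, varR]
    rw [h, zero_mul, zero_sub, neg_eq_zero]
    exact key _ _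

end UnitDefect

namespace LF

section Unitors

variable {k : Type u} [CommRing k] {n : ℕ}
variable {C : Type u} [CommRing C] [Algebra k C] {W : Pol k n} {V : C}

/-- The left unit action `λ_X : I ⊗ X ⟶ X`: project `I` to `θ`-degree zero and multiply. -/
def leftUnitor (X : LF (Pol k n ⊗[k] C) (potDiff k W V)) : tensor (unitDefect k W) X ⟶ X :=
  tenDesc (fun (a : Koszul k n) x => (unitProj k a ⊗ₜ[k] (1 : C)) • x)
    (fun (a a' : Koszul k n) x => by
      change (unitProj k (a + a') ⊗ₜ[k] (1 : C)) • x = _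
      rw [map_add, TensorProduct.add_tmul, add_smul])
    (fun a x x' => smul_add _ _ _)
    (fun s (a : Koszul k n) x => by
      change (unitProj k (((1 : Pol k n) ⊗ₜ[k] s) • a) ⊗ₜ[k] (1 : C)) • x = _
      rw [unitProj_smul, smul_smul, Algebra.TensorProduct.tmul_mul_tmul]
      simp [mul_comm])
    (fun t c (a : Koszul k n) x => by
      change (unitProj k ((t ⊗ₜ[k] (1 : Pol k n)) • a) ⊗ₜ[k] (1 : C)) • _ = _
      rw [unitProj_smul, smul_smul, smul_smul, Algebra.TensorProduct.tmul_mul_tmul,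
        Algebra.TensorProduct.tmul_mul_tmul]
      simp)
    (fun (a : Koszul k n) x => by
      change (unitProj k (CliffordAlgebra.involute a) ⊗ₜ[k] (1 : C)) • X.par x = _
      rw [unitProj_par, map_smul])
    (fun (a : Koszul k n) x => by
      change (unitProj k (unitD k W a) ⊗ₜ[k] (1 : C)) • x +
        (unitProj k (CliffordAlgebra.involute a) ⊗ₜ[k] (1 : C)) • X.d x = _
      rw [unitProj_par, unitProj_d, map_smul, TensorProduct.zero_tmul]
      exact (congrArg (· + _) (zero_smul (Pol k n ⊗[k] C) x)).trans (zero_add _))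

/-- The right unit action `ρ_D : D ⊗ I ⟶ D`: project `I` to `θ`-degree zero and multiply. -/
def rightUnitor (D : LF (C ⊗[k] Pol k n) (potDiff k V W)) : tensor D (unitDefect k W) ⟶ D :=
  tenDesc (fun y (a : Koszul k n) => ((1 : C) ⊗ₜ[k] unitProj k a) • y)
    (fun y y' a => smul_add _ _ _)
    (fun y (a a' : Koszul k n) => by
      change ((1 : C) ⊗ₜ[k] unitProj k (a + a')) • y = _
      rw [map_add, TensorProduct.tmul_add, add_smul])
    (fun s y (a : Koszul k n) => by
      change _ = ((1 : C) ⊗ₜ[k] unitProj k ((s ⊗ₜ[k] (1 : Pol k n)) • a)) • y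
      rw [unitProj_smul, smul_smul, Algebra.TensorProduct.tmul_mul_tmul]
      simp [mul_comm])
    (fun t c y (a : Koszul k n) => by
      change ((1 : C) ⊗ₜ[k] unitProj k (((1 : Pol k n) ⊗ₜ[k] c) • a)) • _ = _
      rw [unitProj_smul, smul_smul, smul_smul, Algebra.TensorProduct.tmul_mul_tmul,
        Algebra.TensorProduct.tmul_mul_tmul]
      simp)
    (fun y (a : Koszul k n) => by
      change ((1 : C) ⊗ₜ[k] unitProj k (CliffordAlgebra.involute a)) • D.par y = _
      rw [unitProj_par, map_smul])
    (fun y (a : Koszul k n) => by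
      change ((1 : C) ⊗ₜ[k] unitProj k a) • D.d y +
        ((1 : C) ⊗ₜ[k] unitProj k (unitD k W a)) • D.par y = _
      rw [unitProj_d, map_smul, TensorProduct.tmul_zero]
      exact (congrArg (_ + ·) (zero_smul (C ⊗[k] Pol k n) (D.par y))).trans (add_zero _))

end Unitors

end LF

/-! ## Twists by automorphisms -/

section Twist

variable (k : Type u) [CommRing k]

/-- The group of `k`-algebra automorphisms of `S` leaving `V` invariant. -/
def symAut {S : Type u} [CommRing S] [Algebra k S] (V : S) : Subgroup (S ≃ₐ[k] S) where
  carrier := {g | g V = V}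
  one_mem' := rfl
  mul_mem' {g h} hg hh := by
    change g (h V) = V
    rw [show h V = V from hh]
    exact hg
  inv_mem' {g} hg := by
    change g⁻¹ V = V
    conv_lhs => rw [← show g V = V from hg]
    exact g.symm_apply_apply V

variable {k} {S C : Type u} [CommRing S] [CommRing C] [Algebra k S] [Algebra k C] {V : S} {W : C}

/-- The ring homomorphism `r ↦ g⁻¹(r)`. -/
def invHom (g : symAut k V) : S →+* S := (((g⁻¹ : symAut k V) : S ≃ₐ[k] S) : S →+* S)

theorem invHom_pot (g : symAut k V) : invHom g V = V := (g⁻¹).2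

theorem invHom_one (r : S) : invHom (1 : symAut k V) r = r := by
  simp [invHom]

theorem invHom_mul (g h : symAut k V) (r : S) : invHom (g * h) r = invHom h (invHom g r) := by
  simp [invHom]

/-- The ring homomorphism `r ⊗ c ↦ g⁻¹(r) ⊗ c`. -/
def invHomL (C : Type u) [CommRing C] [Algebra k C] (g : symAut k V) : S ⊗[k] C →+* S ⊗[k] C :=
  (Algebra.TensorProduct.map (((g⁻¹ : symAut k V) : S ≃ₐ[k] S) : S →ₐ[k] S)
    (AlgHom.id k C) : S ⊗[k] C →ₐ[k] S ⊗[k] C)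

theorem invHomL_tmul (g : symAut k V) (s : S) (c : C) :
    invHomL C g (s ⊗ₜ c) = invHom g s ⊗ₜ c := rfl

theorem invHomL_pot (g : symAut k V) : invHomL C g (potDiff k V W) = potDiff k V W := by
  rw [potDiff, map_sub, invHomL_tmul, invHomL_tmul, invHom_pot]
  simp [invHom]

theorem invHomL_one (r : S ⊗[k] C) : invHomL C (1 : symAut k V) r = r := by
  induction r using TensorProduct.induction_on with
  | zero => simp
  | add a b ha hb => rw [map_add, ha, hb]
  | tmul s c => rw [invHomL_tmul, invHom_one]

theorem invHomL_mul (g h : symAut k V) (r : S ⊗[k] C) :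
    invHomL C (g * h) r = invHomL C h (invHomL C g r) := by
  induction r using TensorProduct.induction_on with
  | zero => simp
  | add a b ha hb => simp only [map_add, ha, hb]
  | tmul s c => rw [invHomL_tmul, invHomL_tmul, invHomL_tmul, invHom_mul]

end Twist

namespace LF

section ResIso

variable {Q Z Z' : Type u} [CommRing Q] [CommRing Z] [CommRing Z'] {w : Q} {z : Z} {z' : Z'}

/-- Restriction along the identity does nothing. -/
def resId (f : Q →+* Q) (hf : f w = w) (h : ∀ r, f r = r) (X : LF Q w) : res f hf X ≅ X where
  hom := mkHom (X := res f hf X) (Y := X)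
    { toFun := fun x => x, map_add' := fun _ _ => rfl,
      map_smul' := fun r x => congrArg (fun s : Q => s • (show X.carrier from x)) (h r) }
    (fun _ => rfl) (fun _ => rfl)
  inv := mkHom (X := X) (Y := res f hf X)
    { toFun := fun x => x, map_add' := fun _ _ => rfl,
      map_smul' := fun r x => congrArg (fun s : Q => s • (show X.carrier from x)) (h r).symm }
    (fun _ => rfl) (fun _ => rfl)
  hom_inv_id := hom_ext fun _ => rfl
  inv_hom_id := hom_ext fun _ => rfl

/-- Restriction along a composite is the composite of the restrictions. -/
def resComp (f : Z' →+* Z) (hf : f z' = z) (g : Z →+* Q) (hg : g z = w) (e : Z' →+* Q)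
    (he : e z' = w) (h : ∀ r, e r = g (f r)) (X : LF Q w) :
    res e he X ≅ res f hf (res g hg X) where
  hom := mkHom (X := res e he X) (Y := res f hf (res g hg X))
    { toFun := fun x => x, map_add' := fun _ _ => rfl,
      map_smul' := fun r x => congrArg (fun s : Q => s • (show X.carrier from x)) (h r) }
    (fun _ => rfl) (fun _ => rfl)
  inv := mkHom (X := res f hf (res g hg X)) (Y := res e he X)
    { toFun := fun x => x, map_add' := fun _ _ => rfl,
      map_smul' := fun r x => congrArg (fun s : Q => s • (show X.carrier from x)) (h r).symm }
    (fun _ => rfl) (fun _ => rfl)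
  hom_inv_id := hom_ext fun _ => rfl
  inv_hom_id := hom_ext fun _ => rfl

end ResIso

section Twist

variable {k : Type u} [CommRing k]
variable {T S C : Type u} [CommRing T] [CommRing S] [CommRing C]
variable [Algebra k T] [Algebra k S] [Algebra k C] {U : T} {V : S} {W : C}

/-- The twist `ᵍX`: the same set, with `r` acting as `g⁻¹(r)`. -/
abbrev twist (g : symAut k V) : LF S V ⥤ LF S V := resFunctor (invHom g) (invHom_pot g)

/-- `ᵉX ≅ X`, the identity on underlying sets. -/
def twistOne (X : LF S V) : (twist (1 : symAut k V)).obj X ≅ X := resId _ (invHom_pot 1) invHom_one X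

/-- `ᵍʰX ≅ ᵍ(ʰX)`, the identity on underlying sets. -/
def twistMul (g h : symAut k V) (X : LF S V) :
    (twist (g * h)).obj X ≅ (twist g).obj ((twist h).obj X) :=
  resComp _ (invHom_pot g) _ (invHom_pot h) _ (invHom_pot (g * h)) (invHom_mul g h) X

/-- The twist `ᵍD` of a defect, through its left-hand ring. -/
abbrev twistL (g : symAut k U) :
    LF (T ⊗[k] S) (potDiff k U V) ⥤ LF (T ⊗[k] S) (potDiff k U V) :=
  resFunctor (invHomL S g) (invHomL_pot g)

/-- `ᵉD ≅ D`, the identity on underlying sets. -/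
def twistLOne (D : LF (T ⊗[k] S) (potDiff k U V)) : (twistL (1 : symAut k U)).obj D ≅ D :=
  resId _ (invHomL_pot 1) invHomL_one D

/-- `ᵍʰD ≅ ᵍ(ʰD)`, the identity on underlying sets. -/
def twistLMul (g h : symAut k U) (D : LF (T ⊗[k] S) (potDiff k U V)) :
    (twistL (g * h)).obj D ≅ (twistL g).obj ((twistL h).obj D) :=
  resComp _ (invHomL_pot g) _ (invHomL_pot h) _ (invHomL_pot (g * h)) (invHomL_mul g h) D

/-- `ᵍD ⊗ X ⟶ ᵍ(D ⊗ X)`, `y ⊗ x ↦ y ⊗ x`. -/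
def twistLTensor (g : symAut k U) (D : LF (T ⊗[k] S) (potDiff k U V))
    (X : LF (S ⊗[k] C) (potDiff k V W)) :
    tensor ((twistL g).obj D) X ⟶ (twistL g).obj (tensor D X) :=
  tenDesc (D := (twistL g).obj D) (Y := (twistL g).obj (tensor D X))
    (fun (y : D.carrier) x => (pt y x : Ten D X))
    (fun y y' x => pt_add_left (D := D) y y' x)
    (fun y x x' => pt_add_right (D := D) y x x')
    (fun s (y : D.carrier) x => by
      change (pt (invHomL S g (1 ⊗ₜ[k] s) • y) x : Ten D X) = _
      rw [invHomL_tmul, invHom, map_one]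
      exact pt_balanced s y x)
    (fun t c (y : D.carrier) x => by
      change (pt (invHomL S g (t ⊗ₜ[k] 1) • y) (((1 : S) ⊗ₜ[k] c) • x) : Ten D X) =
        tenAct D X (invHomL C g (t ⊗ₜ c)) (pt y x)
      rw [invHomL_tmul, invHomL_tmul, tenAct_pt])
    (fun y x => rfl)
    (fun y x => rfl)

end Twist

/-! ## Direct sums -/

section Sum

variable {Q : Type u} [CommRing Q] {w : Q} {ι : Type u}

/-- The direct sum of a finite family of factorisations. -/
def directSum [Fintype ι] (F : ι → LF Q w) : LF Q w where
  carrier := ∀ i, (F i).carrier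
  par := LinearMap.pi fun i => (F i).par ∘ₗ LinearMap.proj i
  d := LinearMap.pi fun i => (F i).d ∘ₗ LinearMap.proj i
  par_par x := funext fun i => (F i).par_par (x i)
  par_d x := funext fun i => (F i).par_d (x i)
  d_d x := funext fun i => (F i).d_d (x i)

variable [Fintype ι] (F : ι → LF Q w)

/-- The projection onto a summand. -/
def sumProj (i : ι) : directSum F ⟶ F i :=
  mkHom (X := directSum F) (Y := F i) (LinearMap.proj (φ := fun i => (F i).carrier) i)
    (fun _ => rfl) (fun _ => rfl)

open Classical in
/-- The inclusion of a summand. -/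
def sumIncl (i : ι) : F i ⟶ directSum F :=
  mkHom (X := F i) (Y := directSum F) (LinearMap.single Q (fun i => (F i).carrier) i)
    (fun x => funext fun j => by
      change (Pi.single i ((F i).par x) : ∀ i, (F i).carrier) j =
        (F j).par ((Pi.single i x : ∀ i, (F i).carrier) j)
      exact (Pi.apply_single (fun j => (F j).par) (fun j => map_zero _) i x j).symm)
    (fun x => funext fun j => by
      change (Pi.single i ((F i).d x) : ∀ i, (F i).carrier) j =
        (F j).d ((Pi.single i x : ∀ i, (F i).carrier) j)
      exact (Pi.apply_single (fun j => (F j).d) (fun j => map_zero _) i x j).symm)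

end Sum

end LF

/-! ## Algebras and modules in the bicategory of Landau-Ginzburg models

All equations below hold in homotopy categories; `HF.cls` sends a morphism of factorisations to its
homotopy class. -/

section Algebras

open LF

variable {k : Type u} [CommRing k] {n : ℕ} {W : Pol k n}

/-- Multiplication and unit on a defect `A` from `W` to itself. -/
structure AlgData (A : LF (PolE k n) (potDiff k W W)) where
  mul : (HF.cls _ _).obj (tensor A A) ⟶ (HF.cls _ _).obj A
  one : (HF.cls _ _).obj (unitDefect k W) ⟶ (HF.cls _ _).obj A

/-- Comultiplication and counit on a defect `A` from `W` to itself. -/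
structure CoalgData (A : LF (PolE k n) (potDiff k W W)) where
  comul : (HF.cls _ _).obj A ⟶ (HF.cls _ _).obj (tensor A A)
  counit : (HF.cls _ _).obj A ⟶ (HF.cls _ _).obj (unitDefect k W)

variable {A : LF (PolE k n) (potDiff k W W)}

/-- `A` is an algebra: associative and unital. -/
structure AlgData.IsAlgebra (a : AlgData A) : Prop where
  mul_assoc : (HF.tensorRight A).map a.mul ≫ a.mul =
    (HF.cls _ _).map (assoc A A A).hom ≫ (HF.tensorLeft A).map a.mul ≫ a.mul
  one_mul : (HF.tensorRight A).map a.one ≫ a.mul = (HF.cls _ _).map (leftUnitor A)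
  mul_one : (HF.tensorLeft A).map a.one ≫ a.mul = (HF.cls _ _).map (rightUnitor A)

/-- `A` is a coalgebra: coassociative and counital. -/
structure CoalgData.IsCoalgebra (c : CoalgData A) : Prop where
  comul_assoc : c.comul ≫ (HF.tensorRight A).map c.comul ≫ (HF.cls _ _).map (assoc A A A).hom =
    c.comul ≫ (HF.tensorLeft A).map c.comul
  counit_comul : c.comul ≫ (HF.tensorRight A).map c.counit ≫ (HF.cls _ _).map (leftUnitor A) = 𝟙 _
  comul_counit : c.comul ≫ (HF.tensorLeft A).map c.counit ≫ (HF.cls _ _).map (rightUnitor A) = 𝟙 _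

/-- `A` is a (`Δ`-)separable Frobenius algebra. -/
structure IsSeparableFrobenius (a : AlgData A) (c : CoalgData A) : Prop where
  isAlgebra : a.IsAlgebra
  isCoalgebra : c.IsCoalgebra
  frobenius_left : (HF.tensorRight A).map c.comul ≫ (HF.cls _ _).map (assoc A A A).hom ≫
    (HF.tensorLeft A).map a.mul = a.mul ≫ c.comul
  frobenius_right : (HF.tensorLeft A).map c.comul ≫ (HF.cls _ _).map (assoc A A A).inv ≫
    (HF.tensorRight A).map a.mul = a.mul ≫ c.comul
  separable : c.comul ≫ a.mul = 𝟙 _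

variable {C : Type u} [CommRing C] [Algebra k C] {V : C}

/-- A left module over `A`: a 1-morphism `X : (C, V) → (R, W)` in the class `P`, with an
associative unital action `A ⊗ X ⟶ X`. -/
structure LeftMod (a : AlgData A) (P : ObjectProperty (HF (Pol k n ⊗[k] C) (potDiff k W V))) where
  X : HF (Pol k n ⊗[k] C) (potDiff k W V)
  mem : P X
  act : (HF.tensorLeft A).obj X ⟶ X
  mul_act : (HF.tensorRight X.as).map a.mul ≫ act =
    (HF.cls _ _).map (assoc A A X.as).hom ≫ (HF.tensorLeft A).map act ≫ act
  one_act : (HF.tensorRight X.as).map a.one ≫ act = (HF.cls _ _).map (leftUnitor X.as)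

variable {a : AlgData A} {P : ObjectProperty (HF (Pol k n ⊗[k] C) (potDiff k W V))}

/-- Module maps. -/
@[ext] structure LeftMod.Hom (M N : LeftMod a P) where
  hom : M.X ⟶ N.X
  comm : (HF.tensorLeft A).map hom ≫ N.act = M.act ≫ hom

instance : Category (LeftMod a P) where
  Hom := LeftMod.Hom
  id M := ⟨𝟙 _, by rw [CategoryTheory.Functor.map_id, Category.id_comp, Category.comp_id]⟩
  comp f g := ⟨f.hom ≫ g.hom, by
    rw [CategoryTheory.Functor.map_comp, Category.assoc, g.comm, ← Category.assoc, f.comm, Category.assoc]⟩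
  id_comp f := LeftMod.Hom.ext (Category.id_comp _)
  comp_id f := LeftMod.Hom.ext (Category.comp_id _)
  assoc f g h := LeftMod.Hom.ext (Category.assoc _ _ _)

/-- The underlying factorisation of a module. -/
def LeftMod.forget (a : AlgData A) (P : ObjectProperty (HF (Pol k n ⊗[k] C) (potDiff k W V))) :
    LeftMod a P ⥤ HF (Pol k n ⊗[k] C) (potDiff k W V) where
  obj M := M.X
  map f := LeftMod.Hom.hom f

end Algebras

/-! ## Equivariant factorisations -/

section Equivariant

variable {k : Type u} [CommRing k] {S : Type u} [CommRing S] [Algebra k S] {V : S}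

/-- The twist on the homotopy category. -/
abbrev HF.twist (g : symAut k V) : HF S V ⥤ HF S V := HF.res (invHom g) (invHom_pot g)

/-- A `G`-equivariant object: a factorisation `X` in the class `P` with isomorphisms
`φ_g : ᵍX ⟶ X` such that `φ_e = 1` and `φ_{gh} = φ_g ∘ ᵍ(φ_h)`, up to homotopy. -/
structure EquivariantObj (G : Subgroup (symAut k V)) (P : ObjectProperty (HF S V)) where
  X : HF S V
  mem : P X
  φ : ∀ g : G, (HF.twist (g : symAut k V)).obj X ≅ X
  φ_one : (φ 1).hom = (HF.cls _ _).map (LF.twistOne X.as).hom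
  φ_mul : ∀ g h : G, (φ (g * h)).hom =
    (HF.cls _ _).map (LF.twistMul (g : symAut k V) (h : symAut k V) X.as).hom ≫
      (HF.twist (g : symAut k V)).map (φ h).hom ≫ (φ g).hom

variable {G : Subgroup (symAut k V)} {P : ObjectProperty (HF S V)}

/-- Equivariant morphisms. -/
@[ext] structure EquivariantObj.Hom (X Y : EquivariantObj G P) where
  hom : X.X ⟶ Y.X
  comm : ∀ g : G, (X.φ g).hom ≫ hom = (HF.twist (g : symAut k V)).map hom ≫ (Y.φ g).hom

instance : Category (EquivariantObj G P) where
  Hom := EquivariantObj.Hom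
  id X := ⟨𝟙 _, fun g => by rw [CategoryTheory.Functor.map_id, Category.id_comp, Category.comp_id]⟩
  comp f g := ⟨f.hom ≫ g.hom, fun x => by
    rw [CategoryTheory.Functor.map_comp, Category.assoc, ← g.comm, ← Category.assoc, f.comm, Category.assoc]⟩
  id_comp f := EquivariantObj.Hom.ext (Category.id_comp _)
  comp_id f := EquivariantObj.Hom.ext (Category.comp_id _)
  assoc f g h := EquivariantObj.Hom.ext (Category.assoc _ _ _)

/-- The underlying factorisation of an equivariant one. -/
def EquivariantObj.forget (G : Subgroup (symAut k V)) (P : ObjectProperty (HF S V)) :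
    EquivariantObj G P ⥤ HF S V where
  obj X := X.X
  map f := EquivariantObj.Hom.hom f

end Equivariant

/-! ## The algebra `A_G` -/

section OrbifoldAlgebra

open LF

variable {k : Type u} [CommRing k] {n : ℕ} {W : Pol k n} (G : Subgroup (symAut k W))

/-- The twisted unit defect `ᵍI`: the `Rᵉ`-module `I` with `r ⊗ r'` acting as `g⁻¹(r) ⊗ r'`. -/
def twistedUnit (g : symAut k W) : LF (PolE k n) (potDiff k W W) := (twistL g).obj (unitDefect k W)

/-- `μ_{g,h} = ᵍ(λ) : ᵍI ⊗ ʰI ⟶ ᵍʰI`. -/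
def mulComp (g h : symAut k W) : tensor (twistedUnit g) (twistedUnit h) ⟶ twistedUnit (g * h) :=
  twistLTensor g (unitDefect k W) (twistedUnit h) ≫ (twistL g).map (leftUnitor (twistedUnit h)) ≫
    (twistLMul g h (unitDefect k W)).inv

variable [Fintype G]

/-- `A_G = ⨁_g ᵍI`. -/
def orbAlg : LF (PolE k n) (potDiff k W W) :=
  directSum fun g : G => twistedUnit (g : symAut k W)

/-- Inclusion `ᵍI ⟶ A_G`. -/
def orbIncl (g : G) : twistedUnit (g : symAut k W) ⟶ orbAlg G :=
  sumIncl (fun g : G => twistedUnit (g : symAut k W)) g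

/-- Projection `A_G ⟶ ᵍI`. -/
def orbProj (g : G) : orbAlg G ⟶ twistedUnit (g : symAut k W) :=
  sumProj (fun g : G => twistedUnit (g : symAut k W)) g

/-- The algebra structure on `A_G`: multiplication `∑ μ_{g,h}` and unit `I = ᵉI ↪ A_G`. -/
def orbAlgData : AlgData (orbAlg G) where
  mul := (HF.cls _ _).map (∑ g : G, ∑ h : G,
    tensorHom (orbProj G g) (orbProj G h) ≫ mulComp (g : symAut k W) (h : symAut k W) ≫
      orbIncl G (g * h))
  one := (HF.cls _ _).map ((twistLOne (unitDefect k W)).inv ≫ orbIncl G 1)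

/-- The coalgebra structure on `A_G`: comultiplication `|G|⁻¹ ∑ μ_{g,h}⁻¹` and counit
`|G|` times the projection `A_G ↠ ᵉI = I`. -/
def orbCoalgData [Algebra ℚ k]
    (hμ : ∀ g h : G, IsIso ((HF.cls _ _).map (mulComp (g : symAut k W) (h : symAut k W)))) :
    CoalgData (orbAlg G) where
  comul := algebraMap k (PolE k n) (algebraMap ℚ k (1 / (Fintype.card G : ℚ))) •
    ∑ g : G, ∑ h : G, (HF.cls _ _).map (orbProj G (g * h)) ≫
      @inv _ _ _ _ _ (hμ g h) ≫
      (HF.cls _ _).map (tensorHom (orbIncl G g) (orbIncl G h))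
  counit := (HF.cls _ _).map
    (Fintype.card G • (orbProj G 1 ≫ (twistLOne (unitDefect k W)).hom))

/-- The trivial Landau-Ginzburg model is `(k, 0)`. This regards a factorisation of `W : R` as a
1-morphism `(k, 0) → (R, W)`, i.e. a factorisation of `W ⊗ 1 - 1 ⊗ 0` over `R ⊗ k = R`. -/
def fromTrivial (W : Pol k n) : HF (Pol k n) W ⥤ HF (Pol k n ⊗[k] k) (potDiff k W (0 : k)) :=
  HF.res ((Algebra.TensorProduct.rid k k (Pol k n) : Pol k n ⊗[k] k ≃ₐ[k] Pol k n) :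
    Pol k n ⊗[k] k →+* Pol k n) (by simp [potDiff])

end OrbifoldAlgebra

end

/-!
Everything rests on one homotopy equivalence. The unit defect `I` is the Koszul complex of the
differences `xᵢ - x'ᵢ` with a perturbed differential. Dividing successively by the `xᵢ - x'ᵢ`
contracts the unperturbed complex onto `R`, linearly over the left variables
(`exists_unit_contraction`). The perturbation raises the degree in the `θᵢ`, so that for a matrix
factorisation `X` the contraction, tensored with `X` along a basis of `X`, inverts
`λ_X : I ⊗ X ⟶ X` up to a nilpotent error, and a Neumann series turns it into a homotopy inverse
(`LF.exists_homotopyInverse`, `LF.isIso_cls_leftUnitor`). The same contraction shows that an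
endomorphism of `I` which vanishes after projection to `R` is null-homotopic, whence
`λ_I` and `ρ_I` agree up to homotopy (`LF.cls_rightUnitor_unitDefect`).

Twisting `λ_X` by `g` gives isomorphisms `ᵍI ⊗ X ≅ ᵍX` (`LF.isIso_cls_twistAct`); for `X = ʰI` these
are the `μ_{g,h}`. The associativity of the `μ_{g,h}` holds strictly, being multiplication in `R`, and
only the right unit law needs `λ_I = ρ_I`. Thus `A_G` is a `G`-graded algebra all of whose
multiplications `A_g ⊗ A_h ⟶ A_{gh}` are invertible, and it is a formal consequence that the
normalised sum of their inverses is a separable Frobenius structure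
(`StronglyGraded.isSeparableFrobenius`).

A morphism `A_G ⊗ X ⟶ X` is a family of morphisms `ᵍI ⊗ X ⟶ X`, that is, by `ᵍI ⊗ X ≅ ᵍX`, a family
`ψ_g : ᵍX ⟶ X`. Under this correspondence unitality, associativity and compatibility with morphisms
become the conditions `ψ_e = 1`, `ψ_{gh} = ψ_g ∘ ᵍ(ψ_h)` and equivariance (`one_actOf_iff`,
`mul_actOf_iff`, `actOf_comm_iff`). Since `R ⊗ k ≃ R`, this makes the passage from equivariant
factorisations to modules fully faithful and essentially surjective, for any class of matrix
factorisations that is preserved by restriction along `R ⊗ k ≃ R` and its inverse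
(`exists_equivariant_equivalence`).
-/

noncomputable section

/-! ### The exterior algebra in coordinates -/

namespace KoszulContraction

open ExteriorAlgebra

section Operators

variable (A : Type*) [CommRing A] (n : ℕ)

/-- The exterior algebra on `θ₁, …, θₙ` over `A`. -/
abbrev Ext : Type _ := ExteriorAlgebra A (Fin n → A)

/-- The basis of monomials in the `θᵢ`. -/
def monomial : Module.Basis (Finset (Fin n)) A (Ext A n) := (Pi.basisFun A (Fin n)).ExteriorAlgebra

/-- The generator `θᵢ`. -/
def gen (i : Fin n) : Ext A n := ι A (Pi.single i 1)

variable {A n}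

theorem gen_mul_self (i : Fin n) : gen A n i * gen A n i = 0 := ι_sq_zero _

theorem gen_mul_comm (i j : Fin n) : gen A n i * gen A n j = -(gen A n j * gen A n i) :=
  eq_neg_of_add_eq_zero_left (ι_add_mul_swap _ _)

theorem ι_eq_sum_gen (m : Fin n → A) : ι A m = ∑ i, m i • gen A n i := by
  conv_lhs => rw [← Finset.univ_sum_single m]
  simp only [map_sum, gen, ← map_smul]
  refine Finset.sum_congr rfl fun i _ => ?_
  congr 1
  ext j
  simp [Pi.single_apply]

theorem gen_eq_monomial (i : Fin n) : gen A n i = monomial A n {i} := by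
  rw [monomial, basis_apply_ofCard _ (Finset.card_singleton i)]
  simp only [ιMulti_family, ιMulti_succ_apply, ιMulti_zero_apply, mul_one, gen,
    Function.comp_apply]
  have h : (Set.powersetCard.ofFinEmbEquiv.symm
      (Set.powersetCard.ofCard (Finset.card_singleton i))) 0 = i := by
    have := (Set.powersetCard.mem_range_ofFinEmbEquiv_symm_iff_mem
      (Set.powersetCard.ofCard (Finset.card_singleton i))
      ((Set.powersetCard.ofFinEmbEquiv.symm
      (Set.powersetCard.ofCard (Finset.card_singleton i))) 0)).1 ⟨0, rfl⟩
    exact Finset.mem_singleton.1 this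
  rw [h, Pi.basisFun_apply]

theorem one_eq_monomial : (1 : Ext A n) = monomial A n ∅ := by
  rw [monomial, basis_apply_ofCard _ Finset.card_empty]
  simp [ιMulti_family]

theorem gen_mul_monomial (i : Fin n) (s : Finset (Fin n)) :
    gen A n i * monomial A n s = 0 ∨ ∃ (z : ℤ) (t : Finset (Fin n)), t.card = s.card + 1 ∧
      gen A n i * monomial A n s = z • monomial A n t := by
  rw [gen_eq_monomial]
  let a : Set.powersetCard (Fin n) 1 := Set.powersetCard.ofCard (Finset.card_singleton i)
  let b : Set.powersetCard (Fin n) s.card := Set.powersetCard.ofCard rfl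
  by_cases h : Disjoint a.val b.val
  · refine Or.inr ⟨((Set.powersetCard.permOfDisjoint h).sign : ℤˣ),
      (Set.powersetCard.disjUnion h).val, ?_, ?_⟩
    · rw [(Set.powersetCard.disjUnion h).2, add_comm]
    · exact (basis_mul_of_disjoint (Pi.basisFun A (Fin n)) a b h).trans
        (Units.smul_def _ _)
  · exact Or.inl (basis_mul_of_not_disjoint (Pi.basisFun A (Fin n)) a b h)

/-- The exterior algebra is spanned by products of generators. -/
theorem gen_induction {p : Ext A n → Prop} (x : Ext A n)
    (h₀ : ∀ a, p (algebraMap A _ a)) (hadd : ∀ x y, p x → p y → p (x + y))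
    (hgen : ∀ i x, p x → p (gen A n i * x)) : p x := by
  suffices H : ∀ a : A, p (a • x) by simpa using H 1
  induction x using CliffordAlgebra.left_induction with
  | algebraMap r =>
    intro a
    have h : a • (algebraMap A (Ext A n)) r = algebraMap A _ (a * r) := by
      rw [map_mul, Algebra.smul_def]
    exact h ▸ h₀ (a * r)
  | add x y hx hy => exact fun a => smul_add a x y ▸ hadd _ _ (hx a) (hy a)
  | ι_mul x m hx =>
    intro a
    have h : a • (ι A m * x) = ∑ i, gen A n i * ((a * m i) • x) := by
      rw [ι_eq_sum_gen, Finset.sum_mul, Finset.smul_sum]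
      exact Finset.sum_congr rfl fun i _ => by
        rw [smul_mul_assoc, mul_smul_comm, smul_smul]
    refine (congrArg p h).mpr (Finset.sum_induction _ p hadd ?_ fun i _ => hgen i _ (hx _))
    simpa using h₀ 0

variable (A n) in
/-- The operator `θᵢ ∧ (-)`, linear over a subring `B`. -/
def wedge (B : Type*) [CommRing B] [Algebra B A] (i : Fin n) : Module.End B (Ext A n) :=
  (LinearMap.mulLeft A (gen A n i)).restrictScalars B

variable (A n) in
/-- The contraction `θᵢ*`, linear over a subring `B`. -/
def contr (B : Type*) [CommRing B] [Algebra B A] (i : Fin n) : Module.End B (Ext A n) :=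
  (CliffordAlgebra.contractLeft (Q := (0 : QuadraticForm A (Fin n → A)))
    (LinearMap.proj i)).restrictScalars B

variable {B : Type*} [CommRing B] [Algebra B A]

/-- A `B`-linear endomorphism of the coefficient ring acts on the exterior algebra
coefficientwise. -/
def coeff (φ : Module.End B A) : Module.End B (Ext A n) where
  toFun x := (monomial A n).repr.symm
    (Finsupp.mapRange φ (map_zero φ) ((monomial A n).repr x))
  map_add' x y := by
    rw [map_add, Finsupp.mapRange_add (map_add φ), map_add]
  map_smul' b x := by
    have h : Finsupp.mapRange φ (map_zero φ) (algebraMap B A b • (monomial A n).repr x) =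
        algebraMap B A b • Finsupp.mapRange φ (map_zero φ) ((monomial A n).repr x) :=
      Finsupp.ext fun s => by simp
    rw [← algebraMap_smul A b x, map_smul, h, map_smul, algebraMap_smul, RingHom.id_apply]

theorem coeff_smul_monomial (φ : Module.End B A) (a : A) (s : Finset (Fin n)) :
    coeff φ (a • monomial A n s) = φ a • monomial A n s := by
  simp [coeff, Finsupp.mapRange_single]

theorem endo_ext {M : Type*} [AddCommGroup M] [Module B M] {f g : Ext A n →ₗ[B] M}
    (h : ∀ (a : A) (s : Finset (Fin n)), f (a • monomial A n s) = g (a • monomial A n s)) : f = g := by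
  refine LinearMap.ext fun x => ?_
  rw [← (monomial A n).sum_repr x, map_sum, map_sum]
  exact Finset.sum_congr rfl fun s _ => h _ s

theorem endo_ext_gen {M : Type*} [AddCommGroup M] [Module B M] {f g : Ext A n →ₗ[B] M}
    (h₀ : ∀ a, f (algebraMap A _ a) = g (algebraMap A _ a))
    (h₁ : ∀ i x, f x = g x → f (gen A n i * x) = g (gen A n i * x)) : f = g := by
  refine LinearMap.ext fun x => gen_induction x h₀ (fun x y hx hy => ?_) h₁
  rw [map_add, map_add, hx, hy]

theorem coeff_algebraMap (φ : Module.End B A) (a : A) :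
    coeff φ (algebraMap A (Ext A n) a) = algebraMap A _ (φ a) := by
  simp only [Algebra.algebraMap_eq_smul_one, one_eq_monomial]
  exact coeff_smul_monomial φ a ∅

theorem coeff_one : coeff (1 : Module.End B A) = (1 : Module.End B (Ext A n)) :=
  endo_ext fun a s => by rw [coeff_smul_monomial]; rfl

theorem coeff_mul (φ ψ : Module.End B A) :
    coeff (φ * ψ) = (coeff φ * coeff ψ : Module.End B (Ext A n)) :=
  endo_ext fun a s => by
    rw [Module.End.mul_apply, coeff_smul_monomial, coeff_smul_monomial, coeff_smul_monomial]; rfl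

theorem coeff_sub (φ ψ : Module.End B A) :
    coeff (φ - ψ) = (coeff φ - coeff ψ : Module.End B (Ext A n)) :=
  endo_ext fun a s => by
    rw [LinearMap.sub_apply, coeff_smul_monomial, coeff_smul_monomial, coeff_smul_monomial,
      LinearMap.sub_apply, sub_smul]

theorem coeff_zero : coeff (0 : Module.End B A) = (0 : Module.End B (Ext A n)) :=
  endo_ext fun a s => by rw [coeff_smul_monomial]; simp

theorem coeff_lsmul (y : A) (x : Ext A n) :
    coeff (Algebra.lmul B A y : Module.End B A) x = y • x := by
  have h : coeff (Algebra.lmul B A y : Module.End B A) =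
      ((LinearMap.lsmul A (Ext A n) y).restrictScalars B : Module.End B (Ext A n)) :=
    endo_ext fun a s => by rw [coeff_smul_monomial]; simp [smul_smul, mul_comm]
  rw [h]; rfl

theorem coeff_wedge (φ : Module.End B A) (i : Fin n) :
    coeff φ * wedge A n B i = wedge A n B i * coeff φ := by
  refine endo_ext fun a s => ?_
  simp only [Module.End.mul_apply, coeff_smul_monomial]
  change coeff φ (gen A n i * a • monomial A n s) = gen A n i * φ a • monomial A n s
  rw [mul_smul_comm, mul_smul_comm]
  rcases gen_mul_monomial (A := A) i s with h | ⟨z, t, -, h⟩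
  · rw [h, smul_zero, smul_zero, map_zero]
  · rw [h, smul_comm, smul_comm (φ a), map_zsmul, coeff_smul_monomial]

theorem wedge_apply (i : Fin n) (x : Ext A n) : wedge A n B i x = gen A n i * x := rfl

theorem contr_algebraMap (i : Fin n) (a : A) : contr A n B i (algebraMap A _ a) = 0 :=
  CliffordAlgebra.contractLeft_algebraMap (Q := (0 : QuadraticForm A (Fin n → A)))
    (LinearMap.proj i) a

theorem contr_gen_mul (i j : Fin n) (x : Ext A n) :
    contr A n B i (gen A n j * x) = (if i = j then x else 0) - gen A n j * contr A n B i x := by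
  refine (CliffordAlgebra.contractLeft_ι_mul (Q := (0 : QuadraticForm A (Fin n → A)))
    (LinearMap.proj i) (Pi.single j 1 : Fin n → A) x).trans ?_
  congr 1
  by_cases h : i = j
  · subst h; simp
  · simp [h]

theorem contr_wedge_self (i : Fin n) :
    contr A n B i * wedge A n B i + wedge A n B i * contr A n B i = 1 :=
  LinearMap.ext fun x => by
    simp [wedge_apply, contr_gen_mul]

theorem contr_wedge_of_ne {i j : Fin n} (h : i ≠ j) :
    contr A n B i * wedge A n B j = -(wedge A n B j * contr A n B i) :=
  LinearMap.ext fun x => by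
    simp [wedge_apply, contr_gen_mul, h]

theorem wedge_comm (i j : Fin n) :
    wedge A n B i * wedge A n B j = -(wedge A n B j * wedge A n B i) :=
  LinearMap.ext fun x => by
    simp [wedge_apply, ← mul_assoc, gen_mul_comm i j]

theorem contr_mul_self (i : Fin n) : contr A n B i * contr A n B i = 0 :=
  LinearMap.ext fun x => CliffordAlgebra.contractLeft_contractLeft
    (Q := (0 : QuadraticForm A (Fin n → A))) (LinearMap.proj i) x

theorem contr_comm (i j : Fin n) :
    contr A n B i * contr A n B j = -(contr A n B j * contr A n B i) :=
  LinearMap.ext fun x =>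
    CliffordAlgebra.contractLeft_comm (Q := (0 : QuadraticForm A (Fin n → A))) (LinearMap.proj i)
    (LinearMap.proj j) x

theorem coeff_contr (φ : Module.End B A) (i : Fin n) :
    coeff φ * contr A n B i = contr A n B i * coeff φ := by
  refine endo_ext_gen (fun a => ?_) fun j x hx => ?_
  · simp only [Module.End.mul_apply, coeff_algebraMap, contr_algebraMap, map_zero]
  · have hw : ∀ z, coeff φ (gen A n j * z) = gen A n j * coeff φ z := fun z =>
      LinearMap.congr_fun (coeff_wedge φ j) z
    simp only [Module.End.mul_apply, contr_gen_mul, hw, map_sub] at hx ⊢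
    rw [hx]
    split_ifs <;> simp

/-- The filtration of the exterior algebra by the degree in the `θᵢ`. -/
def filtration (A : Type*) [CommRing A] (n : ℕ) : ℕ → Submodule A (Ext A n)
  | 0 => ⊤
  | p + 1 => ⨆ i, (filtration A n p).map (LinearMap.mulLeft A (gen A n i))

theorem gen_mul_mem {p : ℕ} {x : Ext A n} (hx : x ∈ filtration A n p) (i : Fin n) :
    gen A n i * x ∈ filtration A n (p + 1) :=
  Submodule.mem_iSup_of_mem i ⟨x, hx, rfl⟩

@[elab_as_elim] theorem filtration_succ_induction {p : ℕ} {q : Ext A n → Prop} {x : Ext A n}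
    (hx : x ∈ filtration A n (p + 1)) (gen_mul : ∀ i, ∀ y ∈ filtration A n p, q (gen A n i * y))
    (zero : q 0) (add : ∀ x y, q x → q y → q (x + y)) : q x := by
  refine Submodule.iSup_induction _ (motive := q) hx (fun i y hy => ?_) zero add
  obtain ⟨z, hz, rfl⟩ := hy
  exact gen_mul i z hz

theorem filtration_antitone {p : ℕ} {x : Ext A n} (hx : x ∈ filtration A n (p + 1)) :
    x ∈ filtration A n p := by
  induction p generalizing x with
  | zero => trivial
  | succ p ih =>
    exact filtration_succ_induction hx (fun i y hy => gen_mul_mem (ih hy) i) (zero_mem _)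
      fun _ _ => add_mem

theorem ι_mul_mem {p : ℕ} {x : Ext A n} (hx : x ∈ filtration A n p) (m : Fin n → A) :
    ι A m * x ∈ filtration A n (p + 1) := by
  rw [ι_eq_sum_gen, Finset.sum_mul]
  refine sum_mem fun i _ => ?_
  rw [smul_mul_assoc]
  exact Submodule.smul_mem _ _ (gen_mul_mem hx i)

theorem repr_of_mem_filtration {p : ℕ} {x : Ext A n} (hx : x ∈ filtration A n p)
    (s : Finset (Fin n)) (hs : s.card < p) : (monomial A n).repr x s = 0 := by
  induction p generalizing x s with
  | zero => omega
  | succ p ih =>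
    refine filtration_succ_induction hx (fun i y hy => ?_) (by simp) fun a b ha hb => by simp [ha, hb]
    rw [← (monomial A n).sum_repr y, Finset.mul_sum, map_sum, Finsupp.finsetSum_apply]
    refine Finset.sum_eq_zero fun t _ => ?_
    rw [mul_smul_comm, map_smul, Finsupp.smul_apply]
    by_cases ht : t.card < p
    · rw [ih hy t ht, zero_smul]
    · rcases gen_mul_monomial (A := A) i t with h | ⟨z, t', hc, h⟩
      · rw [h]; simp
      · rw [h, map_zsmul, Module.Basis.repr_self, Finsupp.smul_apply, Finsupp.single_eq_of_ne,
          smul_zero, smul_zero]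
        rintro rfl
        omega

theorem filtration_eq_zero {p : ℕ} (hp : n < p) {x : Ext A n} (hx : x ∈ filtration A n p) :
    x = 0 := by
  refine (monomial A n).repr.injective (Finsupp.ext fun s => ?_)
  rw [map_zero, repr_of_mem_filtration hx s]
  · rfl
  · exact lt_of_le_of_lt (by simpa using Finset.card_le_univ s) hp

theorem coeff_mem_filtration (φ : Module.End B A) {p : ℕ} {x : Ext A n}
    (hx : x ∈ filtration A n p) : coeff φ x ∈ filtration A n p := by
  induction p generalizing x with
  | zero => trivial
  | succ p ih =>
    refine filtration_succ_induction hx (fun i y hy => ?_) (by simp) fun a b ha hb => by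
      rw [map_add]; exact add_mem ha hb
    have h : coeff φ (gen A n i * y) = gen A n i * coeff φ y :=
      LinearMap.congr_fun (coeff_wedge φ i) y
    rw [h]
    exact gen_mul_mem (ih hy) i

theorem contr_mem_filtration (i : Fin n) {p : ℕ} {x : Ext A n}
    (hx : x ∈ filtration A n (p + 1)) : contr A n B i x ∈ filtration A n p := by
  induction p generalizing x with
  | zero => trivial
  | succ p ih =>
    refine filtration_succ_induction hx (fun j y hy => ?_) (by simp) fun a b ha hb => by
      rw [map_add]; exact add_mem ha hb
    rw [contr_gen_mul]
    refine sub_mem ?_ (gen_mul_mem (ih hy) j)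
    split_ifs
    · exact hy
    · exact zero_mem _

theorem contr_wedge_mem_filtration (i : Fin n) {p : ℕ} {x : Ext A n}
    (hx : x ∈ filtration A n p) : contr A n B i (gen A n i * x) ∈ filtration A n p :=
  contr_mem_filtration i (gen_mul_mem hx i)

theorem involute_gen_mul (i : Fin n) (x : Ext A n) :
    CliffordAlgebra.involute (gen A n i * x) = -(gen A n i * CliffordAlgebra.involute x) := by
  rw [map_mul, gen]
  erw [CliffordAlgebra.involute_ι]
  rw [neg_mul]

theorem involute_mem_filtration {p : ℕ} {x : Ext A n} (hx : x ∈ filtration A n p) :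
    CliffordAlgebra.involute x ∈ filtration A n p := by
  induction p generalizing x with
  | zero => trivial
  | succ p ih =>
    refine filtration_succ_induction hx (fun i y hy => ?_) (by simp) fun a b ha hb => by
      rw [map_add]; exact add_mem ha hb
    rw [involute_gen_mul]
    exact neg_mem (gen_mul_mem (ih hy) i)

end Operators

end KoszulContraction

/-! ### Contraction of Koszul complexes -/

namespace KoszulContraction

open ExteriorAlgebra

section RingIdentities

/-! In these identities `Y` and `Q` stand for multiplication and division by a `yⱼ`, `F` for the
substitution `yⱼ = 0`, `S` and `T` for `θⱼ*` and `θⱼ ∧ (-)`, and `V` for the grading involution. They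
are stated in an abstract ring, where `noncomm_ring` is cheap. -/

variable {M : Type*} [Ring M]

theorem direction_self {Y S T Q F : M} (QY : Q * Y = 1) (YQ : Y * Q = 1 - F) (QS : Q * S = S * Q)
    (YT : Y * T = T * Y) (ST : S * T + T * S = 1) :
    Y * S * (Q * T) + Q * T * (Y * S) = 1 - F * (S * T) :=
  calc Y * S * (Q * T) + Q * T * (Y * S)
      = Y * (S * Q) * T + Q * (T * Y) * S := by noncomm_ring
    _ = Y * Q * (S * T) + Q * Y * (T * S) := by rw [← QS, ← YT]; noncomm_ring
    _ = (S * T + T * S) - F * (S * T) := by rw [YQ, QY]; noncomm_ring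
    _ = _ := by rw [ST]

theorem direction_other {Y S T Q : M} (QY : Q * Y = Y * Q) (QS : Q * S = S * Q)
    (YT : Y * T = T * Y) (ST : S * T = -(T * S)) :
    Y * S * (Q * T) + Q * T * (Y * S) = 0 :=
  calc Y * S * (Q * T) + Q * T * (Y * S)
      = Y * (S * Q) * T + Q * (T * Y) * S := by noncomm_ring
    _ = Y * Q * (S * T) + Q * Y * (T * S) := by rw [← QS, ← YT]; noncomm_ring
    _ = 0 := by rw [ST, QY]; noncomm_ring

theorem direction_self_comm {Y S T F : M} (FY : F * Y = 0) (YS : Y * S = S * Y)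
    (YT : Y * T = T * Y) (FS : F * S = S * F) (SS : S * S = 0) :
    Y * S * (F * (S * T)) = F * (S * T) * (Y * S) := by
  have h1 : Y * S * (F * (S * T)) = Y * (S * F) * S * T := by noncomm_ring
  have h2 : F * (S * T) * (Y * S) = F * S * (T * Y) * S := by noncomm_ring
  rw [h1, h2, ← FS, ← YT]
  have h3 : Y * (F * S) * S * T = Y * F * (S * S) * T := by noncomm_ring
  have h4 : F * S * (Y * T) * S = F * (S * Y) * T * S := by noncomm_ring
  rw [h3, h4, SS, ← YS]
  have h5 : F * (Y * S) * T * S = F * Y * S * T * S := by noncomm_ring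
  rw [h5, FY]
  noncomm_ring

theorem direction_other_comm {Y S S' T' F : M} (FY : F * Y = Y * F) (YS : Y * S' = S' * Y)
    (YT : Y * T' = T' * Y) (FS : F * S = S * F) (SS : S * S' = -(S' * S))
    (ST : S * T' = -(T' * S)) :
    Y * S * (F * (S' * T')) = F * (S' * T') * (Y * S) :=
  calc Y * S * (F * (S' * T')) = Y * (S * F) * S' * T' := by noncomm_ring
    _ = Y * F * (S * S') * T' := by rw [← FS]; noncomm_ring
    _ = -(Y * F * S' * (S * T')) := by rw [SS]; noncomm_ring
    _ = F * Y * S' * (T' * S) := by rw [ST, FY]; noncomm_ring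
    _ = F * (Y * S') * T' * S := by noncomm_ring
    _ = F * S' * (Y * T') * S := by rw [YS]; noncomm_ring
    _ = _ := by rw [YT]; noncomm_ring

theorem anticomm_mul {Q T V : M} (QV : Q * V = V * Q) (VT : V * T = -(T * V)) :
    Q * T * V = -(V * (Q * T)) :=
  calc Q * T * V = -(Q * -(T * V)) := by noncomm_ring
    _ = -(Q * V * T) := by rw [← VT]; noncomm_ring
    _ = _ := by rw [QV]; noncomm_ring

theorem comm_mul {F S T V : M} (FV : F * V = V * F) (VT : V * T = -(T * V))
    (SV : S * V = -(V * S)) : F * (S * T) * V = V * (F * (S * T)) :=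
  calc F * (S * T) * V = -(F * S * -(T * V)) := by noncomm_ring
    _ = -(F * (S * V) * T) := by rw [← VT]; noncomm_ring
    _ = F * V * (S * T) := by rw [SV]; noncomm_ring
    _ = _ := by rw [FV]; noncomm_ring

theorem comm_mul' {F S T T' : M} (FT : F * T' = T' * F) (TT : T * T' = -(T' * T))
    (ST : S * T' = -(T' * S)) : F * (S * T) * T' = T' * (F * (S * T)) :=
  calc F * (S * T) * T' = F * S * (T * T') := by noncomm_ring
    _ = -(F * (S * T') * T) := by rw [TT]; noncomm_ring
    _ = F * T' * S * T := by rw [ST]; noncomm_ring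
    _ = _ := by rw [FT]; noncomm_ring

theorem compose_contractions {D h P K p : M} (h1 : D * h + h * D = 1 - P) (h2 : D * P = P * D)
    (s1 : D * K + K * D = 1 - p) :
    D * (h + P * K) + (h + P * K) * D = 1 - P * p :=
  calc D * (h + P * K) + (h + P * K) * D
      = (D * h + h * D) + ((D * P) * K + P * (K * D)) := by noncomm_ring
    _ = (1 - P) + P * (D * K + K * D) := by rw [h1, h2]; noncomm_ring
    _ = _ := by rw [s1]; noncomm_ring

theorem compose_anticomm {h P K V : M} (h3 : h * V = -(V * h)) (KV : K * V = -(V * K))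
    (PV : P * V = V * P) : (h + P * K) * V = -(V * (h + P * K)) :=
  calc (h + P * K) * V = h * V + P * (K * V) := by noncomm_ring
    _ = -(V * h) - P * V * K := by rw [h3, KV]; noncomm_ring
    _ = _ := by rw [PV]; noncomm_ring

end RingIdentities

section Contraction

variable {A : Type*} [CommRing A] {n : ℕ} {B : Type*} [CommRing B] [Algebra B A]

/-- The grading involution as a `B`-linear operator. -/
def invol (A : Type*) [CommRing A] (n : ℕ) (B : Type*) [CommRing B] [Algebra B A] :
    Module.End B (Ext A n) :=
  (CliffordAlgebra.involute : Ext A n →ₐ[A] Ext A n).toLinearMap.restrictScalars B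

theorem invol_apply (x : Ext A n) : invol A n B x = CliffordAlgebra.involute x := rfl

theorem invol_wedge (i : Fin n) : invol A n B * wedge A n B i = -(wedge A n B i * invol A n B) :=
  LinearMap.ext fun x => involute_gen_mul i x

theorem involute_algebraMap (a : A) :
    CliffordAlgebra.involute (algebraMap A (Ext A n) a) = algebraMap A _ a :=
  AlgHom.commutes _ a

theorem coeff_invol (φ : Module.End B A) :
    coeff φ * invol A n B = invol A n B * coeff φ := by
  refine endo_ext_gen (fun a => ?_) fun j x hx => ?_
  · simp only [Module.End.mul_apply, coeff_algebraMap, invol_apply, involute_algebraMap]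
  · have hw : ∀ z, coeff φ (gen A n j * z) = gen A n j * coeff φ z := fun z =>
      LinearMap.congr_fun (coeff_wedge φ j) z
    simp only [Module.End.mul_apply, invol_apply, involute_gen_mul, hw, map_neg] at hx ⊢
    rw [hx]

theorem contr_invol (i : Fin n) :
    contr A n B i * invol A n B = -(invol A n B * contr A n B i) := by
  refine endo_ext_gen (fun a => ?_) fun j x hx => ?_
  · simp only [Module.End.mul_apply, LinearMap.neg_apply, invol_apply, involute_algebraMap,
      contr_algebraMap, map_zero, neg_zero]
  · simp only [Module.End.mul_apply, LinearMap.neg_apply, invol_apply, involute_gen_mul,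
      contr_gen_mul, map_neg, map_sub] at hx ⊢
    rw [hx]
    split_ifs
    · simp only [mul_neg, sub_neg_eq_add]
    · simp

/-- The Koszul differential `∑ᵢ yᵢ θᵢ*`. -/
def koszulD (B : Type*) [CommRing B] [Algebra B A] (y : Fin n → A) : Module.End B (Ext A n) :=
  ∑ l, coeff (Algebra.lmul B A (y l) : Module.End B A) * contr A n B l

variable {y : Fin n → A} {e : Fin n → A →ₐ[B] A} {q : Fin n → Module.End B A}

/-- Coefficientwise division by `yⱼ` followed by `θⱼ ∧ (-)` contracts the Koszul complex in the
`j`-th direction. -/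
theorem koszulD_step (he : ∀ i, e i (y i) = 0) (he' : ∀ i j, i ≠ j → e i (y j) = y j)
    (hq : ∀ i a, a - e i a = y i * q i a) (hq' : ∀ i a, q i (y i * a) = a)
    (hqy : ∀ i j a, i ≠ j → q i (y j * a) = y j * q i a) (j : Fin n) :
    (koszulD B y * (coeff (q j) * wedge A n B j) + (coeff (q j) * wedge A n B j) * koszulD B y =
      1 - coeff (e j).toLinearMap * (contr A n B j * wedge A n B j)) ∧
    koszulD B y * (coeff (e j).toLinearMap * (contr A n B j * wedge A n B j)) =
      coeff (e j).toLinearMap * (contr A n B j * wedge A n B j) * koszulD B y := by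
  set Y : Fin n → Module.End B (Ext A n) := fun l => coeff (Algebra.lmul B A (y l)) with hY
  set S : Fin n → Module.End B (Ext A n) := contr A n B with hS
  set T : Fin n → Module.End B (Ext A n) := wedge A n B with hT
  set Q : Module.End B (Ext A n) := coeff (q j) with hQ
  set F : Module.End B (Ext A n) := coeff (e j).toLinearMap with hF
  have hD : koszulD B y = ∑ l, Y l * S l := rfl
  have QY : Q * Y j = 1 := by
    rw [hQ, hY, ← coeff_mul, ← coeff_one]
    congr 1
    exact LinearMap.ext fun a => hq' j a
  have YQ : Y j * Q = 1 - F := by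
    rw [hQ, hY, ← coeff_mul, ← coeff_one, hF, ← coeff_sub]
    congr 1
    exact LinearMap.ext fun a => (hq j a).symm
  have FY : F * Y j = 0 := by
    rw [hF, hY, ← coeff_mul, ← coeff_zero]
    congr 1
    exact LinearMap.ext fun a => by simp [he]
  have QY' : ∀ l, j ≠ l → Q * Y l = Y l * Q := fun l h => by
    rw [hQ, hY, ← coeff_mul, ← coeff_mul]
    congr 1
    exact LinearMap.ext fun a => hqy j l a h
  have FY' : ∀ l, j ≠ l → F * Y l = Y l * F := fun l h => by
    rw [hF, hY, ← coeff_mul, ← coeff_mul]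
    congr 1
    exact LinearMap.ext fun a => by simp [he' j l h]
  have YS : ∀ l m, Y l * S m = S m * Y l := fun l m => coeff_contr _ _
  have YT : ∀ l m, Y l * T m = T m * Y l := fun l m => coeff_wedge _ _
  have QS : ∀ m, Q * S m = S m * Q := fun m => coeff_contr _ _
  have QT : ∀ m, Q * T m = T m * Q := fun m => coeff_wedge _ _
  have FS : ∀ m, F * S m = S m * F := fun m => coeff_contr _ _
  have FT : ∀ m, F * T m = T m * F := fun m => coeff_wedge _ _
  have ST : ∀ l, l ≠ j → S l * T j = -(T j * S l) := fun l h => contr_wedge_of_ne h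
  have SS : ∀ l, S l * S j = -(S j * S l) := fun l => contr_comm l j
  have STj : S j * T j + T j * S j = 1 := contr_wedge_self j
  have SSj : S j * S j = 0 := contr_mul_self j
  constructor
  · rw [hD, Finset.sum_mul, Finset.mul_sum, ← Finset.sum_add_distrib, Finset.sum_eq_single j]
    · exact direction_self QY YQ (QS j) (YT j j) STj
    · exact fun l _ h => direction_other (QY' l h.symm) (QS l) (YT l j) (ST l h)
    · exact fun h => absurd (Finset.mem_univ j) h
  · rw [hD, Finset.sum_mul, Finset.mul_sum]
    refine Finset.sum_congr rfl fun l _ => ?_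
    by_cases h : l = j
    · subst h
      exact direction_self_comm FY (YS l l) (YT l l) (FS l) SSj
    · exact direction_other_comm (FY' l (Ne.symm h)) (YS l j) (YT l j) (FS l) (SS l) (ST l h)

/-- A contraction of the Koszul complex on `y` in the first `j` directions, where the `yᵢ` can be
divided out one after the other: `{d, h} = 1 - P`, and `P` evaluates the coefficients at
`y₁ = … = yⱼ = 0` and kills `θ₁, …, θⱼ`. -/
theorem exists_contraction (he : ∀ i, e i (y i) = 0) (he' : ∀ i j, i ≠ j → e i (y j) = y j)
    (hq : ∀ i a, a - e i a = y i * q i a) (hq' : ∀ i a, q i (y i * a) = a)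
    (hqy : ∀ i j a, i ≠ j → q i (y j * a) = y j * q i a) (j : ℕ) (hj : j ≤ n) :
    ∃ (h P : Module.End B (Ext A n)) (ε : A →ₐ[B] A),
      koszulD B y * h + h * koszulD B y = 1 - P ∧ koszulD B y * P = P * koszulD B y ∧
      h * invol A n B = -(invol A n B * h) ∧
      (∀ p, ∀ x ∈ filtration A n p, h x ∈ filtration A n (p + 1)) ∧
      (∀ p, ∀ x ∈ filtration A n p, P x ∈ filtration A n p) ∧
      P * invol A n B = invol A n B * P ∧
      (∀ l : Fin n, (l : ℕ) < j → P * wedge A n B l = 0) ∧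
      (∀ a, P (algebraMap A _ a) = algebraMap A _ (ε a)) ∧
      ∀ l : Fin n, (l : ℕ) < j → ε (y l) = 0 := by
  induction j with
  | zero =>
    refine ⟨0, 1, AlgHom.id B A, by simp, by simp, by simp, fun p x _ => zero_mem _,
      fun p x hx => hx, by simp, fun l hl => by omega, fun a => rfl, fun l hl => by omega⟩
  | succ j ih =>
    obtain ⟨h, P, ε, h1, h2, h3, h4, h5, h6, h7, h8, h9⟩ := ih (by omega)
    let m : Fin n := ⟨j, by omega⟩
    obtain ⟨s1, s2⟩ := koszulD_step he he' hq hq' hqy m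
    set D := koszulD B y
    set K := coeff (q m) * wedge A n B m with hK
    set p₀ := coeff (e m).toLinearMap * (contr A n B m * wedge A n B m) with hp₀
    have K_invol : K * invol A n B = -(invol A n B * K) :=
      anticomm_mul (coeff_invol (q m)) (invol_wedge m)
    have p_invol : p₀ * invol A n B = invol A n B * p₀ :=
      comm_mul (coeff_invol _) (invol_wedge m) (contr_invol m)
    refine ⟨h + P * K, P * p₀, ε.comp (e m), compose_contractions h1 h2 s1, ?_,
      compose_anticomm h3 K_invol h6, ?_, ?_, ?_, ?_, ?_, ?_⟩
    · exact (mul_assoc D P p₀).symm.trans ((congrArg (· * p₀) h2).trans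
        ((mul_assoc P D p₀).trans ((congrArg (P * ·) s2).trans (mul_assoc P p₀ D).symm)))
    · intro p x hx
      have hK' : K x ∈ filtration A n (p + 1) :=
        coeff_mem_filtration (q m) (x := gen A n m * x) (gen_mul_mem hx m)
      exact add_mem (h4 p x hx) (h5 (p + 1) (K x) hK')
    · intro p x hx
      have hp' : p₀ x ∈ filtration A n p :=
        coeff_mem_filtration (e m).toLinearMap (x := contr A n B m (gen A n m * x))
          (contr_wedge_mem_filtration m hx)
      exact h5 p (p₀ x) hp'
    · exact (mul_assoc P p₀ _).trans ((congrArg (P * ·) p_invol).trans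
        ((mul_assoc P _ p₀).symm.trans ((congrArg (· * p₀) h6).trans (mul_assoc _ P p₀))))
    · intro l hl
      by_cases hlm : m = l
      · refine LinearMap.ext fun x => ?_
        have : gen A n m * (gen A n l * x) = 0 := by
          rw [← hlm, ← mul_assoc, gen_mul_self, zero_mul]
        simp only [Module.End.mul_apply, hp₀, wedge_apply, this, map_zero, LinearMap.zero_apply]
      · have hlj : (l : ℕ) < j := by
          have : (l : ℕ) ≠ j := fun h => hlm (Fin.ext h.symm)
          omega
        have : p₀ * wedge A n B l = wedge A n B l * p₀ :=
          comm_mul' (coeff_wedge _ l) (wedge_comm m l) (contr_wedge_of_ne hlm)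
        refine (mul_assoc P p₀ _).trans ((congrArg (P * ·) this).trans
          ((mul_assoc P _ p₀).symm.trans ((congrArg (· * p₀) (h7 l hlj)).trans (zero_mul p₀))))
    · intro a
      have : contr A n B m (gen A n m * algebraMap A _ a) = algebraMap A _ a := by
        rw [contr_gen_mul, contr_algebraMap, if_pos rfl, mul_zero, sub_zero]
      simp only [Module.End.mul_apply, hp₀, wedge_apply, this, coeff_algebraMap, h8]
      rfl
    · intro l hl
      by_cases hlm : m = l
      · rw [← hlm, AlgHom.comp_apply, he, map_zero]
      · have hlj : (l : ℕ) < j := by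
          have : (l : ℕ) ≠ j := fun h => hlm (Fin.ext h.symm)
          omega
        rw [AlgHom.comp_apply, he' m l hlm, h9 l hlj]

end Contraction

end KoszulContraction

/-! ### The Koszul complex of the diagonal -/

section UnitContraction

open MvPolynomial KoszulContraction

variable (k : Type u) [CommRing k] {n : ℕ}

/-- The substitution `x'ᵢ ↦ fᵢ` in `k[x, x']`, leaving `x` fixed. -/
def substR (f : Fin n → PolE k n) : PolE k n →ₐ[Pol k n] PolE k n :=
  Algebra.TensorProduct.lift (Algebra.ofId (Pol k n) (PolE k n)) (aeval f : Pol k n →ₐ[k] PolE k n)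
    (fun _ _ => Commute.all _ _)

theorem substR_varL (f : Fin n → PolE k n) (i : Fin n) : substR k f (varL k i) = varL k i := by
  simp [substR, varL, Algebra.ofId_apply]

theorem substR_varR (f : Fin n → PolE k n) (i : Fin n) : substR k f (varR k i) = f i := by
  simp [substR, varR]
  exact one_mul (f i)

theorem algHom_ext_varR {S : Type*} [CommRing S] [Algebra k S] [Algebra (Pol k n) S]
    [IsScalarTower k (Pol k n) S] {f g : PolE k n →ₐ[Pol k n] S}
    (h : ∀ i, f (varR k i) = g (varR k i)) : f = g := by
  refine Algebra.TensorProduct.ext (Subsingleton.elim _ _) (MvPolynomial.algHom_ext fun i => ?_)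
  exact h i

/-- `xᵢ - x'ᵢ` is not a zero divisor in `k[x, x']`. -/
theorem isLeftRegular_varL_sub_varR (i : Fin n) : IsLeftRegular (varL k i - varR k i) := by
  -- The involution `x'ₗ ↦ xₗ - x'ₗ` turns `xᵢ - x'ᵢ` into the variable `x'ᵢ`.
  let σ := substR k fun l : Fin n => varL k l - varR k l
  have hσ : σ.comp σ = AlgHom.id (Pol k n) (PolE k n) := algHom_ext_varR k fun i => by
    simp [σ, substR_varR, substR_varL]
  have hy : algebraTensorAlgEquiv k (Pol k n) (σ (varL k i - varR k i)) = X i := by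
    rw [map_sub, substR_varR, substR_varL, sub_sub_cancel]
    exact ((AlgEquiv.symm_apply_eq _).1 (algebraTensorAlgEquiv_symm_X k (Pol k n) i)).symm
  intro a b hab
  have h1 : X i * algebraTensorAlgEquiv k (Pol k n) (σ a) =
      X i * algebraTensorAlgEquiv k (Pol k n) (σ b) := by
    rw [← hy, ← map_mul, ← map_mul, ← map_mul, ← map_mul]
    exact congrArg (fun c => algebraTensorAlgEquiv k (Pol k n) (σ c)) hab
  have h2 : σ a = σ b := (algebraTensorAlgEquiv k (Pol k n)).injective (isRegular_X.left h1)
  rw [← AlgHom.id_apply (R := Pol k n) a, ← AlgHom.id_apply (R := Pol k n) b, ← hσ]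
  exact congrArg σ h2

/-- The substitution `x'ᵢ ↦ xᵢ`. -/
def evalDiag (i : Fin n) : PolE k n →ₐ[Pol k n] PolE k n :=
  substR k fun l => if l = i then varL k l else varR k l

theorem dvd_sub_evalDiag (i : Fin n) (a : PolE k n) :
    varL k i - varR k i ∣ a - evalDiag k i a := by
  rw [← Ideal.mem_span_singleton, ← Ideal.Quotient.eq]
  set J : Ideal (PolE k n) := Ideal.span {varL k i - varR k i}
  have h : Ideal.Quotient.mkₐ (Pol k n) J =
      (Ideal.Quotient.mkₐ (Pol k n) J).comp (evalDiag k i) := by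
    refine algHom_ext_varR k (S := PolE k n ⧸ J) fun l => ?_
    rw [AlgHom.comp_apply, evalDiag, substR_varR]
    split_ifs with h
    · subst h
      rw [Ideal.Quotient.mkₐ_eq_mk, eq_comm, Ideal.Quotient.eq]
      exact Ideal.mem_span_singleton_self _
    · rfl
  exact DFunLike.congr_fun h a

theorem evalDiag_self (i : Fin n) : evalDiag k i (varL k i - varR k i) = 0 := by
  rw [map_sub, evalDiag, substR_varL, substR_varR, if_pos rfl, sub_self]

theorem evalDiag_of_ne {i j : Fin n} (h : i ≠ j) :
    evalDiag k i (varL k j - varR k j) = varL k j - varR k j := by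
  rw [map_sub, evalDiag, substR_varL, substR_varR, if_neg h.symm]

/-- The divided difference `(f - f|_{x'ᵢ = xᵢ}) / (xᵢ - x'ᵢ)`. -/
def divDiff (i : Fin n) : Module.End (Pol k n) (PolE k n) where
  toFun a := (dvd_sub_evalDiag k i a).choose
  map_add' a b := isLeftRegular_varL_sub_varR k i <| by
    change _ * _ = _ * (_ + _)
    rw [mul_add, ← (dvd_sub_evalDiag k i (a + b)).choose_spec,
      ← (dvd_sub_evalDiag k i a).choose_spec, ← (dvd_sub_evalDiag k i b).choose_spec, map_add]
    ring
  map_smul' r a := isLeftRegular_varL_sub_varR k i <| by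
    change _ * _ = _ * (r • _)
    rw [mul_smul_comm, ← (dvd_sub_evalDiag k i (r • a)).choose_spec,
      ← (dvd_sub_evalDiag k i a).choose_spec, map_smul, smul_sub]

theorem divDiff_spec (i : Fin n) (a : PolE k n) :
    a - evalDiag k i a = (varL k i - varR k i) * divDiff k i a :=
  (dvd_sub_evalDiag k i a).choose_spec

theorem divDiff_mul_self (i : Fin n) (a : PolE k n) :
    divDiff k i ((varL k i - varR k i) * a) = a := isLeftRegular_varL_sub_varR k i <| by
  change _ * _ = _ * _
  rw [← divDiff_spec, map_mul, evalDiag_self, zero_mul, sub_zero]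

theorem divDiff_mul_of_ne {i j : Fin n} (h : i ≠ j) (a : PolE k n) :
    divDiff k i ((varL k j - varR k j) * a) = (varL k j - varR k j) * divDiff k i a :=
  isLeftRegular_varL_sub_varR k i <| by
    change _ * _ = _ * _
    rw [← divDiff_spec, map_mul, evalDiag_of_ne k h, mul_left_comm, ← divDiff_spec, mul_sub]

/-- The inclusion `R → I` of the constants of degree zero, linear for the left `R`-action. -/
def unitSec : Pol k n →+ Koszul k n :=
  (algebraMap (PolE k n) (Koszul k n) : PolE k n →+ Koszul k n).comp
    ((Algebra.TensorProduct.includeLeft : Pol k n →ₐ[k] PolE k n) : Pol k n →+ PolE k n)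

theorem unitSec_apply (r : Pol k n) :
    unitSec k r = algebraMap (PolE k n) (Koszul k n) (r ⊗ₜ 1) := rfl

theorem unitSec_mul (s r : Pol k n) :
    unitSec k (s * r) = (s ⊗ₜ[k] (1 : Pol k n)) • unitSec k r := by
  have h : (s * r) ⊗ₜ[k] (1 : Pol k n) = (s ⊗ₜ[k] (1 : Pol k n)) • r ⊗ₜ[k] (1 : Pol k n) := by
    rw [smul_eq_mul, Algebra.TensorProduct.tmul_mul_tmul, one_mul]
  rw [unitSec_apply, h]
  exact (Algebra.linearMap (PolE k n) (Koszul k n)).map_smul _ _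

theorem unitProj_algebraMap (a : PolE k n) :
    unitProj k (algebraMap (PolE k n) (Koszul k n) a) = Algebra.TensorProduct.lmul' k a := by
  simp [unitProj]

theorem unitProj_unitSec (r : Pol k n) : unitProj k (unitSec k r) = r := by
  rw [unitSec_apply, unitProj_algebraMap]
  simp

theorem unitProj_gen_mul (i : Fin n) (x : Koszul k n) : unitProj k (gen (PolE k n) n i * x) = 0 := by
  simp [unitProj, ExteriorAlgebra.algebraMapInv, gen]

theorem unitProj_of_mem_filtration {x : Koszul k n} (hx : x ∈ filtration (PolE k n) n 1) :
    unitProj k x = 0 :=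
  filtration_succ_induction hx (fun i y _ => unitProj_gen_mul k i y) (map_zero _)
    fun a b ha hb => by rw [map_add, ha, hb, add_zero]

theorem involute_unitSec (r : Pol k n) :
    CliffordAlgebra.involute (unitSec k r) = unitSec k r := involute_algebraMap _

/-- The Koszul complex of `x - x'` over `k[x, x']` contracts onto `R = k[x, x'] / (x - x')`,
linearly over the left variables. -/
theorem exists_unit_contraction : ∃ h : Koszul k n →+ Koszul k n,
    (∀ (r : Pol k n) x, h ((r ⊗ₜ[k] (1 : Pol k n)) • x) = (r ⊗ₜ[k] (1 : Pol k n)) • h x) ∧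
    (∀ x, CliffordAlgebra.contractLeft (diffForm k) (h x) +
      h (CliffordAlgebra.contractLeft (diffForm k) x) = x - unitSec k (unitProj k x)) ∧
    (∀ x, h (CliffordAlgebra.involute x) = -CliffordAlgebra.involute (h x)) ∧
    (∀ p, ∀ x ∈ filtration (PolE k n) n p, h x ∈ filtration (PolE k n) n (p + 1)) := by
  obtain ⟨h, P, ε, h1, -, h3, h4, -, -, h7, h8, h9⟩ :=
    exists_contraction (B := Pol k n) (y := fun i : Fin n => varL k i - varR k i)
      (e := evalDiag k) (q := divDiff k) (evalDiag_self k) (fun _ _ => evalDiag_of_ne k)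
      (divDiff_spec k) (divDiff_mul_self k) (fun _ _ a h => divDiff_mul_of_ne k h a) n le_rfl
  have hD : ∀ x : Koszul k n, koszulD (Pol k n) (fun i : Fin n => varL k i - varR k i) x =
      CliffordAlgebra.contractLeft (diffForm k) x := fun x => by
    simp only [koszulD, LinearMap.sum_apply, Module.End.mul_apply, coeff_lsmul, diffForm,
      map_sum, map_smul, LinearMap.smul_apply]
    rfl
  have hP : ∀ x : Koszul k n, P x = unitSec k (unitProj k x) := fun x => by
    refine gen_induction (p := fun x => P x = unitSec k (unitProj k x)) x (fun a => ?_) (fun x y hx hy => by simp only [map_add, hx, hy])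
      fun i x _ => ?_
    · have hε : ε = (Algebra.ofId (Pol k n) (PolE k n)).comp
          (Algebra.TensorProduct.lift (AlgHom.id (Pol k n) (Pol k n)) (AlgHom.id k (Pol k n))
            fun _ _ => Commute.all _ _ : PolE k n →ₐ[Pol k n] Pol k n) :=
        algHom_ext_varR k fun i => by
          have h : ε (varR k i) = ε (varL k i) := (sub_eq_zero.1 ((map_sub ε _ _).symm.trans
            (h9 i i.2))).symm
          have hl : varL k i = algebraMap (Pol k n) (PolE k n) (X i) := rfl
          rw [h, hl, AlgHom.commutes]
          simp [varR, Algebra.ofId_apply]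
      rw [h8, unitProj_algebraMap, hε]
      rfl
    · rw [unitProj_gen_mul, map_zero]
      exact LinearMap.congr_fun (h7 i i.2) x
  refine ⟨h.toAddMonoidHom, fun r x => ?_, fun x => ?_, fun x => ?_, h4⟩
  · have hr : ∀ z : Koszul k n, (r ⊗ₜ[k] (1 : Pol k n)) • z = r • z := fun z =>
      algebraMap_smul (PolE k n) r z
    rw [hr, hr]
    exact h.map_smul r x
  · have := LinearMap.congr_fun h1 x
    simp only [LinearMap.add_apply, LinearMap.sub_apply, Module.End.mul_apply, hD, hP] at this
    exact this
  · exact LinearMap.congr_fun h3 x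

end UnitContraction

/-! ### Homotopy inverses and homogeneous bases -/

namespace LF

section HomotopyInverse

variable {Q : Type u} [CommRing Q] {w : Q}

/-- A morphism `f : P ⟶ X` with a linear section `s` is a homotopy equivalence as soon as some odd
linear `h` on its kernel satisfies `dh + hd + sf = 1` up to a nilpotent error. The section is
corrected to a morphism `σ` by means of the inverse of `dh + hd + sf`. -/
theorem exists_homotopyInverse {P X : LF Q w} (f : P ⟶ X) (s : X.carrier →ₗ[Q] P.carrier)
    (h : P.carrier →ₗ[Q] P.carrier) (s_par : ∀ x, s (X.par x) = P.par (s x))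
    (h_par : ∀ x, h (P.par x) = -P.par (h x)) (fs : ∀ x, lin f (s x) = x)
    (fh : ∀ x, lin f (h x) = 0)
    (hN : IsNilpotent (P.d ∘ₗ h + h ∘ₗ P.d + s ∘ₗ lin f - 1 : Module.End Q P.carrier)) :
    ∃ σ : X ⟶ P, σ ≫ f = 𝟙 X ∧ homotopic Q w (f ≫ σ) (𝟙 P) := by
  obtain ⟨U, hU⟩ : IsUnit (P.d ∘ₗ h + h ∘ₗ P.d + s ∘ₗ lin f : Module.End Q P.carrier) := by
    have := hN.isUnit_one_add
    rwa [add_sub_cancel] at this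
  -- `U = dh + hd + sf` and its inverse `v` are compatible with `f`, though not with `d`
  let v : Module.End Q P.carrier := ↑U⁻¹
  have hu : ∀ p, U.val p = P.d (h p) + h (P.d p) + s (lin f p) := fun p => LinearMap.congr_fun hU p
  have uv : ∀ p, U.val (v p) = p := fun p => LinearMap.congr_fun U.mul_inv p
  have vu : ∀ p, v (U.val p) = p := fun p => LinearMap.congr_fun U.inv_mul p
  have fu : ∀ p, lin f (U.val p) = lin f p := fun p => by
    rw [hu, map_add, map_add, lin_d, fh, fh, map_zero, fs, zero_add, zero_add]
  have fv : ∀ p, lin f (v p) = lin f p := fun p => by rw [← fu, uv]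
  -- `ε` measures the failure of `s` to commute with the differentials; it lands in the kernel of `f`
  let ε : X.carrier →ₗ[Q] P.carrier := P.d ∘ₗ s - s ∘ₗ X.d
  have hε : ∀ x, ε x = P.d (s x) - s (X.d x) := fun x => rfl
  have fε : ∀ x, lin f (ε x) = 0 := fun x => by rw [hε, map_sub, lin_d, fs, fs, sub_self]
  have εd : ∀ x, ε (X.d x) = -P.d (ε x) := fun x => by
    rw [hε, hε, X.d_d, map_sub, P.d_d, map_smul, neg_sub]
  have du : ∀ p, P.d (U.val p) = U.val (P.d p) + ε (lin f p) := fun p => by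
    rw [hu, hu, hε, map_add, map_add, P.d_d, P.d_d, map_smul, lin_d]; abel
  have vd : ∀ p, v (P.d p) = P.d (v p) + v (ε (lin f p)) := fun p => by
    conv_lhs => rw [← uv p, du, map_add, vu, fv]
  have d_par : ∀ {Y : LF Q w} (y : Y.carrier), Y.d (Y.par y) = -Y.par (Y.d y) := fun y => by
    rw [LF.par_d, neg_neg]
  have u_par : ∀ p, U.val (P.par p) = P.par (U.val p) := fun p => by
    rw [hu, hu, h_par, map_neg, d_par, d_par, map_neg, h_par, lin_par, s_par, map_add, map_add,
      neg_neg, neg_neg]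
  have v_par : ∀ p, v (P.par p) = P.par (v p) := fun p => by
    conv_lhs => rw [← uv p, ← u_par, vu]
  have ε_par : ∀ x, ε (X.par x) = -P.par (ε x) := fun x => by
    rw [hε, hε, s_par, map_sub, d_par, d_par, map_neg, s_par]; abel
  refine ⟨mkHom (s - h ∘ₗ v ∘ₗ ε) (fun x => ?_) (fun x => ?_), ?_, h ∘ₗ v, fun x => ?_, fun x => ?_⟩
  · change s (X.par x) - h (v (ε (X.par x))) = P.par (s x - h (v (ε x)))
    rw [s_par, ε_par, map_neg, map_neg, v_par, h_par, map_sub, neg_neg]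
  · change s (X.d x) - h (v (ε (X.d x))) = P.d (s x - h (v (ε x)))
    have key : ε x = P.d (h (v (ε x))) + h (P.d (v (ε x))) := by
      conv_lhs => rw [← uv (ε x), hu, fv, fε, map_zero, add_zero]
    have key' : P.d (s x) = P.d (h (v (ε x))) + h (P.d (v (ε x))) + s (X.d x) := by
      rw [← key, hε, sub_add_cancel]
    have v0 : v 0 = 0 := map_zero v
    rw [εd, map_neg, map_neg, sub_neg_eq_add, vd, fε, map_zero, v0, add_zero, map_sub, key']
    abel
  · refine hom_ext fun x => ?_
    change lin f (s x - h (v (ε x))) = x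
    rw [map_sub, fh, fs, sub_zero]
  · change h (v (P.par x)) = -P.par (h (v x))
    rw [v_par, h_par]
  · change x - (s (lin f x) - h (v (ε (lin f x)))) = P.d (h (v x)) + h (v (P.d x))
    have key := hu (v x)
    rw [uv, fv] at key
    rw [vd, map_add, sub_eq_iff_eq_add]
    exact key.trans (by abel)

end HomotopyInverse

section Basis

variable {Q : Type u} [CommRing Q] {w : Q}

/-- A basis of a factorisation consisting of even and of odd elements. -/
def IsHomogeneous {X : LF Q w} {ι : Type*} (b : Module.Basis ι Q X.carrier) : Prop :=
  ∀ i, X.par (b i) = b i ∨ X.par (b i) = -b i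

theorem mem_even {X : LF Q w} {x : X.carrier} : x ∈ X.even ↔ X.par x = x := by
  simp [even, sub_eq_zero]

theorem mem_odd {X : LF Q w} {x : X.carrier} : x ∈ X.odd ↔ X.par x = -x := by
  simp [odd, eq_neg_iff_add_eq_zero]

theorem IsMF.exists_basis [Algebra ℚ Q] {X : LF Q w} (hX : X.IsMF) :
    ∃ (ι : Type u) (b : Module.Basis ι Q X.carrier), IsHomogeneous b := by
  obtain ⟨h₀, h₁⟩ := hX
  obtain ⟨⟨ι₀, b₀⟩⟩ := Module.Free.exists_basis (R := Q) (M := X.even)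
  obtain ⟨⟨ι₁, b₁⟩⟩ := Module.Free.exists_basis (R := Q) (M := X.odd)
  refine ⟨ι₀ ⊕ ι₁, (b₀.prod b₁).map
    (Submodule.prodEquivOfIsCompl _ _ X.isCompl_even_odd), ?_⟩
  rintro (i | i)
  · left
    simpa using mem_even.1 (b₀ i).2
  · right
    simpa using mem_odd.1 (b₁ i).2

/-- The fixed points of an involution which is diagonal in a basis are free. -/
theorem exists_basis_ker_sub_id [Algebra ℚ Q] {M : Type u} [AddCommGroup M] [Module Q M]
    {ι : Type u} (b : Module.Basis ι Q M) (T : M →ₗ[Q] M)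
    (hT : ∀ i, T (b i) = b i ∨ T (b i) = -b i) :
    Nonempty (Module.Basis {i // T (b i) = b i} Q (LinearMap.ker (T - LinearMap.id))) := by
  have hspan : LinearMap.ker (T - LinearMap.id) =
      Submodule.span Q (Set.range fun i : {i // T (b i) = b i} => b i) := by
    apply le_antisymm
    · intro x hx
      have hx' : T x = x := by simpa [sub_eq_zero] using hx
      have h2 : x = algebraMap ℚ Q (1 / 2) • (x + T x) := by
        rw [hx', ← two_smul Q x, smul_smul, ← map_ofNat (algebraMap ℚ Q), ← map_mul]
        norm_num
      rw [h2]
      refine Submodule.smul_mem _ _ ?_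
      clear hx hx' h2
      refine Submodule.span_induction (fun y hy => ?_) ?_ (fun y z _ _ hy hz => ?_)
        (fun r y _ hy => ?_) (b.mem_span x)
      · obtain ⟨i, rfl⟩ := hy
        rcases hT i with h | h
        · have hi : b i ∈ Submodule.span Q (Set.range fun i : {i // T (b i) = b i} => b i) :=
            Submodule.subset_span ⟨⟨i, h⟩, rfl⟩
          rw [h]
          exact add_mem hi hi
        · rw [h, add_neg_cancel]
          exact zero_mem _
      · rw [map_zero, add_zero]
        exact zero_mem _
      · rw [map_add, add_add_add_comm]
        exact add_mem hy hz
      · rw [map_smul, ← smul_add]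
        exact Submodule.smul_mem _ _ hy
    · rw [Submodule.span_le]
      rintro _ ⟨⟨i, h⟩, rfl⟩
      simp [h]
  rw [hspan]
  exact ⟨Module.Basis.span (b.linearIndependent.comp _ Subtype.val_injective)⟩

theorem odd_eq_ker (X : LF Q w) : X.odd = LinearMap.ker (-X.par - LinearMap.id) := by
  ext x
  simp [odd, sub_eq_add_neg, ← neg_add_rev, add_comm]

theorem isMF_of_basis [Algebra ℚ Q] {X : LF Q w} {ι : Type u} (b : Module.Basis ι Q X.carrier)
    (hb : IsHomogeneous b) : X.IsMF := by
  obtain ⟨b₀⟩ := exists_basis_ker_sub_id b X.par hb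
  obtain ⟨b₁⟩ := exists_basis_ker_sub_id b (-X.par) fun i => by
    simpa [neg_eq_iff_eq_neg, or_comm] using hb i
  refine ⟨Module.Free.of_basis b₀, ?_⟩
  rw [odd_eq_ker]
  exact Module.Free.of_basis b₁

theorem isFiniteRankMF_of_basis [Algebra ℚ Q] {X : LF Q w} {ι : Type u} [Finite ι]
    (b : Module.Basis ι Q X.carrier) (hb : IsHomogeneous b) : X.IsFiniteRankMF := by
  obtain ⟨b₀⟩ := exists_basis_ker_sub_id b X.par hb
  obtain ⟨b₁⟩ := exists_basis_ker_sub_id b (-X.par) fun i => by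
    simpa [neg_eq_iff_eq_neg, or_comm] using hb i
  refine ⟨isMF_of_basis b hb, Module.Finite.of_basis b₀, ?_⟩
  rw [odd_eq_ker]
  exact Module.Finite.of_basis b₁

end Basis

/-! ### Maps of tensor products defined through a basis -/

section CoeffTensor

variable {k : Type u} [CommRing k]
variable {T S C : Type u} [CommRing T] [CommRing S] [CommRing C]
variable [Algebra k T] [Algebra k S] [Algebra k C] {U : T} {V : S} {W : C}
variable {D : LF (T ⊗[k] S) (potDiff k U V)} {X : LF (S ⊗[k] C) (potDiff k V W)}
variable {ι : Type u} (b : Module.Basis ι (S ⊗[k] C) X.carrier)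

theorem basis_addHom_ext {M : Type*} [AddCommMonoid M] {f g : X.carrier →+ M}
    (h : ∀ (s : S) (c : C) i, f ((s ⊗ₜ[k] c) • b i) = g ((s ⊗ₜ[k] c) • b i)) : f = g := by
  refine AddMonoidHom.ext fun x => ?_
  refine Submodule.span_induction (p := fun x _ => ∀ r : S ⊗[k] C, f (r • x) = g (r • x))
    (fun y hy r => ?_) (fun r => by simp) (fun y z _ _ hy hz r => ?_) (fun r y _ hy r' => ?_)
    (b.mem_span x) 1 |> fun h => by simpa using h
  · obtain ⟨i, rfl⟩ := hy
    induction r using TensorProduct.induction_on with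
    | zero => simp
    | add p q hp hq => rw [add_smul, map_add, map_add, hp, hq]
    | tmul s c => exact h s c i
  · rw [smul_add, map_add, map_add, hy, hz]
  · rw [smul_smul]
    exact hy _

theorem ten_addHom_ext {M : Type u} [AddCommGroup M] (b : Module.Basis ι (S ⊗[k] C) X.carrier)
    {f g : Ten D X →+ M} (h : ∀ (y : D.carrier) (c : C) i, f (pt y (((1 : S) ⊗ₜ[k] c) • b i)) =
      g (pt y (((1 : S) ⊗ₜ[k] c) • b i))) : f = g := by
  refine Ten.addHom_ext fun y x => ?_
  have := basis_addHom_ext b (f := f.comp (AddMonoidHom.mk' (pt (D := D) y) (pt_add_right y)))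
    (g := g.comp (AddMonoidHom.mk' (pt (D := D) y) (pt_add_right y))) fun s c i => by
      have hs : (s ⊗ₜ[k] c) • b i = (s ⊗ₜ[k] (1 : C)) • ((1 : S) ⊗ₜ[k] c) • b i := by
        rw [smul_smul, Algebra.TensorProduct.tmul_mul_tmul, mul_one, one_mul]
      change f (pt y _) = g (pt y _)
      rw [hs, ← pt_balanced, h]
  exact DFunLike.congr_fun this x

theorem map_smul_algebraMap (φ : D.carrier →+ D.carrier)
    (hφ : ∀ (t : T) y, φ ((t ⊗ₜ[k] (1 : S)) • y) = (t ⊗ₜ[k] (1 : S)) • φ y) (a : k) (y : D.carrier) :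
    φ (((1 : T) ⊗ₜ[k] (algebraMap k S a)) • y) = ((1 : T) ⊗ₜ[k] (algebraMap k S a)) • φ y := by
  rw [← algebraMap_tmul_one, hφ]

variable (φ : D.carrier →+ D.carrier)
    (hφ : ∀ (t : T) y, φ ((t ⊗ₜ[k] (1 : S)) • y) = (t ⊗ₜ[k] (1 : S)) • φ y)

/-- `s ⊗ c ↦ φ (s y) ⊗ c bᵢ`. -/
def coeffTerm (y : D.carrier) (i : ι) : S ⊗[k] C →+ Ten D X :=
  TensorProduct.liftAddHom
    (AddMonoidHom.mk' (fun s => AddMonoidHom.mk'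
      (fun c => pt (φ (((1 : T) ⊗ₜ[k] s) • y)) (((1 : S) ⊗ₜ[k] c) • b i))
      fun c c' => by rw [TensorProduct.tmul_add, add_smul, pt_add_right])
      fun s s' => AddMonoidHom.ext fun c => by
        change pt _ _ = pt _ _ + pt _ _
        rw [TensorProduct.tmul_add, add_smul, map_add, pt_add_left])
    fun a s c => by
      change pt _ _ = pt _ _
      have h1 : (1 : T) ⊗ₜ[k] (a • s) = ((1 : T) ⊗ₜ[k] algebraMap k S a) * ((1 : T) ⊗ₜ[k] s) := by
        rw [Algebra.TensorProduct.tmul_mul_tmul, one_mul, Algebra.smul_def]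
      have h2 : (1 : S) ⊗ₜ[k] (a • c) = (algebraMap k S a ⊗ₜ[k] (1 : C)) * ((1 : S) ⊗ₜ[k] c) := by
        rw [Algebra.TensorProduct.tmul_mul_tmul, one_mul, mul_one, TensorProduct.tmul_smul,
          TensorProduct.smul_tmul', Algebra.algebraMap_eq_smul_one]
      rw [h1, h2, mul_smul, mul_smul, map_smul_algebraMap φ hφ, pt_balanced]

theorem coeffTerm_tmul (y : D.carrier) (i : ι) (s : S) (c : C) :
    coeffTerm b φ hφ y i (s ⊗ₜ c) = pt (φ (((1 : T) ⊗ₜ[k] s) • y)) (((1 : S) ⊗ₜ[k] c) • b i) :=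
  rfl

theorem coeffTerm_add (y y' : D.carrier) (i : ι) :
    coeffTerm b φ hφ (y + y') i = coeffTerm b φ hφ y i + coeffTerm b φ hφ y' i := by
  refine AddMonoidHom.ext fun q => ?_
  induction q using TensorProduct.induction_on with
  | zero => rw [map_zero, map_zero]
  | add p q hp hq => rw [map_add, map_add, hp, hq]
  | tmul s c =>
    rw [AddMonoidHom.add_apply, coeffTerm_tmul, coeffTerm_tmul, coeffTerm_tmul, smul_add, map_add,
      pt_add_left]

theorem liftAddHom_coeffTerm (y : D.carrier) (s : S) (c : C) (i : ι) :
    Finsupp.liftAddHom (coeffTerm b φ hφ y) (b.repr ((s ⊗ₜ[k] c) • b i)) =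
      pt (φ (((1 : T) ⊗ₜ[k] s) • y)) (((1 : S) ⊗ₜ[k] c) • b i) := by
  rw [map_smul, Module.Basis.repr_self, Finsupp.smul_single, smul_eq_mul,
    mul_one, Finsupp.liftAddHom_apply_single]
  rfl

/-- For `φ : D → D` linear over the left-hand ring and a basis `b` of `X`, the additive map
`φ ⊗ 1` of `D ⊗ X` which fixes the elements `(1 ⊗ c) bᵢ` of `X`. -/
def coeffMap : Ten D X →+ Ten D X :=
  Ten.lift
    (fun y x => Finsupp.liftAddHom (coeffTerm b φ hφ y) (b.repr x))
    (fun y y' x => by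
      have h : coeffTerm b φ hφ (y + y') = coeffTerm b φ hφ y + coeffTerm b φ hφ y' :=
        funext fun i => coeffTerm_add b φ hφ y y' i
      rw [h, map_add, AddMonoidHom.add_apply])
    (fun y x x' => by rw [map_add, map_add])
    (fun s y x => by
      have h := basis_addHom_ext b
        (f := (Finsupp.liftAddHom (coeffTerm b φ hφ (((1 : T) ⊗ₜ[k] s) • y))).comp
          (b.repr : X.carrier →+ _))
        (g := ((Finsupp.liftAddHom (coeffTerm b φ hφ y)).comp (b.repr : X.carrier →+ _)).comp
          (DistribSMul.toAddMonoidHom X.carrier (s ⊗ₜ[k] (1 : C)))) fun s' c i => by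
        change Finsupp.liftAddHom _ (b.repr ((s' ⊗ₜ[k] c) • b i)) =
          Finsupp.liftAddHom _ (b.repr ((s ⊗ₜ[k] (1 : C)) • (s' ⊗ₜ[k] c) • b i))
        rw [smul_smul, Algebra.TensorProduct.tmul_mul_tmul, one_mul, liftAddHom_coeffTerm,
          liftAddHom_coeffTerm, smul_smul, Algebra.TensorProduct.tmul_mul_tmul, one_mul,
          mul_comm s']
      exact DFunLike.congr_fun h x)

theorem coeffMap_pt (y : D.carrier) (s : S) (c : C) (i : ι) :
    coeffMap b φ hφ (pt y ((s ⊗ₜ[k] c) • b i)) =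
      pt (φ (((1 : T) ⊗ₜ[k] s) • y)) (((1 : S) ⊗ₜ[k] c) • b i) :=
  liftAddHom_coeffTerm b φ hφ y s c i

theorem coeffMap_pt_one (y : D.carrier) (c : C) (i : ι) :
    coeffMap b φ hφ (pt y (((1 : S) ⊗ₜ[k] c) • b i)) = pt (φ y) (((1 : S) ⊗ₜ[k] c) • b i) := by
  rw [coeffMap_pt, one_tmul_one_smul]

theorem coeffMap_act (r : T ⊗[k] C) (e : Ten D X) :
    coeffMap b φ hφ (tenAct D X r e) = tenAct D X r (coeffMap b φ hφ e) := by
  induction r using TensorProduct.induction_on with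
  | zero => simp
  | add p q hp hq => simp only [map_add, LinearMap.add_apply, hp, hq]
  | tmul t c =>
    have h := ten_addHom_ext (D := D) b
      (f := (coeffMap b φ hφ).comp (tenAct D X (t ⊗ₜ c)).toAddMonoidHom)
      (g := (tenAct D X (t ⊗ₜ c)).toAddMonoidHom.comp (coeffMap b φ hφ)) fun y c' i => by
      change coeffMap b φ hφ (tenAct D X (t ⊗ₜ c) (pt y _)) =
        tenAct D X (t ⊗ₜ c) (coeffMap b φ hφ (pt y _))
      rw [tenAct_pt, coeffMap_pt_one, tenAct_pt, smul_smul, Algebra.TensorProduct.tmul_mul_tmul,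
        one_mul, coeffMap_pt_one, hφ]
    exact DFunLike.congr_fun h e

/-- `coeffMap` as a linear map over the outer rings. -/
def coeffLin : (tensor D X).carrier →ₗ[T ⊗[k] C] (tensor D X).carrier where
  toFun := coeffMap b φ hφ
  map_add' := (coeffMap b φ hφ).map_add
  map_smul' r e := coeffMap_act b φ hφ r e

end CoeffTensor
end LF

/-! ### The left unit action is a homotopy equivalence -/

namespace LF

open KoszulContraction

theorem zero_act {Q : Type u} [CommRing Q] {w : Q} (X : LF Q w) (x : X.carrier) :
    (0 : Q) • x = 0 := zero_smul Q x

theorem _root_.KoszulContraction.mem_filtration_zero {A : Type u} [CommRing A] {n : ℕ}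
    (a : Ext A n) : a ∈ filtration A n 0 := Submodule.mem_top

section UnitFiltration

variable {k : Type u} [CommRing k] {n : ℕ} (W : Pol k n)

/-- The filtration of `I` by the degree in the `θᵢ`. -/
def unitFil (p : ℕ) : Submodule (PolE k n) (unitDefect k W).carrier := filtration (PolE k n) n p

/-- The projection `π : I → R`. -/
def proj : (unitDefect k W).carrier →+ Pol k n := unitProj k

/-- The inclusion `R → I` of the left constants. -/
def sec : Pol k n →+ (unitDefect k W).carrier := unitSec k

variable {W}

theorem mem_unitFil_zero (a : (unitDefect k W).carrier) : a ∈ unitFil W 0 := mem_filtration_zero a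

theorem eq_zero_of_mem_unitFil {a : (unitDefect k W).carrier} (ha : a ∈ unitFil W (n + 1)) :
    a = 0 := filtration_eq_zero (Nat.lt_succ_self n) ha

theorem par_mem_unitFil {p : ℕ} {a : (unitDefect k W).carrier} (ha : a ∈ unitFil W p) :
    (unitDefect k W).par a ∈ unitFil W p := involute_mem_filtration ha

theorem proj_smul (r : PolE k n) (a : (unitDefect k W).carrier) :
    proj W (r • a) = Algebra.TensorProduct.lmul' k r * proj W a := unitProj_smul k r a

theorem proj_sec (r : Pol k n) : proj W (sec W r) = r := unitProj_unitSec k r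

theorem proj_d (a : (unitDefect k W).carrier) : proj W ((unitDefect k W).d a) = 0 :=
  unitProj_d k W a

theorem sec_mul (s r : Pol k n) : sec W (s * r) = (s ⊗ₜ[k] (1 : Pol k n)) • sec W r :=
  unitSec_mul k s r

theorem par_sec (r : Pol k n) : (unitDefect k W).par (sec W r) = sec W r := involute_unitSec k r

variable (W) in
/-- The contraction of the Koszul complex, as a contraction of `I` up to higher filtration: the
summand `∑ᵢ ∂_[i]W θᵢ` of the differential raises the degree. -/
theorem exists_contraction_unitDefect :
    ∃ h : (unitDefect k W).carrier →+ (unitDefect k W).carrier,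
    (∀ (r : Pol k n) x, h ((r ⊗ₜ[k] (1 : Pol k n)) • x) = (r ⊗ₜ[k] (1 : Pol k n)) • h x) ∧
    (∀ x, h ((unitDefect k W).par x) = -(unitDefect k W).par (h x)) ∧
    (∀ x, proj W (h x) = 0) ∧
    (∀ p, ∀ x ∈ unitFil W p, h x ∈ unitFil W (p + 1)) ∧
    (∀ p, ∀ x ∈ unitFil W p, (unitDefect k W).d (h x) + h ((unitDefect k W).d x) +
      sec W (proj W x) - x ∈ unitFil W (p + 1)) := by
  obtain ⟨h, h_smul, h_d, h_par, h_fil⟩ := exists_unit_contraction k (n := n)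
  refine ⟨h, h_smul, h_par, fun x => unitProj_of_mem_filtration k (h_fil 0 x (mem_unitFil_zero (W := W) x)),
    h_fil, fun p (x : Koszul k n) hx => ?_⟩
  change unitD k W (h x) + h (unitD k W x) + unitSec k (unitProj k x) - x ∈ _
  rw [unitD_apply, unitD_apply, map_add]
  have key : CliffordAlgebra.contractLeft (diffForm k) (h x) +
      ExteriorAlgebra.ι (PolE k n) (diffQuot k W) * h x +
      (h (CliffordAlgebra.contractLeft (diffForm k) x) +
        h (ExteriorAlgebra.ι (PolE k n) (diffQuot k W) * x)) + unitSec k (unitProj k x) - x =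
      ExteriorAlgebra.ι (PolE k n) (diffQuot k W) * h x +
        h (ExteriorAlgebra.ι (PolE k n) (diffQuot k W) * x) := by
    rw [add_add_add_comm, h_d x]; abel
  rw [key]
  exact add_mem (filtration_antitone (ι_mul_mem (h_fil p x hx) _))
    (filtration_antitone (h_fil (p + 1) _ (ι_mul_mem hx _)))

end UnitFiltration

section UnitorEquivalence

variable {k : Type u} [CommRing k] {n : ℕ}
variable {C : Type u} [CommRing C] [Algebra k C] {W : Pol k n} {V : C}

/-- The degree filtration of `I ⊗ X` induced by that of `I`. -/
def tenFil (X : LF (Pol k n ⊗[k] C) (potDiff k W V)) (p : ℕ) :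
    AddSubgroup (Ten (unitDefect k W) X) :=
  AddSubgroup.closure {e | ∃ a ∈ unitFil W p, ∃ x : X.carrier, e = pt a x}

variable {X : LF (Pol k n ⊗[k] C) (potDiff k W V)}

theorem pt_mem_tenFil {p : ℕ} {a : (unitDefect k W).carrier} (ha : a ∈ unitFil W p)
    (x : X.carrier) : pt a x ∈ tenFil X p :=
  AddSubgroup.subset_closure ⟨a, ha, x, rfl⟩

theorem mem_tenFil_zero (e : Ten (unitDefect k W) X) : e ∈ tenFil X 0 :=
  Ten.induction e (zero_mem _) (fun a x => pt_mem_tenFil (mem_unitFil_zero a) x) fun _ _ => add_mem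

theorem eq_zero_of_mem_tenFil {e : Ten (unitDefect k W) X}
    (he : e ∈ tenFil X (n + 1)) : e = 0 := by
  refine AddSubgroup.closure_induction ?_ rfl (fun a b _ _ ha hb => by rw [ha, hb, add_zero])
    (fun a _ ha => by rw [ha, neg_zero]) he
  rintro _ ⟨a, ha, x, rfl⟩
  rw [eq_zero_of_mem_unitFil ha]
  exact pt_zero_left x

/-- Whether an additive map raises the filtration can be tested on the elements
`a ⊗ (1 ⊗ c) bᵢ`. -/
theorem tenFil_map_mem {ι : Type u} (b : Module.Basis ι (Pol k n ⊗[k] C) X.carrier) {p q : ℕ}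
    (f : Ten (unitDefect k W) X →+ Ten (unitDefect k W) X)
    (hf : ∀ a ∈ unitFil W p, ∀ (c : C) (i : ι),
      f (pt a (((1 : Pol k n) ⊗ₜ[k] c) • b i)) ∈ tenFil X q)
    {e : Ten (unitDefect k W) X} (he : e ∈ tenFil X p) : f e ∈ tenFil X q := by
  refine AddSubgroup.closure_induction ?_ (by rw [map_zero]; exact zero_mem _)
    (fun a b _ _ ha hb => by rw [map_add]; exact add_mem ha hb)
    (fun a _ ha => by rw [map_neg]; exact neg_mem ha) he
  rintro _ ⟨a, ha, x, rfl⟩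
  refine Submodule.span_induction (p := fun x _ => ∀ r : Pol k n ⊗[k] C,
    f (pt a (r • x)) ∈ tenFil X q)
    (fun y hy r => ?_) (fun r => ?_) (fun y z _ _ hy hz r => ?_) (fun r y _ hy r' => ?_)
    (b.mem_span x) 1 |> fun h => by simpa using h
  · obtain ⟨i, rfl⟩ := hy
    induction r using TensorProduct.induction_on with
    | zero =>
      have h0 : (0 : Pol k n ⊗[k] C) • b i = 0 := zero_act X _
      rw [h0, pt_zero_right, map_zero]
      exact zero_mem _
    | add p q hp hq => rw [add_smul, pt_add_right, map_add]; exact add_mem hp hq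
    | tmul s c =>
      have hs : (s ⊗ₜ[k] c) • b i = (s ⊗ₜ[k] (1 : C)) • ((1 : Pol k n) ⊗ₜ[k] c) • b i := by
        rw [smul_smul, Algebra.TensorProduct.tmul_mul_tmul, mul_one, one_mul]
      rw [hs, ← pt_balanced]
      exact hf _ (Submodule.smul_mem _ _ ha) c i
  · rw [smul_zero, pt_zero_right, map_zero]; exact zero_mem _
  · rw [smul_add, pt_add_right, map_add]; exact add_mem (hy r) (hz r)
  · rw [smul_smul]; exact hy _

theorem leftUnitor_pt (a : (unitDefect k W).carrier) (x : X.carrier) :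
    lin (leftUnitor X) (pt a x) = (proj W a ⊗ₜ[k] (1 : C)) • x := rfl

/-- The left unit action `I ⊗ X ⟶ X` is a homotopy equivalence, with a strict section, if `X` is a
matrix factorisation. -/
theorem exists_leftUnitor_inverse [Algebra ℚ k] (hX : X.IsMF) :
    ∃ σ : X ⟶ tensor (unitDefect k W) X, σ ≫ leftUnitor X = 𝟙 X ∧
      homotopic _ _ (leftUnitor X ≫ σ) (𝟙 _) := by
  let _ : Algebra ℚ (Pol k n ⊗[k] C) :=
    ((algebraMap k (Pol k n ⊗[k] C)).comp (algebraMap ℚ k)).toAlgebra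
  obtain ⟨ι, b, hb⟩ := hX.exists_basis
  obtain ⟨h, h_smul, h_par, h_proj, h_fil, h_err⟩ := exists_contraction_unitDefect W
  let ψ : (unitDefect k W).carrier →+ (unitDefect k W).carrier := (sec W).comp (proj W)
  have hψ : ∀ (t : Pol k n) (y : (unitDefect k W).carrier),
      ψ ((t ⊗ₜ[k] (1 : Pol k n)) • y) = (t ⊗ₜ[k] (1 : Pol k n)) • ψ y := fun t y => by
    change sec W (proj W _) = _
    rw [proj_smul, Algebra.TensorProduct.lmul'_apply_tmul, mul_one, sec_mul]
    rfl
  -- the section `x ↦ 1 ⊗ x`, made linear by means of the basis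
  let s₀ : X.carrier →+ Ten (unitDefect k W) X := (coeffMap b ψ hψ).comp
    (AddMonoidHom.mk' (pt (sec W 1)) (pt_add_right _))
  have s₀_apply : ∀ (r : Pol k n) (c : C) i, s₀ ((r ⊗ₜ[k] c) • b i) =
      pt (sec W r) (((1 : Pol k n) ⊗ₜ[k] c) • b i) := fun r c i => by
    refine (coeffMap_pt b ψ hψ _ r c i).trans ?_
    have h : ψ (((1 : Pol k n) ⊗ₜ[k] r) • sec W 1) = sec W r := by
      change sec W (proj W _) = _
      rw [proj_smul, proj_sec, Algebra.TensorProduct.lmul'_apply_tmul, one_mul, mul_one]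
    rw [h]
  let s : X.carrier →ₗ[Pol k n ⊗[k] C] (tensor (unitDefect k W) X).carrier :=
    { toFun := s₀
      map_add' := s₀.map_add
      map_smul' := fun q x => by
        change s₀ (q • x) = tenAct _ X q (s₀ x)
        induction q using TensorProduct.induction_on with
        | zero =>
          have h0 : (0 : Pol k n ⊗[k] C) • x = 0 := zero_act X _
          rw [h0, map_zero, map_zero]
          rfl
        | add p q hp hq => simp only [map_add, add_smul, LinearMap.add_apply, hp, hq]
        | tmul r c =>
          have e := basis_addHom_ext b
            (f := s₀.comp (DistribSMul.toAddMonoidHom X.carrier (r ⊗ₜ[k] c)))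
            (g := (tenAct (unitDefect k W) X (r ⊗ₜ c)).toAddMonoidHom.comp s₀) fun r' c' i => by
            change s₀ ((r ⊗ₜ[k] c) • (r' ⊗ₜ[k] c') • b i) =
              tenAct _ X (r ⊗ₜ c) (s₀ ((r' ⊗ₜ[k] c') • b i))
            rw [smul_smul, Algebra.TensorProduct.tmul_mul_tmul, s₀_apply, s₀_apply, tenAct_pt,
              smul_smul, Algebra.TensorProduct.tmul_mul_tmul, one_mul, sec_mul]
          exact DFunLike.congr_fun e x }
  have s_apply : ∀ (r : Pol k n) (c : C) i, s ((r ⊗ₜ[k] c) • b i) =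
      pt (sec W r) (((1 : Pol k n) ⊗ₜ[k] c) • b i) := s₀_apply
  have par_b : ∀ (r : Pol k n ⊗[k] C) i, X.par (r • b i) = r • b i ∨ X.par (r • b i) = -(r • b i) :=
    fun r i => (hb i).imp (fun h => by rw [map_smul, h]) fun h => by rw [map_smul, h, smul_neg]
  let H := coeffLin b h h_smul
  have H_apply : ∀ (a : (unitDefect k W).carrier) (c : C) i,
      H (pt a (((1 : Pol k n) ⊗ₜ[k] c) • b i)) = pt (h a) (((1 : Pol k n) ⊗ₜ[k] c) • b i) :=
    coeffMap_pt_one b h h_smul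
  have H_fil : ∀ p, ∀ e ∈ tenFil X p, (coeffMap b h h_smul e) ∈ tenFil X (p + 1) := fun p e he => by
    refine tenFil_map_mem b _ (fun a ha c i => ?_) he
    rw [coeffMap_pt_one]
    exact pt_mem_tenFil (h_fil p a ha) _
  refine exists_homotopyInverse (leftUnitor X) s H (fun x => ?_) (fun e => ?_) (fun x => ?_)
    (fun e => ?_) ⟨n + 1, ?_⟩
  · have e := basis_addHom_ext b (f := s₀.comp X.par.toAddMonoidHom)
      (g := (tenMap (unitDefect k W) X (unitDefect k W).par X.par).toAddMonoidHom.comp s₀)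
      fun r c i => by
        change s₀ (X.par _) = tenMap _ X _ _ (s₀ _)
        rw [s₀_apply, tenMap_pt, par_sec]
        rcases hb i with h | h
        · rw [X.par.map_smul, X.par.map_smul, h, s₀_apply]
        · rw [X.par.map_smul, h, smul_neg, map_neg, s₀_apply, X.par.map_smul, h, smul_neg, pt_neg_right]
    exact DFunLike.congr_fun e x
  · have e' := ten_addHom_ext (D := unitDefect k W) b (f := (coeffMap b h h_smul).comp
        (tenMap (unitDefect k W) X (unitDefect k W).par X.par).toAddMonoidHom)
      (g := -(tenMap (unitDefect k W) X (unitDefect k W).par X.par).toAddMonoidHom.comp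
        (coeffMap b h h_smul)) fun y c i => by
        change coeffMap b h h_smul (tenMap _ X _ _ (pt y _)) =
          -tenMap _ X _ _ (coeffMap b h h_smul (pt y _))
        rw [tenMap_pt, coeffMap_pt_one, tenMap_pt]
        rcases par_b ((1 : Pol k n) ⊗ₜ[k] c) i with h | h
        · rw [h, coeffMap_pt_one, h_par, pt_neg_left]
        · rw [h, pt_neg_right, map_neg, coeffMap_pt_one, h_par, pt_neg_left, pt_neg_right]
    exact DFunLike.congr_fun e' e
  · have e := basis_addHom_ext b
      (f := (lin (leftUnitor X)).toAddMonoidHom.comp s.toAddMonoidHom)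
      (g := AddMonoidHom.id _) fun r c i => by
        change lin (leftUnitor X) (s _) = _
        rw [s_apply, leftUnitor_pt, proj_sec, smul_smul, Algebra.TensorProduct.tmul_mul_tmul,
          mul_one, one_mul]
        rfl
    exact DFunLike.congr_fun e x
  · have e' := ten_addHom_ext (D := unitDefect k W) b
      (f := (lin (leftUnitor X)).toAddMonoidHom.comp (coeffMap b h h_smul)) (g := 0)
      fun y c i => by
        change lin (leftUnitor X) (coeffMap b h h_smul _) = _
        rw [coeffMap_pt_one, leftUnitor_pt, h_proj, TensorProduct.zero_tmul]
        exact zero_act X _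
    exact DFunLike.congr_fun e' e
  · set N : Module.End (Pol k n ⊗[k] C) (tensor (unitDefect k W) X).carrier :=
      (tensor (unitDefect k W) X).d ∘ₗ H + H ∘ₗ (tensor (unitDefect k W) X).d +
        s ∘ₗ lin (leftUnitor X) - 1 with hN
    have N_fil : ∀ p, ∀ e : Ten (unitDefect k W) X, e ∈ tenFil X p →
        (show Ten (unitDefect k W) X from N e) ∈ tenFil X (p + 1) := fun p e he => by
      let N' : Ten (unitDefect k W) X →+ Ten (unitDefect k W) X := N.toAddMonoidHom
      refine tenFil_map_mem b N' (fun a ha c i => ?_) he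
      set x := ((1 : Pol k n) ⊗ₜ[k] c) • b i with hx
      have hs : s₀ (lin (leftUnitor X) (pt a x)) = pt (sec W (proj W a)) x := by
        rw [leftUnitor_pt, hx, smul_smul, Algebra.TensorProduct.tmul_mul_tmul, one_mul, mul_one,
          s₀_apply]
      let δ : Ten (unitDefect k W) X →+ Ten (unitDefect k W) X :=
        (tensor (unitDefect k W) X).d.toAddMonoidHom
      have hδ : ∀ (a' : (unitDefect k W).carrier) (x' : X.carrier), δ (pt a' x') =
          pt ((unitDefect k W).d a') x' + pt ((unitDefect k W).par a') (X.d x') := fun _ _ => rfl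
      have h1 : N' (pt a x) =
          pt ((unitDefect k W).d (h a) + h ((unitDefect k W).d a) + sec W (proj W a) - a) x +
          pt ((unitDefect k W).par (h a)) (X.d x) +
          coeffMap b h h_smul (pt ((unitDefect k W).par a) (X.d x)) := by
        have e1 : N' (pt a x) = δ (coeffMap b h h_smul (pt a x)) +
          coeffMap b h h_smul (δ (pt a x)) + s₀ (lin (leftUnitor X) (pt a x)) - pt a x := rfl
        have e2 : ∀ a', coeffMap b h h_smul (pt a' x) = pt (h a') x := fun a' =>
          coeffMap_pt_one b h h_smul a' c i
        rw [e1, hs, e2, hδ, hδ, map_add, e2, pt_sub_left, pt_add_left, pt_add_left]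
        abel
      rw [h1]
      refine add_mem (add_mem (pt_mem_tenFil (h_err p a ha) x)
        (pt_mem_tenFil (par_mem_unitFil (h_fil p a ha)) _))
        (H_fil p _ (pt_mem_tenFil (par_mem_unitFil ha) _))
    have N_pow : ∀ p, ∀ e : Ten (unitDefect k W) X,
        (show Ten (unitDefect k W) X from (N ^ p) e) ∈ tenFil X p := fun p => by
      induction p with
      | zero => exact mem_tenFil_zero
      | succ p ih =>
        intro e
        have : (N ^ (p + 1)) e = N ((N ^ p) e) := by rw [pow_succ']; rfl
        exact this ▸ N_fil p _ (ih e)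
    exact LinearMap.ext fun e => eq_zero_of_mem_tenFil (N_pow (n + 1) e)

end UnitorEquivalence

end LF

/-! ### Finite rank, and endomorphisms of the unit defect -/

namespace LF

section RankTransfer

variable {Q Z : Type u} [CommRing Q] [CommRing Z] {w : Q} {z : Z}

/-- The even part is unaffected by restriction of scalars. -/
def resEvenEquiv (f : Z →+* Q) (f' : Q →+* Z) [RingHomInvPair f f'] [RingHomInvPair f' f]
    (hf : f z = w) (X : LF Q w) : (res f hf X).even ≃ₛₗ[f] X.even where
  toFun x := ⟨x.1, x.2⟩
  invFun x := ⟨x.1, x.2⟩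
  map_add' _ _ := rfl
  map_smul' _ _ := rfl
  left_inv _ := rfl
  right_inv _ := rfl

/-- The odd part is unaffected by restriction of scalars. -/
def resOddEquiv (f : Z →+* Q) (f' : Q →+* Z) [RingHomInvPair f f'] [RingHomInvPair f' f]
    (hf : f z = w) (X : LF Q w) : (res f hf X).odd ≃ₛₗ[f] X.odd where
  toFun x := ⟨x.1, x.2⟩
  invFun x := ⟨x.1, x.2⟩
  map_add' _ _ := rfl
  map_smul' _ _ := rfl
  left_inv _ := rfl
  right_inv _ := rfl

theorem exists_ringHomInvPair {f : Z →+* Q} (hb : Function.Bijective f) :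
    ∃ f' : Q →+* Z, RingHomInvPair f f' ∧ RingHomInvPair f' f := by
  let e := RingEquiv.ofBijective f hb
  have h : RingHomInvPair f (e.symm : Q →+* Z) :=
    ⟨RingHom.ext e.symm_apply_apply, RingHom.ext e.apply_symm_apply⟩
  exact ⟨_, h, ⟨h.comp_eq₂, h.comp_eq⟩⟩

theorem res_isMF_iff (f : Z →+* Q) (hb : Function.Bijective f) (hf : f z = w) (X : LF Q w) :
    (res f hf X).IsMF ↔ X.IsMF := by
  obtain ⟨f', _, _⟩ := exists_ringHomInvPair hb
  exact and_congr (Module.Free.iff_of_equiv (resEvenEquiv f f' hf X))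
    (Module.Free.iff_of_equiv (resOddEquiv f f' hf X))

theorem res_isFiniteRankMF_iff (f : Z →+* Q) (hb : Function.Bijective f) (hf : f z = w)
    (X : LF Q w) : (res f hf X).IsFiniteRankMF ↔ X.IsFiniteRankMF := by
  refine and_congr (res_isMF_iff f hb hf X) ?_
  obtain ⟨f', _, _⟩ := exists_ringHomInvPair hb
  refine and_congr ⟨fun _ => ?_, fun _ => ?_⟩ ⟨fun _ => ?_, fun _ => ?_⟩
  · exact Module.Finite.of_surjective (resEvenEquiv f f' hf X).toLinearMap
      (resEvenEquiv f f' hf X).surjective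
  · exact Module.Finite.of_surjective (resEvenEquiv f f' hf X).symm.toLinearMap
      (resEvenEquiv f f' hf X).symm.surjective
  · exact Module.Finite.of_surjective (resOddEquiv f f' hf X).toLinearMap
      (resOddEquiv f f' hf X).surjective
  · exact Module.Finite.of_surjective (resOddEquiv f f' hf X).symm.toLinearMap
      (resOddEquiv f f' hf X).symm.surjective

variable {ι : Type u} [Fintype ι] (F : ι → LF Q w)

/-- The even part of a direct sum. -/
def evenPiEquiv : (∀ i, (F i).even) ≃ₗ[Q] (directSum F).even where
  toFun x := ⟨fun i => (x i).1, mem_even.2 (funext fun i => mem_even.1 (x i).2)⟩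
  invFun x i := ⟨x.1 i, mem_even.2 (congrFun (mem_even.1 x.2) i)⟩
  map_add' _ _ := rfl
  map_smul' _ _ := rfl
  left_inv _ := rfl
  right_inv _ := rfl

/-- The odd part of a direct sum. -/
def oddPiEquiv : (∀ i, (F i).odd) ≃ₗ[Q] (directSum F).odd where
  toFun x := ⟨fun i => (x i).1, mem_odd.2 (funext fun i => mem_odd.1 (x i).2)⟩
  invFun x i := ⟨x.1 i, mem_odd.2 (congrFun (mem_odd.1 x.2) i)⟩
  map_add' _ _ := rfl
  map_smul' _ _ := rfl
  left_inv _ := rfl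
  right_inv _ := rfl

theorem directSum_isFiniteRankMF (hF : ∀ i, (F i).IsFiniteRankMF) :
    (directSum F).IsFiniteRankMF := by
  have h₁ := fun i => (hF i).1.1
  have h₂ := fun i => (hF i).1.2
  have h₃ := fun i => (hF i).2.1
  have h₄ := fun i => (hF i).2.2
  exact ⟨⟨Module.Free.of_equiv (evenPiEquiv F), Module.Free.of_equiv (oddPiEquiv F)⟩,
    Module.Finite.equiv (evenPiEquiv F), Module.Finite.equiv (oddPiEquiv F)⟩

end RankTransfer

end LF

theorem KoszulContraction.involute_monomial {A : Type*} [CommRing A] {n : ℕ}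
    (s : Finset (Fin n)) : CliffordAlgebra.involute (monomial A n s) = monomial A n s ∨
      CliffordAlgebra.involute (monomial A n s) = -monomial A n s := by
  have h : ∃ l : List (Fin n → A), monomial A n s = (l.map (CliffordAlgebra.ι 0)).prod := by
    have h' : ∃ (m : ℕ) (v : Fin m → Fin n → A), monomial A n s = ExteriorAlgebra.ιMulti A m v :=
      ⟨_, _, ExteriorAlgebra.basis_apply _ s⟩
    obtain ⟨m, v, hv⟩ := h'
    refine ⟨List.ofFn v, ?_⟩
    rw [hv, ExteriorAlgebra.ιMulti_apply, List.map_ofFn]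
    rfl
  obtain ⟨l, hl⟩ := h
  rw [hl]
  have h2 := CliffordAlgebra.involute_prod_map_ι (Q := (0 : QuadraticForm A (Fin n → A))) l
  rcases neg_one_pow_eq_or A l.length with h3 | h3
  · rw [h3, one_smul] at h2
    exact Or.inl h2
  · rw [h3, neg_one_smul] at h2
    exact Or.inr h2

namespace LF

section UnitDefect

variable {k : Type u} [CommRing k] {n : ℕ} {W : Pol k n}

variable (W) in
theorem exists_basis_unitDefect : ∃ (ι : Type u) (_ : Finite ι)
    (b : Module.Basis ι (PolE k n) (unitDefect k W).carrier), IsHomogeneous b := by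
  let b : Module.Basis (Finset (Fin n)) (PolE k n) (unitDefect k W).carrier :=
    KoszulContraction.monomial (PolE k n) n
  refine ⟨ULift (Finset (Fin n)), inferInstance, b.reindex Equiv.ulift.symm, fun i => ?_⟩
  rw [Module.Basis.reindex_apply]
  exact KoszulContraction.involute_monomial _

variable (W) in
theorem unitDefect_isFiniteRankMF [Algebra ℚ k] : (unitDefect k W).IsFiniteRankMF := by
  let _ : Algebra ℚ (PolE k n) := ((algebraMap k (PolE k n)).comp (algebraMap ℚ k)).toAlgebra
  obtain ⟨ι, _, b, hb⟩ := exists_basis_unitDefect W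
  exact isFiniteRankMF_of_basis b hb

/-- An endomorphism of `I` with vanishing projection to `R` is null-homotopic: one strips off the
layers of the degree filtration successively, using the Koszul contraction. -/
theorem homotopic_zero_of_proj_eq_zero (ψ : unitDefect k W ⟶ unitDefect k W)
    (hψ : ∀ a, proj W (lin ψ a) = 0) : homotopic _ _ 0 ψ := by
  obtain ⟨ι, _, b, hb⟩ := exists_basis_unitDefect W
  obtain ⟨h, -, h_par, h_proj, h_fil, h_err⟩ := exists_contraction_unitDefect W
  suffices H : ∀ j p : ℕ, p + j = n + 1 → ∀ ψ : unitDefect k W ⟶ unitDefect k W,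
      (∀ a, proj W (lin ψ a) = 0) → (∀ a, lin ψ a ∈ unitFil W p) → homotopic _ _ 0 ψ from
    H (n + 1) 0 (zero_add _) ψ hψ fun a => mem_unitFil_zero _
  intro j
  induction j with
  | zero =>
    intro p hp ψ _ hfil
    obtain rfl : p = n + 1 := hp
    have : ψ = 0 := hom_ext fun a => eq_zero_of_mem_unitFil (hfil a)
    rw [this]
    exact ⟨0, by simp, by simp⟩
  | succ j ih =>
    intro p hp ψ hψ hfil
    -- `ψ - (dH + Hd)` lies one layer deeper, for `H` the linear map agreeing with `h ψ` on the basis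
    let I := unitDefect k W
    let H : I.carrier →ₗ[PolE k n] I.carrier := b.constr ℕ fun i => h (lin ψ (b i))
    have H_b : ∀ i, H (b i) = h (lin ψ (b i)) := fun i => b.constr_basis ℕ _ i
    have H_par : ∀ x, H (I.par x) = -I.par (H x) := by
      have e : H ∘ₗ I.par = -(I.par ∘ₗ H) := b.ext fun i => by
        change H (I.par (b i)) = -I.par (H (b i))
        have h1 : h (lin ψ (I.par (b i))) = -I.par (H (b i)) := by
          rw [lin_par, h_par, H_b]
        rcases hb i with hi | hi
        · rw [← h1, hi, H_b]
        · rw [← h1, hi, map_neg, map_neg, map_neg, H_b]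
      exact fun x => LinearMap.congr_fun e x
    have H_fil : ∀ x, H x ∈ unitFil W (p + 1) := fun x => by
      have : x ∈ (unitFil W (p + 1)).comap H := by
        have := b.mem_span x
        refine Submodule.span_le.2 ?_ this
        rintro _ ⟨i, rfl⟩
        change H (b i) ∈ unitFil W (p + 1)
        rw [H_b]
        exact h_fil p _ (hfil _)
      exact this
    have H_proj : ∀ x, proj W (H x) = 0 := fun x => by
      have h1 : ∀ m, ∀ y ∈ unitFil W (m + 1), proj W y = 0 := fun m => by
        induction m with
        | zero => exact fun y hy => unitProj_of_mem_filtration k hy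
        | succ m ihm => exact fun y hy => ihm y (KoszulContraction.filtration_antitone hy)
      exact h1 p _ (H_fil x)
    let θ : I ⟶ I := mkHom (I.d ∘ₗ H + H ∘ₗ I.d)
      (fun x => by
        change I.d (H (I.par x)) + H (I.d (I.par x)) = I.par (I.d (H x) + H (I.d x))
        have h2 : ∀ y, I.d (I.par y) = -I.par (I.d y) := fun y => by rw [I.par_d, neg_neg]
        rw [H_par, h2, map_neg, map_neg, h2, H_par, map_add, neg_neg, neg_neg])
      (fun x => by
        change I.d (H (I.d x)) + H (I.d (I.d x)) = I.d (I.d (H x) + H (I.d x))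
        rw [map_add, I.d_d, I.d_d, H.map_smul, add_comm])
    have hθ : ∀ x, lin θ x = I.d (H x) + H (I.d x) := fun _ => rfl
    have sub_apply : ∀ x, lin (ψ - θ) x = lin ψ x - lin θ x := fun _ => rfl
    obtain ⟨h', hp', hd'⟩ := ih (p + 1) (by omega) (ψ - θ)
      (fun a => by
        rw [sub_apply, hθ, map_sub, map_add, hψ, proj_d, H_proj, add_zero, sub_zero])
      (fun a => by
        have : a ∈ (unitFil W (p + 1)).comap (lin (ψ - θ)) := by
          refine Submodule.span_le.2 ?_ (b.mem_span a)
          rintro _ ⟨i, rfl⟩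
          change lin (ψ - θ) (b i) ∈ unitFil W (p + 1)
          have h1 := h_err p _ (hfil (b i))
          rw [hψ, map_zero, add_zero, ← lin_d] at h1
          have h2 : lin (ψ - θ) (b i) = -((unitDefect k W).d (h (lin ψ (b i))) +
              h (lin ψ ((unitDefect k W).d (b i))) - lin ψ (b i)) +
              (h (lin ψ ((unitDefect k W).d (b i))) - H (I.d (b i))) := by
            rw [sub_apply, hθ, H_b]
            abel
          rw [h2]
          exact add_mem (neg_mem h1) (sub_mem (h_fil p _ (hfil _)) (H_fil _))
        exact this)
    refine ⟨h' + H, fun x => ?_, fun x => ?_⟩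
    · rw [LinearMap.add_apply, LinearMap.add_apply, hp', H_par, map_add, neg_add]
    · have h3 := hd' x
      rw [sub_apply, hθ] at h3
      have h4 : lin (0 : I ⟶ I) x = 0 := rfl
      rw [LinearMap.add_apply, LinearMap.add_apply, map_add, h4, sub_zero]
      rw [h4, sub_zero, sub_eq_iff_eq_add] at h3
      rw [h3]
      abel

theorem isIso_cls_leftUnitor [Algebra ℚ k] {C : Type u} [CommRing C] [Algebra k C] {V : C}
    {X : LF (Pol k n ⊗[k] C) (potDiff k W V)} (hX : X.IsMF) :
    IsIso ((HF.cls _ _).map (leftUnitor X)) := by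
  obtain ⟨σ, h1, h2⟩ := exists_leftUnitor_inverse hX
  refine ⟨(HF.cls _ _).map σ, ?_, ?_⟩
  · rw [← Functor.map_comp, ← CategoryTheory.Functor.map_id]
    exact CategoryTheory.Quotient.sound _ h2
  · rw [← Functor.map_comp, h1, CategoryTheory.Functor.map_id]

variable (W) in
/-- The two unit actions `I ⊗ I ⟶ I` are homotopic. -/
theorem cls_rightUnitor_unitDefect [Algebra ℚ k] :
    (HF.cls _ _).map (rightUnitor (unitDefect k W)) =
      (HF.cls _ _).map (leftUnitor (unitDefect k W)) := by
  obtain ⟨σ, h1, h2⟩ := exists_leftUnitor_inverse (unitDefect_isFiniteRankMF W).1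
  have proj_eq : ∀ e, proj W (lin (rightUnitor (unitDefect k W)) e) =
      proj W (lin (leftUnitor (unitDefect k W)) e) := by
    have := Ten.addHom_ext (D := unitDefect k W) (X := unitDefect k W)
      (f := (proj W).comp (lin (rightUnitor (unitDefect k W))).toAddMonoidHom)
      (g := (proj W).comp (lin (leftUnitor (unitDefect k W))).toAddMonoidHom) fun y a => by
      change proj W (((1 : Pol k n) ⊗ₜ[k] proj W a) • y) =
        proj W ((proj W y ⊗ₜ[k] (1 : Pol k n)) • a)
      rw [proj_smul, proj_smul, Algebra.TensorProduct.lmul'_apply_tmul,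
        Algebra.TensorProduct.lmul'_apply_tmul, one_mul, mul_one, mul_comm]
    exact fun e => DFunLike.congr_fun this e
  have h3 : homotopic _ _ 0 (σ ≫ leftUnitor (unitDefect k W) - σ ≫ rightUnitor (unitDefect k W)) :=
    homotopic_zero_of_proj_eq_zero _ fun a => by
      have h : lin (σ ≫ leftUnitor (unitDefect k W) - σ ≫ rightUnitor (unitDefect k W)) a =
        lin (leftUnitor (unitDefect k W)) (lin σ a) -
          lin (rightUnitor (unitDefect k W)) (lin σ a) := rfl
      rw [h, map_sub, proj_eq, sub_self]
  have h4 := CategoryTheory.Quotient.sound (homotopic _ _) h3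
  have h5 : (HF.cls _ _).map (leftUnitor (unitDefect k W) ≫ σ) = 𝟙 _ := by
    rw [← CategoryTheory.Functor.map_id]
    exact CategoryTheory.Quotient.sound _ h2
  have h6 : (HF.cls _ _).map (σ ≫ leftUnitor (unitDefect k W)) =
      (HF.cls _ _).map (σ ≫ rightUnitor (unitDefect k W)) := by
    refine sub_eq_zero.1 ?_
    rw [← Functor.map_sub, ← h4, Functor.map_zero]
  calc _ = (HF.cls _ _).map (leftUnitor (unitDefect k W) ≫ σ) ≫
        (HF.cls _ _).map (rightUnitor (unitDefect k W)) := by rw [h5, Category.id_comp]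
    _ = (HF.cls _ _).map (leftUnitor (unitDefect k W)) ≫
        (HF.cls _ _).map (σ ≫ leftUnitor (unitDefect k W)) := by
      rw [h6, Functor.map_comp, Functor.map_comp, Category.assoc]
    _ = _ := by rw [h1, CategoryTheory.Functor.map_id, Category.comp_id]

theorem invHomL_bijective {k : Type u} [CommRing k] {S C : Type u} [CommRing S] [CommRing C]
    [Algebra k S] [Algebra k C] {V : S} (g : symAut k V) :
    Function.Bijective (invHomL C g) := by
  have h : ∀ (g : symAut k V) r, invHomL C g (invHomL C g⁻¹ r) = r := fun g r => by
    rw [← invHomL_mul, inv_mul_cancel, invHomL_one]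
  refine ⟨Function.LeftInverse.injective (g := invHomL C g⁻¹) fun r => ?_,
    Function.RightInverse.surjective (g := invHomL C g⁻¹) (h g)⟩
  simpa using h g⁻¹ r

theorem twistedUnit_isFiniteRankMF [Algebra ℚ k] (g : symAut k W) :
    (twistedUnit g).IsFiniteRankMF :=
  (res_isFiniteRankMF_iff _ (invHomL_bijective g) (invHomL_pot g) _).2 (unitDefect_isFiniteRankMF W)

theorem orbAlg_isFiniteRankMF [Algebra ℚ k] (G : Subgroup (symAut k W)) [Fintype G] :
    (orbAlg G).IsFiniteRankMF :=
  directSum_isFiniteRankMF _ fun _ => twistedUnit_isFiniteRankMF _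

end UnitDefect

end LF

/-! ### Tensor products in the homotopy category -/

namespace LF

section TensorExt

variable {k : Type u} [CommRing k]
variable {T S C B : Type u} [CommRing T] [CommRing S] [CommRing C] [CommRing B]
variable [Algebra k T] [Algebra k S] [Algebra k C] [Algebra k B]
variable {U : T} {V : S} {W : C} {P : B}

theorem isIso_of_bijective {Q : Type u} [CommRing Q] {w : Q} {X Y : LF Q w} (f : X ⟶ Y)
    (hf : Function.Bijective (lin f)) : IsIso f := by
  let e := LinearEquiv.ofBijective (lin f) hf
  have he : ∀ x, lin f (e.symm x) = x := e.apply_symm_apply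
  have he' : ∀ x, e.symm (lin f x) = x := e.symm_apply_apply
  refine ⟨mkHom e.symm.toLinearMap (fun y => hf.1 ?_) (fun y => hf.1 ?_), hom_ext he', hom_ext he⟩
  · change lin f (e.symm (Y.par y)) = lin f (X.par (e.symm y))
    rw [he, lin_par, he]
  · change lin f (e.symm (Y.d y)) = lin f (X.d (e.symm y))
    rw [he, lin_d, he]

section
variable {D : LF (T ⊗[k] S) (potDiff k U V)} {X : LF (S ⊗[k] C) (potDiff k V W)}

theorem tensor_hom_ext {Y : LF (T ⊗[k] C) (potDiff k U W)} {f g : tensor D X ⟶ Y}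
    (h : ∀ y x, lin f (pt y x) = lin g (pt y x)) : f = g :=
  hom_ext fun e => DFunLike.congr_fun (Ten.addHom_ext (f := (lin f).toAddMonoidHom)
    (g := (lin g).toAddMonoidHom) h) e

theorem tensor_hom_ext_left {E : LF (S ⊗[k] C) (potDiff k V W)}
    {X : LF (C ⊗[k] B) (potDiff k W P)} {Y : LF (T ⊗[k] B) (potDiff k U P)}
    {f g : tensor (tensor D E) X ⟶ Y}
    (h : ∀ y e x, lin f (pt (D := tensor D E) (pt y e) x) =
      lin g (pt (D := tensor D E) (pt y e) x)) : f = g := by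
  refine tensor_hom_ext fun p x => ?_
  have := Ten.addHom_ext (D := D) (X := E)
    (f := (lin f).toAddMonoidHom.comp
      (AddMonoidHom.mk' (fun p : Ten D E => pt (D := tensor D E) p x)
        fun p p' => pt_add_left (D := tensor D E) p p' x))
    (g := (lin g).toAddMonoidHom.comp
      (AddMonoidHom.mk' (fun p : Ten D E => pt (D := tensor D E) p x)
        fun p p' => pt_add_left (D := tensor D E) p p' x))
    fun y e => h y e x
  exact DFunLike.congr_fun this p

end

end TensorExt

end LF

namespace HF

open LF

section Functors

variable {k : Type u} [CommRing k]
variable {T S C B : Type u} [CommRing T] [CommRing S] [CommRing C] [CommRing B]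
variable [Algebra k T] [Algebra k S] [Algebra k C] [Algebra k B]
variable {U : T} {V : S} {W : C} {P : B}

/-- Choose a representative of a homotopy class. -/
theorem exists_rep {Q : Type u} [CommRing Q] {w : Q} {X Y : LF Q w}
    (f : (cls Q w).obj X ⟶ (cls Q w).obj Y) : ∃ f' : X ⟶ Y, (cls Q w).map f' = f :=
  (cls Q w).map_surjective f

theorem map_cls_add {Q : Type u} [CommRing Q] {w : Q} {X Y : LF Q w} (f g : X ⟶ Y) :
    (cls Q w).map (f + g) = (cls Q w).map f + (cls Q w).map g := Functor.map_add _

theorem map_cls_smul {Q : Type u} [CommRing Q] {w : Q} {X Y : LF Q w} (r : Q) (f : X ⟶ Y) :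
    (cls Q w).map (r • f) = r • (cls Q w).map f := rfl

theorem map_cls_comp {Q : Type u} [CommRing Q] {w : Q} {X Y Z : LF Q w} (f : X ⟶ Y) (g : Y ⟶ Z) :
    (cls Q w).map (f ≫ g) = (cls Q w).map f ≫ (cls Q w).map g := rfl

theorem map_cls_id {Q : Type u} [CommRing Q] {w : Q} (X : LF Q w) :
    (cls Q w).map (𝟙 X) = 𝟙 ((cls Q w).obj X) := rfl

/-- `1_D ⊗ g` for a homotopy class `g`. -/
def whiskerL (D : LF (T ⊗[k] S) (potDiff k U V)) {X Y : LF (S ⊗[k] C) (potDiff k V W)}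
    (g : (cls _ _).obj X ⟶ (cls _ _).obj Y) :
    (cls _ _).obj (tensor D X) ⟶ (cls _ _).obj (tensor D Y) := (HF.tensorLeft D).map g

/-- `f ⊗ 1_X` for a homotopy class `f`. -/
def whiskerR {D E : LF (T ⊗[k] S) (potDiff k U V)} (f : (cls _ _).obj D ⟶ (cls _ _).obj E)
    (X : LF (S ⊗[k] C) (potDiff k V W)) :
    (cls _ _).obj (tensor D X) ⟶ (cls _ _).obj (tensor E X) := (HF.tensorRight X).map f

theorem whiskerL_cls (D : LF (T ⊗[k] S) (potDiff k U V)) {X Y : LF (S ⊗[k] C) (potDiff k V W)}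
    (f : X ⟶ Y) : whiskerL D ((cls _ _).map f) = (cls _ _).map (tensorHom (𝟙 D) f) := rfl

theorem whiskerR_cls {D E : LF (T ⊗[k] S) (potDiff k U V)} (f : D ⟶ E)
    (X : LF (S ⊗[k] C) (potDiff k V W)) :
    whiskerR ((cls _ _).map f) X = (cls _ _).map (tensorHom f (𝟙 X)) := rfl

section Linearity

variable {D E F : LF (T ⊗[k] S) (potDiff k U V)} {X Y Z : LF (S ⊗[k] C) (potDiff k V W)}

theorem whiskerL_id : whiskerL D (𝟙 ((cls _ _).obj X)) = 𝟙 _ :=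
  CategoryTheory.Functor.map_id (HF.tensorLeft D) _

theorem whiskerR_id : whiskerR (𝟙 ((cls _ _).obj D)) X = 𝟙 _ :=
  CategoryTheory.Functor.map_id (HF.tensorRight X) _

theorem whiskerL_comp (f : (cls _ _).obj X ⟶ (cls _ _).obj Y)
    (g : (cls _ _).obj Y ⟶ (cls _ _).obj Z) :
    whiskerL D (f ≫ g) = whiskerL D f ≫ whiskerL D g :=
  Functor.map_comp (HF.tensorLeft D) _ _

theorem whiskerR_comp (f : (cls _ _).obj D ⟶ (cls _ _).obj E)
    (g : (cls _ _).obj E ⟶ (cls _ _).obj F) :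
    whiskerR (f ≫ g) X = whiskerR f X ≫ whiskerR g X :=
  Functor.map_comp (HF.tensorRight X) _ _

theorem whiskerL_add (f g : (cls _ _).obj X ⟶ (cls _ _).obj Y) :
    whiskerL D (f + g) = whiskerL D f + whiskerL D g := by
  obtain ⟨f, rfl⟩ := exists_rep f
  obtain ⟨g, rfl⟩ := exists_rep g
  rw [← map_cls_add, whiskerL_cls, whiskerL_cls, whiskerL_cls, ← map_cls_add]
  exact congrArg _ (tensor_hom_ext fun y x => pt_add_right _ _ _)

theorem whiskerR_add (f g : (cls _ _).obj D ⟶ (cls _ _).obj E) :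
    whiskerR (f + g) X = whiskerR f X + whiskerR g X := by
  obtain ⟨f, rfl⟩ := exists_rep f
  obtain ⟨g, rfl⟩ := exists_rep g
  rw [← map_cls_add, whiskerR_cls, whiskerR_cls, whiskerR_cls, ← map_cls_add]
  exact congrArg _ (tensor_hom_ext fun y x => pt_add_left _ _ _)

theorem whiskerL_sum {ι : Type*} (s : Finset ι) (f : ι → ((cls _ _).obj X ⟶ (cls _ _).obj Y)) :
    whiskerL D (∑ i ∈ s, f i) = ∑ i ∈ s, whiskerL D (f i) :=
  map_sum (AddMonoidHom.mk' _ (whiskerL_add (D := D) (X := X) (Y := Y))) _ _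

theorem whiskerR_sum {ι : Type*} (s : Finset ι) (f : ι → ((cls _ _).obj D ⟶ (cls _ _).obj E)) :
    whiskerR (∑ i ∈ s, f i) X = ∑ i ∈ s, whiskerR (f i) X :=
  map_sum (AddMonoidHom.mk' (fun f => whiskerR f X) whiskerR_add) _ _

theorem whiskerL_zero : whiskerL D (0 : (cls _ _).obj X ⟶ (cls _ _).obj Y) = 0 :=
  map_zero (AddMonoidHom.mk' _ (whiskerL_add (D := D) (X := X) (Y := Y)))

theorem whiskerR_zero : whiskerR (0 : (cls _ _).obj D ⟶ (cls _ _).obj E) X = 0 :=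
  map_zero (AddMonoidHom.mk' (fun f : (cls _ _).obj D ⟶ (cls _ _).obj E => whiskerR f X)
    whiskerR_add)

theorem whiskerL_smul (c : k) (f : (cls _ _).obj X ⟶ (cls _ _).obj Y) :
    whiskerL D (algebraMap k (S ⊗[k] C) c • f) = algebraMap k (T ⊗[k] C) c • whiskerL D f := by
  obtain ⟨f, rfl⟩ := exists_rep f
  rw [← map_cls_smul, whiskerL_cls, whiskerL_cls, ← map_cls_smul]
  refine congrArg _ (tensor_hom_ext fun y x => ?_)
  change pt y (algebraMap k (S ⊗[k] C) c • lin f x) = tenAct _ _ (algebraMap k (T ⊗[k] C) c)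
    (pt y (lin f x))
  rw [Algebra.TensorProduct.algebraMap_apply, Algebra.TensorProduct.algebraMap_apply, tenAct_pt,
    one_tmul_one_smul, ← pt_balanced, algebraMap_tmul_one]

theorem whiskerR_smul (c : k) (f : (cls _ _).obj D ⟶ (cls _ _).obj E) :
    whiskerR (algebraMap k (T ⊗[k] S) c • f) X = algebraMap k (T ⊗[k] C) c • whiskerR f X := by
  obtain ⟨f, rfl⟩ := exists_rep f
  rw [← map_cls_smul, whiskerR_cls, whiskerR_cls, ← map_cls_smul]
  refine congrArg _ (tensor_hom_ext fun y x => ?_)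
  change pt (algebraMap k (T ⊗[k] S) c • lin f y) x = tenAct _ _ (algebraMap k (T ⊗[k] C) c)
    (pt (lin f y) x)
  rw [Algebra.TensorProduct.algebraMap_apply, Algebra.TensorProduct.algebraMap_apply, tenAct_pt,
    one_tmul_one_smul]

theorem interchange (f : (cls _ _).obj D ⟶ (cls _ _).obj E)
    (g : (cls _ _).obj X ⟶ (cls _ _).obj Y) :
    whiskerR f X ≫ whiskerL E g = whiskerL D g ≫ whiskerR f Y := by
  obtain ⟨f, rfl⟩ := exists_rep f
  obtain ⟨g, rfl⟩ := exists_rep g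
  rw [whiskerL_cls, whiskerL_cls, whiskerR_cls, whiskerR_cls, ← map_cls_comp, ← map_cls_comp]
  exact congrArg _ (tensor_hom_ext fun y x => rfl)

theorem cls_tensorHom (f : D ⟶ E) (g : X ⟶ Y) : (cls _ _).map (tensorHom f g) =
      whiskerR ((cls _ _).map f) X ≫ whiskerL E ((cls _ _).map g) := by
  rw [whiskerL_cls, whiskerR_cls, ← map_cls_comp]
  exact congrArg _ (tensor_hom_ext fun y x => rfl)

end Linearity

section Assoc

variable {D D' : LF (T ⊗[k] S) (potDiff k U V)} {E E' : LF (S ⊗[k] C) (potDiff k V W)}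
  {X X' : LF (C ⊗[k] B) (potDiff k W P)}

theorem assoc_naturality_left (f : (cls _ _).obj D ⟶ (cls _ _).obj D') :
    whiskerR (whiskerR f E) X ≫ (cls _ _).map (assoc D' E X).hom =
      (cls _ _).map (assoc D E X).hom ≫ whiskerR f (tensor E X) := by
  obtain ⟨f, rfl⟩ := exists_rep f
  rw [whiskerR_cls, whiskerR_cls, whiskerR_cls, ← map_cls_comp, ← map_cls_comp]
  exact congrArg _ (tensor_hom_ext_left fun y e x => rfl)

theorem assoc_naturality_middle (f : (cls _ _).obj E ⟶ (cls _ _).obj E') :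
    whiskerR (whiskerL D f) X ≫ (cls _ _).map (assoc D E' X).hom =
      (cls _ _).map (assoc D E X).hom ≫ whiskerL D (whiskerR f X) := by
  obtain ⟨f, rfl⟩ := exists_rep f
  rw [whiskerL_cls, whiskerR_cls, whiskerR_cls, whiskerL_cls, ← map_cls_comp, ← map_cls_comp]
  exact congrArg _ (tensor_hom_ext_left fun y e x => rfl)

theorem assoc_naturality_right (f : (cls _ _).obj X ⟶ (cls _ _).obj X') :
    whiskerL (tensor D E) f ≫ (cls _ _).map (assoc D E X').hom =
      (cls _ _).map (assoc D E X).hom ≫ whiskerL D (whiskerL E f) := by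
  obtain ⟨f, rfl⟩ := exists_rep f
  rw [whiskerL_cls, whiskerL_cls, whiskerL_cls, ← map_cls_comp, ← map_cls_comp]
  exact congrArg _ (tensor_hom_ext_left fun y e x => rfl)

end Assoc

end Functors

section Unitors

variable {k : Type u} [CommRing k] {n : ℕ} {C : Type u} [CommRing C] [Algebra k C]
variable {W : Pol k n} {V : C}

theorem leftUnitor_naturality {X Y : LF (Pol k n ⊗[k] C) (potDiff k W V)}
    (f : (cls _ _).obj X ⟶ (cls _ _).obj Y) :
    whiskerL (unitDefect k W) f ≫ (cls _ _).map (leftUnitor Y) =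
      (cls _ _).map (leftUnitor X) ≫ f := by
  obtain ⟨f, rfl⟩ := exists_rep f
  rw [whiskerL_cls, ← map_cls_comp, ← map_cls_comp]
  refine congrArg _ (tensor_hom_ext fun a x => ?_)
  exact ((lin f).map_smul _ _).symm

theorem rightUnitor_naturality {X Y : LF (C ⊗[k] Pol k n) (potDiff k V W)}
    (f : (cls _ _).obj X ⟶ (cls _ _).obj Y) :
    whiskerR f (unitDefect k W) ≫ (cls _ _).map (rightUnitor Y) =
      (cls _ _).map (rightUnitor X) ≫ f := by
  obtain ⟨f, rfl⟩ := exists_rep f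
  rw [whiskerR_cls, ← map_cls_comp, ← map_cls_comp]
  refine congrArg _ (tensor_hom_ext fun y a => ?_)
  exact ((lin f).map_smul _ _).symm

end Unitors

end HF

/-! ### The action of twisted unit defects -/

namespace LF

section TwistedAction

variable {k : Type u} [CommRing k] {n : ℕ} {C : Type u} [CommRing C] [Algebra k C]
variable {W : Pol k n} {V : C}

theorem twist_smul {T S : Type u} [CommRing T] [CommRing S] [Algebra k T] [Algebra k S] {U : T}
    {V : S} (g : symAut k U) (D : LF (T ⊗[k] S) (potDiff k U V)) (r : T ⊗[k] S) (y : D.carrier) :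
    (show D.carrier from r • (show ((twistL g).obj D).carrier from y)) = invHomL S g r • y := rfl

theorem isIso_twistLTensor {T S : Type u} [CommRing T] [CommRing S] [Algebra k T] [Algebra k S]
    {U : T} {V : S} {W : C} (g : symAut k U) (D : LF (T ⊗[k] S) (potDiff k U V))
    (X : LF (S ⊗[k] C) (potDiff k V W)) : IsIso (twistLTensor g D X) := by
  refine isIso_of_bijective _ ?_
  let inv : Ten D X →+ Ten ((twistL g).obj D) X :=
    Ten.lift (fun y x => pt (D := (twistL g).obj D) y x)
      (fun y y' x => pt_add_left (D := (twistL g).obj D) y y' x)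
      (fun y x x' => pt_add_right (D := (twistL g).obj D) y x x')
      (fun s y x => by
        refine Eq.trans ?_ (pt_balanced (D := (twistL g).obj D) s y x)
        have h : invHomL S g ((1 : T) ⊗ₜ[k] s) = (1 : T) ⊗ₜ[k] s := by
          rw [invHomL_tmul, invHom, map_one]
        have h2 : ((1 : T) ⊗ₜ[k] s) • y = (show D.carrier from
            ((1 : T) ⊗ₜ[k] s) • (show ((twistL g).obj D).carrier from y)) := by
          rw [twist_smul, h]
        rw [h2])
  let f : Ten ((twistL g).obj D) X →+ Ten D X := (lin (twistLTensor g D X)).toAddMonoidHom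
  have h1 : inv.comp f = AddMonoidHom.id _ := Ten.addHom_ext fun y x => rfl
  have h2 : f.comp inv = AddMonoidHom.id _ := Ten.addHom_ext fun y x => rfl
  exact ⟨Function.LeftInverse.injective (g := inv) (DFunLike.congr_fun h1),
    Function.RightInverse.surjective (g := inv) (DFunLike.congr_fun h2)⟩

/-- The action of `ᵍI` on `X`: the twisted unit action `ᵍI ⊗ X ⟶ ᵍX`, `a ⊗ x ↦ π(a) x`. -/
def twistAct (g : symAut k W) (X : LF (Pol k n ⊗[k] C) (potDiff k W V)) :
    tensor (twistedUnit g) X ⟶ (twistL g).obj X :=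
  twistLTensor g (unitDefect k W) X ≫ (twistL g).map (leftUnitor X)

/-- The twist of a homotopy class. -/
def _root_.HF.twistMap {T S : Type u} [CommRing T] [CommRing S] [Algebra k T] [Algebra k S] {U : T}
    {V : S} (g : symAut k U) {D E : LF (T ⊗[k] S) (potDiff k U V)}
    (f : (HF.cls _ _).obj D ⟶ (HF.cls _ _).obj E) :
    (HF.cls _ _).obj ((twistL g).obj D) ⟶ (HF.cls _ _).obj ((twistL g).obj E) :=
  (HF.res (invHomL S g) (invHomL_pot g)).map f

theorem _root_.HF.twistMap_cls {T S : Type u} [CommRing T] [CommRing S] [Algebra k T] [Algebra k S]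
    {U : T} {V : S} (g : symAut k U) {D E : LF (T ⊗[k] S) (potDiff k U V)} (f : D ⟶ E) :
    HF.twistMap g ((HF.cls _ _).map f) = (HF.cls _ _).map ((twistL g).map f) := rfl

theorem _root_.HF.twistMap_comp {T S : Type u} [CommRing T] [CommRing S] [Algebra k T]
    [Algebra k S] {U : T} {V : S} (g : symAut k U) {D E F : LF (T ⊗[k] S) (potDiff k U V)}
    (f : (HF.cls _ _).obj D ⟶ (HF.cls _ _).obj E) (f' : (HF.cls _ _).obj E ⟶ (HF.cls _ _).obj F) :
    HF.twistMap g (f ≫ f') = HF.twistMap g f ≫ HF.twistMap g f' :=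
  Functor.map_comp (HF.res (invHomL S g) (invHomL_pot g)) _ _

theorem _root_.HF.isIso_twistMap {T S : Type u} [CommRing T] [CommRing S] [Algebra k T]
    [Algebra k S] {U : T} {V : S} (g : symAut k U) {D E : LF (T ⊗[k] S) (potDiff k U V)}
    (f : (HF.cls _ _).obj D ⟶ (HF.cls _ _).obj E) [IsIso f] : IsIso (HF.twistMap g f) :=
  Functor.map_isIso (HF.res (invHomL S g) (invHomL_pot g)) f

theorem isIso_cls_twistAct [Algebra ℚ k] (g : symAut k W)
    {X : LF (Pol k n ⊗[k] C) (potDiff k W V)} (hX : X.IsMF) :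
    IsIso ((HF.cls _ _).map (twistAct g X)) := by
  have h1 := isIso_twistLTensor g (unitDefect k W) X
  have h2 := isIso_cls_leftUnitor hX
  have h3 := HF.isIso_twistMap g ((HF.cls _ _).map (leftUnitor X))
  have h4 : IsIso ((HF.cls _ _).map (twistLTensor g (unitDefect k W) X)) := inferInstance
  exact IsIso.comp_isIso' h4 h3

theorem isIso_cls_mulComp [Algebra ℚ k] (g h : symAut k W) :
    IsIso ((HF.cls _ _).map (mulComp g h)) := by
  have h1 := isIso_cls_twistAct g (twistedUnit_isFiniteRankMF h).1
  have h2 : IsIso ((HF.cls _ _).map (twistLMul g h (unitDefect k W)).inv) := inferInstance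
  have h3 : mulComp g h = twistAct g (twistedUnit h) ≫
    (show (twistL g).obj (twistedUnit h) ⟶ twistedUnit (g * h) from
      (twistLMul g h (unitDefect k W)).inv) := (Category.assoc _ _ _).symm
  rw [h3]
  exact IsIso.comp_isIso' h1 h2

theorem twistAct_mul (g h : symAut k W) (X : LF (Pol k n ⊗[k] C) (potDiff k W V)) :
    tensorHom (mulComp g h) (𝟙 X) ≫ twistAct (g * h) X ≫ (twistLMul g h X).hom =
      (assoc (twistedUnit g) (twistedUnit h) X).hom ≫
        tensorHom (𝟙 (twistedUnit g)) (twistAct h X) ≫ twistAct g ((twistL h).obj X) := by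
  refine tensor_hom_ext_left fun (a : (unitDefect k W).carrier) (b : (unitDefect k W).carrier) x => ?_
  have h1 : (proj W ((invHom h (proj W a) ⊗ₜ[k] (1 : Pol k n)) • b) ⊗ₜ[k] (1 : C)) • x =
      (invHom h (proj W a) ⊗ₜ[k] (1 : C)) • (proj W b ⊗ₜ[k] (1 : C)) • x := by
    rw [proj_smul, smul_smul, Algebra.TensorProduct.tmul_mul_tmul,
      Algebra.TensorProduct.lmul'_apply_tmul, mul_one, mul_one]
  exact h1

theorem twistAct_one (X : LF (Pol k n ⊗[k] C) (potDiff k W V)) :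
    tensorHom (twistLOne (unitDefect k W)).inv (𝟙 X) ≫ twistAct 1 X ≫ (twistLOne X).hom =
      leftUnitor X :=
  tensor_hom_ext fun _ _ => rfl

theorem twistAct_naturality (g : symAut k W) {X Y : LF (Pol k n ⊗[k] C) (potDiff k W V)}
    (f : X ⟶ Y) : tensorHom (𝟙 (twistedUnit g)) f ≫ twistAct g Y =
      twistAct g X ≫ (twistL g).map f :=
  tensor_hom_ext fun _ _ => ((lin f).map_smul _ _).symm

theorem rightUnitor_twistedUnit (g : symAut k W) : rightUnitor (twistedUnit g) =
    twistLTensor g (unitDefect k W) (unitDefect k W) ≫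
      (twistL g).map (rightUnitor (unitDefect k W)) := by
  refine tensor_hom_ext fun (y : (unitDefect k W).carrier) a => ?_
  have h : (invHomL (Pol k n) g ((1 : Pol k n) ⊗ₜ[k] proj W a)) • y =
      ((1 : Pol k n) ⊗ₜ[k] proj W a) • y := by
    rw [invHomL_tmul, invHom, map_one]
  exact h

/-- The right unit action on `ᵍI` is homotopic to the action of `ᵍI` on `I`. -/
theorem cls_rightUnitor_twistedUnit [Algebra ℚ k] (g : symAut k W) :
    (HF.cls _ _).map (rightUnitor (twistedUnit g)) =
      (HF.cls _ _).map (twistAct g (unitDefect k W)) := by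
  rw [rightUnitor_twistedUnit]
  have h := congrArg (HF.twistMap g) (cls_rightUnitor_unitDefect W)
  exact congrArg (CategoryStruct.comp
    ((HF.cls _ _).map (twistLTensor g (unitDefect k W) (unitDefect k W)))) h

end TwistedAction

end LF

/-! ### Strongly graded algebras are separable Frobenius -/

open LF HF

section GradedFrobenius

variable {k : Type u} [CommRing k] {n : ℕ} {W : Pol k n}

/-- A group-graded algebra `A` in the homotopy category of defects with invertible components of
the multiplication, in terms of operators on `A`: the projectors `e g` onto the homogeneous parts
`A_g`, the components `m g h : A_g ⊗ A_h → A_{gh}` of the multiplication and their inverses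
`w g h : A_{gh} → A_g ⊗ A_h`, extended by zero, and the unit `η : I → A_1` with its inverse `ε`. -/
structure StronglyGraded (G : Type*) [Group G] (A : LF (PolE k n) (potDiff k W W)) where
  e : G → ((cls _ _).obj A ⟶ (cls _ _).obj A)
  m : G → G → ((cls _ _).obj (tensor A A) ⟶ (cls _ _).obj A)
  w : G → G → ((cls _ _).obj A ⟶ (cls _ _).obj (tensor A A))
  η : (cls _ _).obj (unitDefect k W) ⟶ (cls _ _).obj A
  ε : (cls _ _).obj A ⟶ (cls _ _).obj (unitDefect k W)
  e_e : ∀ g, e g ≫ e g = e g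
  e_ne : ∀ g h, g ≠ h → e g ≫ e h = 0
  e_m_left : ∀ g h, whiskerR (e g) A ≫ m g h = m g h
  e_m_right : ∀ g h, whiskerL A (e h) ≫ m g h = m g h
  m_e : ∀ g h, m g h ≫ e (g * h) = m g h
  e_w : ∀ g h, e (g * h) ≫ w g h = w g h
  w_e_left : ∀ g h, w g h ≫ whiskerR (e g) A = w g h
  w_e_right : ∀ g h, w g h ≫ whiskerL A (e h) = w g h
  w_m : ∀ g h, w g h ≫ m g h = e (g * h)
  m_w : ∀ g h, m g h ≫ w g h = whiskerR (e g) A ≫ whiskerL A (e h)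
  m_assoc : ∀ g h p, whiskerR (m g h) A ≫ m (g * h) p =
    (cls _ _).map (assoc A A A).hom ≫ whiskerL A (m h p) ≫ m g (h * p)
  η_e : η ≫ e 1 = η
  e_ε : e 1 ≫ ε = ε
  ε_η : ε ≫ η = e 1
  η_m : ∀ h, whiskerR η A ≫ m 1 h = (cls _ _).map (leftUnitor A) ≫ e h
  m_η : ∀ g, whiskerL A η ≫ m g 1 = (cls _ _).map (rightUnitor A) ≫ e g

namespace StronglyGraded

variable {G : Type*} [Group G] {A : LF (PolE k n) (potDiff k W W)} (s : StronglyGraded G A)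

theorem w_assoc (g h p : G) :
    s.w (g * h) p ≫ whiskerR (s.w g h) A ≫ (cls _ _).map (assoc A A A).hom =
      s.w g (h * p) ≫ whiskerL A (s.w h p) := by
  -- both sides are inverse to the triple product `A_g ⊗ (A_h ⊗ A_p) → A_{ghp}`
  have h1 : (s.w (g * h) p ≫ whiskerR (s.w g h) A ≫ (cls _ _).map (assoc A A A).hom) ≫
      whiskerL A (s.m h p) ≫ s.m g (h * p) = s.e (g * (h * p)) := by
    rw [Category.assoc, Category.assoc, ← s.m_assoc, ← Category.assoc (whiskerR _ _),
      ← whiskerR_comp, s.w_m, s.e_m_left, s.w_m, mul_assoc]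
  have h2 : (whiskerL A (s.m h p) ≫ s.m g (h * p)) ≫ s.w g (h * p) ≫ whiskerL A (s.w h p) =
      whiskerL A (whiskerL A (s.e p)) ≫ whiskerL A (whiskerR (s.e h) A) ≫
        whiskerR (s.e g) (tensor A A) := by
    rw [Category.assoc, ← Category.assoc (s.m _ _), s.m_w, Category.assoc, ← whiskerL_comp, s.e_w,
      interchange, ← Category.assoc, ← whiskerL_comp, s.m_w, interchange, whiskerL_comp,
      Category.assoc]
  calc _ = (s.w (g * h) p ≫ whiskerR (s.w g h) A ≫ (cls _ _).map (assoc A A A).hom) ≫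
        whiskerL A (whiskerL A (s.e p)) ≫ whiskerL A (whiskerR (s.e h) A) ≫
          whiskerR (s.e g) (tensor A A) := by
        have h3 : (cls _ _).map (assoc A A A).hom ≫ whiskerL A (whiskerL A (s.e p)) ≫
            whiskerL A (whiskerR (s.e h) A) ≫ whiskerR (s.e g) (tensor A A) =
            whiskerL (tensor A A) (s.e p) ≫ whiskerR (whiskerL A (s.e h)) A ≫
              whiskerR (whiskerR (s.e g) A) A ≫ (cls _ _).map (assoc A A A).hom := by
          rw [← Category.assoc, ← assoc_naturality_right, Category.assoc,
            ← Category.assoc ((cls _ _).map _), ← assoc_naturality_middle, Category.assoc,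
            ← assoc_naturality_left]
        have c1 := interchange (s.w g h) (s.e p)
        have c2 : whiskerR (s.w g h) A ≫ whiskerR (whiskerL A (s.e h)) A = whiskerR (s.w g h) A := by
          rw [← whiskerR_comp, s.w_e_right]
        have c3 : whiskerR (s.w g h) A ≫ whiskerR (whiskerR (s.e g) A) A = whiskerR (s.w g h) A := by
          rw [← whiskerR_comp, s.w_e_left]
        rw [Category.assoc, Category.assoc, h3, reassoc_of% c1, reassoc_of% (s.w_e_right (g * h) p),
          reassoc_of% c2, reassoc_of% c3]
    _ = s.e (g * (h * p)) ≫ s.w g (h * p) ≫ whiskerL A (s.w h p) := by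
        rw [← h2, ← Category.assoc, h1]
    _ = _ := by rw [← Category.assoc, s.e_w]

theorem frobenius_left (g h p : G) :
    whiskerR (s.w g h) A ≫ (cls _ _).map (assoc A A A).hom ≫ whiskerL A (s.m h p) =
      s.m (g * h) p ≫ s.w g (h * p) := by
  have h1 : (whiskerR (s.w g h) A ≫ (cls _ _).map (assoc A A A).hom ≫ whiskerL A (s.m h p)) ≫
      s.m g (h * p) = s.m (g * h) p := by
    rw [Category.assoc, Category.assoc, ← s.m_assoc, ← Category.assoc, ← whiskerR_comp, s.w_m,
      s.e_m_left]
  have c1 := (interchange (s.e g) (s.m h p)).symm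
  have c2 := (assoc_naturality_left (E := A) (X := A) (s.e g)).symm
  have c3 : whiskerR (s.w g h) A ≫ whiskerR (whiskerR (s.e g) A) A = whiskerR (s.w g h) A := by
    rw [← whiskerR_comp, s.w_e_left]
  rw [← h1, Category.assoc, Category.assoc, Category.assoc, s.m_w, reassoc_of% c1, reassoc_of% c2,
    reassoc_of% c3, ← whiskerL_comp, s.m_e]

theorem frobenius_right (g h p : G) :
    whiskerL A (s.w h p) ≫ (cls _ _).map (assoc A A A).inv ≫ whiskerR (s.m g h) A =
      s.m g (h * p) ≫ s.w (g * h) p := by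
  have inv_hom : (cls _ _).map (assoc A A A).inv ≫ (cls _ _).map (assoc A A A).hom = 𝟙 _ := by
    rw [← map_cls_comp, Iso.inv_hom_id]; rfl
  have hom_inv : (cls _ _).map (assoc A A A).hom ≫ (cls _ _).map (assoc A A A).inv = 𝟙 _ := by
    rw [← map_cls_comp, Iso.hom_inv_id]; rfl
  have h1 : (whiskerL A (s.w h p) ≫ (cls _ _).map (assoc A A A).inv ≫ whiskerR (s.m g h) A) ≫
      s.m (g * h) p = s.m g (h * p) := by
    rw [Category.assoc, Category.assoc, s.m_assoc, ← Category.assoc ((cls _ _).map _), inv_hom,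
      Category.id_comp, ← Category.assoc, ← whiskerL_comp, s.w_m, s.e_m_right]
  have h2 : (cls _ _).map (assoc A A A).inv ≫ whiskerL (tensor A A) (s.e p) =
      whiskerL A (whiskerL A (s.e p)) ≫ (cls _ _).map (assoc A A A).inv := by
    rw [← Category.comp_id (whiskerL (tensor A A) (s.e p)), ← hom_inv,
      ← Category.assoc (whiskerL (tensor A A) (s.e p)), assoc_naturality_right, Category.assoc,
      ← Category.assoc, inv_hom, Category.id_comp]
  have c0 : whiskerR (s.m g h) A ≫ whiskerR (s.e (g * h)) A = whiskerR (s.m g h) A := by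
    rw [← whiskerR_comp, s.m_e]
  have c1 := interchange (s.m g h) (s.e p)
  have c3 : whiskerL A (s.w h p) ≫ whiskerL A (whiskerL A (s.e p)) = whiskerL A (s.w h p) := by
    rw [← whiskerL_comp, s.w_e_right]
  rw [← h1, Category.assoc, Category.assoc, Category.assoc, s.m_w, reassoc_of% c0, c1,
    reassoc_of% h2, reassoc_of% c3]

variable [Fintype G]

/-- The multiplication, the sum of its components. -/
def mul : (cls _ _).obj (tensor A A) ⟶ (cls _ _).obj A := ∑ g, ∑ h, s.m g h

/-- The sum of the inverses of the components of the multiplication. -/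
def invSum : (cls _ _).obj A ⟶ (cls _ _).obj (tensor A A) := ∑ g, ∑ h, s.w g h

theorem whiskerR_mul {X : LF (PolE k n) (potDiff k W W)} {u : G}
    {f : (cls _ _).obj X ⟶ (cls _ _).obj A} (hf : f ≫ s.e u = f) :
    whiskerR f A ≫ s.mul = ∑ p, whiskerR f A ≫ s.m u p := by
  rw [mul, Preadditive.comp_sum, Finset.sum_eq_single u, Preadditive.comp_sum]
  · intro g _ hg
    rw [Preadditive.comp_sum]
    refine Finset.sum_eq_zero fun h _ => ?_
    rw [← s.e_m_left, ← hf, ← Category.assoc, ← whiskerR_comp, Category.assoc, s.e_ne _ _ hg.symm,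
      Limits.comp_zero, whiskerR_zero, Limits.zero_comp]
  · exact fun h => absurd (Finset.mem_univ u) h

theorem whiskerL_mul {X : LF (PolE k n) (potDiff k W W)} {u : G}
    {f : (cls _ _).obj X ⟶ (cls _ _).obj A} (hf : f ≫ s.e u = f) :
    whiskerL A f ≫ s.mul = ∑ g, whiskerL A f ≫ s.m g u := by
  rw [mul, Preadditive.comp_sum]
  refine Finset.sum_congr rfl fun g _ => ?_
  rw [Preadditive.comp_sum, Finset.sum_eq_single u]
  · intro h _ hh
    rw [← s.e_m_right, ← hf, ← Category.assoc, ← whiskerL_comp, Category.assoc, s.e_ne _ _ hh.symm,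
      Limits.comp_zero, whiskerL_zero, Limits.zero_comp]
  · exact fun h => absurd (Finset.mem_univ u) h

theorem invSum_whiskerR {X : LF (PolE k n) (potDiff k W W)} {u : G}
    {f : (cls _ _).obj A ⟶ (cls _ _).obj X} (hf : s.e u ≫ f = f) :
    s.invSum ≫ whiskerR f A = ∑ p, s.w u p ≫ whiskerR f A := by
  rw [invSum, Preadditive.sum_comp, Finset.sum_eq_single u, Preadditive.sum_comp]
  · intro g _ hg
    rw [Preadditive.sum_comp]
    refine Finset.sum_eq_zero fun h _ => ?_
    rw [← s.w_e_left, ← hf, Category.assoc, ← whiskerR_comp, ← Category.assoc, s.e_ne _ _ hg,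
      Limits.zero_comp, whiskerR_zero, Limits.comp_zero]
  · exact fun h => absurd (Finset.mem_univ u) h

theorem invSum_whiskerL {X : LF (PolE k n) (potDiff k W W)} {u : G}
    {f : (cls _ _).obj A ⟶ (cls _ _).obj X} (hf : s.e u ≫ f = f) :
    s.invSum ≫ whiskerL A f = ∑ g, s.w g u ≫ whiskerL A f := by
  rw [invSum, Preadditive.sum_comp]
  refine Finset.sum_congr rfl fun g _ => ?_
  rw [Preadditive.sum_comp, Finset.sum_eq_single u]
  · intro h _ hh
    rw [← s.w_e_right, ← hf, Category.assoc, ← whiskerL_comp, ← Category.assoc, s.e_ne _ _ hh,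
      Limits.zero_comp, whiskerL_zero, Limits.comp_zero]
  · exact fun h => absurd (Finset.mem_univ u) h

theorem mul_assoc' : whiskerR s.mul A ≫ s.mul =
    (cls _ _).map (assoc A A A).hom ≫ whiskerL A s.mul ≫ s.mul := by
  have h1 : whiskerR s.mul A ≫ s.mul = ∑ g, ∑ h, ∑ p, whiskerR (s.m g h) A ≫ s.m (g * h) p := by
    conv_lhs => rw [mul, whiskerR_sum, Preadditive.sum_comp]
    refine Finset.sum_congr rfl fun g _ => ?_
    rw [whiskerR_sum, Preadditive.sum_comp]
    exact Finset.sum_congr rfl fun h _ => s.whiskerR_mul (s.m_e g h)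
  have h2 : whiskerL A s.mul ≫ s.mul = ∑ h, ∑ p, ∑ g, whiskerL A (s.m h p) ≫ s.m g (h * p) := by
    conv_lhs => rw [mul, whiskerL_sum, Preadditive.sum_comp]
    refine Finset.sum_congr rfl fun g _ => ?_
    rw [whiskerL_sum, Preadditive.sum_comp]
    exact Finset.sum_congr rfl fun h _ => s.whiskerL_mul (s.m_e g h)
  rw [h1, h2]
  simp only [Preadditive.comp_sum, ← s.m_assoc]
  exact ((Finset.sum_congr rfl fun h _ => Finset.sum_comm).trans Finset.sum_comm).symm

theorem invSum_assoc : s.invSum ≫ whiskerR s.invSum A ≫ (cls _ _).map (assoc A A A).hom =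
    s.invSum ≫ whiskerL A s.invSum := by
  have h1 : s.invSum ≫ whiskerR s.invSum A =
      ∑ g, ∑ h, ∑ p, s.w (g * h) p ≫ whiskerR (s.w g h) A := by
    conv_lhs => rhs; rw [invSum, whiskerR_sum]
    rw [Preadditive.comp_sum]
    refine Finset.sum_congr rfl fun g _ => ?_
    rw [whiskerR_sum, Preadditive.comp_sum]
    exact Finset.sum_congr rfl fun h _ => s.invSum_whiskerR (s.e_w g h)
  have h2 : s.invSum ≫ whiskerL A s.invSum =
      ∑ h, ∑ p, ∑ g, s.w g (h * p) ≫ whiskerL A (s.w h p) := by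
    conv_lhs => rhs; rw [invSum, whiskerL_sum]
    rw [Preadditive.comp_sum]
    refine Finset.sum_congr rfl fun g _ => ?_
    rw [whiskerL_sum, Preadditive.comp_sum]
    exact Finset.sum_congr rfl fun h _ => s.invSum_whiskerL (s.e_w g h)
  rw [← Category.assoc, h1, h2]
  simp only [Preadditive.sum_comp, Category.assoc, s.w_assoc]
  exact ((Finset.sum_congr rfl fun h _ => Finset.sum_comm).trans Finset.sum_comm).symm

theorem m_comp_invSum (f p : G) : s.m f p ≫ s.invSum = ∑ g, s.m f p ≫ s.w g (g⁻¹ * (f * p)) := by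
  rw [invSum, Preadditive.comp_sum]
  refine Finset.sum_congr rfl fun g _ => ?_
  rw [Preadditive.comp_sum, Finset.sum_eq_single (g⁻¹ * (f * p))]
  · intro h _ hh
    have hne : f * p ≠ g * h := fun h' => hh (by rw [h', inv_mul_cancel_left])
    rw [← s.m_e, ← s.e_w, Category.assoc, ← Category.assoc (s.e _), s.e_ne _ _ hne,
      Limits.zero_comp, Limits.comp_zero]
  · exact fun h => absurd (Finset.mem_univ _) h

theorem mul_invSum : s.mul ≫ s.invSum = ∑ g, ∑ h, ∑ p, s.m (g * h) p ≫ s.w g (h * p) := by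
  have h1 : s.mul ≫ s.invSum = ∑ f, ∑ p, ∑ g, s.m f p ≫ s.w g (g⁻¹ * (f * p)) := by
    rw [mul, Preadditive.sum_comp]
    refine Finset.sum_congr rfl fun f _ => ?_
    rw [Preadditive.sum_comp]
    exact Finset.sum_congr rfl fun p _ => s.m_comp_invSum f p
  rw [h1, (Finset.sum_congr rfl fun f _ => Finset.sum_comm).trans Finset.sum_comm]
  refine Finset.sum_congr rfl fun g _ => ?_
  refine (Fintype.sum_equiv (Equiv.mulLeft g) _ _ fun h => ?_).symm
  refine Finset.sum_congr rfl fun p _ => ?_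
  rw [Equiv.coe_mulLeft, mul_assoc, inv_mul_cancel_left]

theorem frobenius_left_sum : whiskerR s.invSum A ≫ (cls _ _).map (assoc A A A).hom ≫
    whiskerL A s.mul = s.mul ≫ s.invSum := by
  rw [s.mul_invSum, invSum, whiskerR_sum, Preadditive.sum_comp]
  refine Finset.sum_congr rfl fun g _ => ?_
  rw [whiskerR_sum, Preadditive.sum_comp]
  refine Finset.sum_congr rfl fun h _ => ?_
  rw [mul, whiskerL_sum, Preadditive.comp_sum, Preadditive.comp_sum, Finset.sum_eq_single h,
    whiskerL_sum, Preadditive.comp_sum, Preadditive.comp_sum]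
  · exact Finset.sum_congr rfl fun p _ => s.frobenius_left g h p
  · intro h' _ hh'
    rw [whiskerL_sum, Preadditive.comp_sum, Preadditive.comp_sum]
    refine Finset.sum_eq_zero fun p _ => ?_
    rw [← s.e_m_left, whiskerL_comp, ← Category.assoc ((cls _ _).map _), ← assoc_naturality_middle,
      Category.assoc, ← Category.assoc, ← whiskerR_comp, ← s.w_e_right, Category.assoc,
      ← whiskerL_comp, s.e_ne _ _ hh'.symm, whiskerL_zero, Limits.comp_zero, whiskerR_zero,
      Limits.zero_comp]
  · exact fun h => absurd (Finset.mem_univ _) h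

theorem frobenius_right_sum : whiskerL A s.invSum ≫ (cls _ _).map (assoc A A A).inv ≫
    whiskerR s.mul A = s.mul ≫ s.invSum := by
  have hinv : ∀ f : (cls _ _).obj A ⟶ (cls _ _).obj A,
      (cls _ _).map (assoc A A A).inv ≫ whiskerR (whiskerL A f) A =
        whiskerL A (whiskerR f A) ≫ (cls _ _).map (assoc A A A).inv := fun f => by
    have inv_hom : (cls _ _).map (assoc A A A).inv ≫ (cls _ _).map (assoc A A A).hom = 𝟙 _ := by
      rw [← map_cls_comp, Iso.inv_hom_id]; rfl
    have hom_inv : (cls _ _).map (assoc A A A).hom ≫ (cls _ _).map (assoc A A A).inv = 𝟙 _ := by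
      rw [← map_cls_comp, Iso.hom_inv_id]; rfl
    rw [← Category.comp_id (whiskerR (whiskerL A f) A), ← hom_inv,
      ← Category.assoc (whiskerR (whiskerL A f) A), assoc_naturality_middle, Category.assoc,
      ← Category.assoc, inv_hom, Category.id_comp]
  have h1 : s.mul ≫ s.invSum = ∑ h, ∑ p, ∑ g, s.m g (h * p) ≫ s.w (g * h) p := by
    have e : s.mul ≫ s.invSum = ∑ g, ∑ q, ∑ p, s.m g q ≫ s.w (g * q * p⁻¹) p := by
      rw [mul, Preadditive.sum_comp]
      refine Finset.sum_congr rfl fun g _ => ?_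
      rw [Preadditive.sum_comp]
      refine Finset.sum_congr rfl fun q _ => ?_
      rw [invSum, Finset.sum_comm, Preadditive.comp_sum]
      refine Finset.sum_congr rfl fun p _ => ?_
      rw [Preadditive.comp_sum, Finset.sum_eq_single (g * q * p⁻¹)]
      · intro f _ hf
        have hne : g * q ≠ f * p := fun h' => hf (by rw [h', mul_inv_cancel_right])
        rw [← s.m_e, ← s.e_w, Category.assoc, ← Category.assoc (s.e _), s.e_ne _ _ hne,
          Limits.zero_comp, Limits.comp_zero]
      · exact fun h => absurd (Finset.mem_univ _) h
    rw [e]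
    refine Eq.trans ?_ ((Finset.sum_congr rfl fun h _ => Finset.sum_comm).trans
      Finset.sum_comm).symm
    refine Finset.sum_congr rfl fun g _ => ?_
    refine Finset.sum_comm.trans (Eq.trans ?_ Finset.sum_comm)
    refine Finset.sum_congr rfl fun p _ => ?_
    refine (Fintype.sum_equiv (Equiv.mulRight p) _ _ fun h => ?_).symm
    rw [Equiv.coe_mulRight, ← mul_assoc, mul_inv_cancel_right]
  rw [h1, invSum, whiskerL_sum, Preadditive.sum_comp]
  refine Finset.sum_congr rfl fun h _ => ?_
  rw [whiskerL_sum, Preadditive.sum_comp]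
  refine Finset.sum_congr rfl fun p _ => ?_
  rw [mul, whiskerR_sum, Preadditive.comp_sum, Preadditive.comp_sum]
  refine Finset.sum_congr rfl fun g _ => ?_
  rw [whiskerR_sum, Preadditive.comp_sum, Preadditive.comp_sum, Finset.sum_eq_single h]
  · exact s.frobenius_right g h p
  · intro h' _ hh'
    rw [← s.e_m_right, whiskerR_comp, ← Category.assoc ((cls _ _).map _), hinv, Category.assoc,
      ← Category.assoc, ← whiskerL_comp, ← s.w_e_left, Category.assoc, ← whiskerR_comp,
      s.e_ne _ _ hh'.symm, whiskerR_zero, Limits.comp_zero, whiskerL_zero, Limits.zero_comp]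
  · exact fun h => absurd (Finset.mem_univ _) h

theorem w_mul (g h : G) : s.w g h ≫ s.mul = s.e (g * h) := by
  rw [← s.w_e_left, Category.assoc, s.whiskerR_mul (s.e_e g), Preadditive.comp_sum,
    Finset.sum_eq_single h]
  · rw [← Category.assoc, s.w_e_left, s.w_m]
  · intro p _ hp
    rw [← Category.assoc, s.w_e_left, ← s.w_e_right, ← s.e_m_right, Category.assoc,
      ← Category.assoc (whiskerL _ _), ← whiskerL_comp, s.e_ne _ _ hp.symm, whiskerL_zero,
      Limits.zero_comp, Limits.comp_zero]
  · exact fun h => absurd (Finset.mem_univ _) h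

theorem invSum_mul (sum_e : ∑ g, s.e g = 𝟙 _) : s.invSum ≫ s.mul = Fintype.card G • 𝟙 _ := by
  have h1 : s.invSum ≫ s.mul = ∑ g, ∑ h, s.e (g * h) := by
    rw [invSum, Preadditive.sum_comp]
    refine Finset.sum_congr rfl fun g _ => ?_
    rw [Preadditive.sum_comp]
    exact Finset.sum_congr rfl fun h _ => s.w_mul g h
  rw [h1, ← sum_e, ← Finset.card_univ, ← Finset.sum_const]
  exact Finset.sum_congr rfl fun g _ => Fintype.sum_equiv (Equiv.mulLeft g) _ _ fun h => rfl

theorem η_mul (sum_e : ∑ g, s.e g = 𝟙 _) :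
    whiskerR s.η A ≫ s.mul = (cls _ _).map (leftUnitor A) := by
  rw [s.whiskerR_mul s.η_e]
  simp only [s.η_m]
  rw [← Preadditive.comp_sum, sum_e]
  exact Category.comp_id _

theorem mul_η (sum_e : ∑ g, s.e g = 𝟙 _) :
    whiskerL A s.η ≫ s.mul = (cls _ _).map (rightUnitor A) := by
  rw [s.whiskerL_mul s.η_e]
  simp only [s.m_η]
  rw [← Preadditive.comp_sum, sum_e]
  exact Category.comp_id _

theorem ε_invSum (sum_e : ∑ g, s.e g = 𝟙 _) :
    s.invSum ≫ whiskerR s.ε A ≫ (cls _ _).map (leftUnitor A) = 𝟙 _ := by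
  rw [← Category.assoc, s.invSum_whiskerR s.e_ε, Preadditive.sum_comp, ← sum_e]
  refine Finset.sum_congr rfl fun p _ => ?_
  rw [← s.w_e_right, Category.assoc, Category.assoc, ← Category.assoc (whiskerL _ _),
    ← interchange, Category.assoc, leftUnitor_naturality, ← s.η_m, ← Category.assoc (whiskerR _ _),
    ← whiskerR_comp, s.ε_η, s.e_m_left, s.w_m, one_mul]

theorem invSum_ε (sum_e : ∑ g, s.e g = 𝟙 _) :
    s.invSum ≫ whiskerL A s.ε ≫ (cls _ _).map (rightUnitor A) = 𝟙 _ := by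
  rw [← Category.assoc, s.invSum_whiskerL s.e_ε, Preadditive.sum_comp, ← sum_e]
  refine Finset.sum_congr rfl fun p _ => ?_
  rw [← s.w_e_left, Category.assoc, Category.assoc, ← Category.assoc (whiskerR _ _),
    interchange, Category.assoc, rightUnitor_naturality, ← s.m_η, ← Category.assoc (whiskerL _ _),
    ← whiskerL_comp, s.ε_η, s.e_m_right, s.w_m, mul_one]

/-- A strongly graded algebra is separable Frobenius once `|G|` is invertible. -/
theorem isSeparableFrobenius (sum_e : ∑ g, s.e g = 𝟙 _) (r : k) (hr : r * Fintype.card G = 1) :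
    IsSeparableFrobenius (A := A) ⟨s.mul, s.η⟩
      ⟨algebraMap k (PolE k n) r • s.invSum, Fintype.card G • s.ε⟩ := by
  have hr' : ∀ {X Y : HF (PolE k n) (potDiff k W W)} (f : X ⟶ Y),
      algebraMap k (PolE k n) r • Fintype.card G • f = f := fun f => by
    rw [← Nat.cast_smul_eq_nsmul (PolE k n), smul_smul, ← map_natCast (algebraMap k (PolE k n)),
      ← map_mul, hr, map_one, one_smul]
  have nsmulR : whiskerR (Fintype.card G • s.ε) A = Fintype.card G • whiskerR s.ε A :=
    map_nsmul (AddMonoidHom.mk' (fun f => whiskerR f A) whiskerR_add) _ _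
  have nsmulL : whiskerL A (Fintype.card G • s.ε) = Fintype.card G • whiskerL A s.ε :=
    map_nsmul (AddMonoidHom.mk' (fun f => whiskerL A f) whiskerL_add) _ _
  refine ⟨⟨s.mul_assoc', s.η_mul sum_e, s.mul_η sum_e⟩, ⟨?_, ?_, ?_⟩, ?_, ?_, ?_⟩
  · change (algebraMap k (PolE k n) r • s.invSum) ≫ whiskerR (algebraMap k (PolE k n) r • s.invSum) A ≫
        (cls _ _).map (assoc A A A).hom =
      (algebraMap k (PolE k n) r • s.invSum) ≫ whiskerL A (algebraMap k (PolE k n) r • s.invSum)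
    rw [whiskerR_smul, whiskerL_smul, Linear.smul_comp, Linear.smul_comp, Linear.smul_comp,
      Linear.comp_smul, Linear.comp_smul, s.invSum_assoc]
  · change (algebraMap k (PolE k n) r • s.invSum) ≫ whiskerR (Fintype.card G • s.ε) A ≫
        (cls _ _).map (leftUnitor A) = 𝟙 _
    rw [nsmulR, Linear.smul_comp, Preadditive.nsmul_comp, Preadditive.comp_nsmul, hr',
      s.ε_invSum sum_e]
  · change (algebraMap k (PolE k n) r • s.invSum) ≫ whiskerL A (Fintype.card G • s.ε) ≫
        (cls _ _).map (rightUnitor A) = 𝟙 _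
    rw [nsmulL, Linear.smul_comp, Preadditive.nsmul_comp, Preadditive.comp_nsmul, hr',
      s.invSum_ε sum_e]
  · change whiskerR (algebraMap k (PolE k n) r • s.invSum) A ≫ (cls _ _).map (assoc A A A).hom ≫
        whiskerL A s.mul = s.mul ≫ (algebraMap k (PolE k n) r • s.invSum)
    rw [whiskerR_smul, Linear.smul_comp, Linear.comp_smul, s.frobenius_left_sum]
  · change whiskerL A (algebraMap k (PolE k n) r • s.invSum) ≫ (cls _ _).map (assoc A A A).inv ≫
        whiskerR s.mul A = s.mul ≫ (algebraMap k (PolE k n) r • s.invSum)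
    rw [whiskerL_smul, Linear.smul_comp, Linear.comp_smul, s.frobenius_right_sum]
  · change (algebraMap k (PolE k n) r • s.invSum) ≫ s.mul = 𝟙 _
    rw [Linear.smul_comp, s.invSum_mul sum_e, hr']

end StronglyGraded

end GradedFrobenius

/-! ### The algebra `A_G` -/

theorem comp_comp_inv_comp {C : Type*} [Category C] {A B D M N : C} (t : A ⟶ M) (μ : M ⟶ N)
    [IsIso μ] (i : N ⟶ B) (p : B ⟶ N) (j : M ⟶ D) (h : i ≫ p = 𝟙 N) :
    (t ≫ μ ≫ i) ≫ p ≫ inv μ ≫ j = t ≫ j := by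
  rw [Category.assoc, Category.assoc, reassoc_of% h, IsIso.hom_inv_id_assoc]

theorem comp_inv_comp_comp {C : Type*} [Category C] {A B D M N : C} (p : A ⟶ N) (μ : M ⟶ N)
    [IsIso μ] (j : M ⟶ D) (t : D ⟶ M) (i : N ⟶ B) (h : j ≫ t = 𝟙 M) :
    (p ≫ inv μ ≫ j) ≫ t ≫ μ ≫ i = p ≫ i := by
  rw [Category.assoc, Category.assoc, reassoc_of% h, IsIso.inv_hom_id_assoc]

section DirectSum

variable {Q : Type u} [CommRing Q] {w : Q} {ι : Type u} [Fintype ι] (F : ι → LF Q w)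

open Classical in
theorem LF.sumProj_sumIncl (i : ι) (x : (F i).carrier) :
    lin (sumProj F i) (lin (sumIncl F i) x) = x :=
  Pi.single_eq_same (M := fun i => (F i).carrier) i x

open Classical in
theorem LF.sumProj_sumIncl_ne {i j : ι} (hij : j ≠ i) (x : (F i).carrier) :
    lin (sumProj F j) (lin (sumIncl F i) x) = 0 :=
  Pi.single_eq_of_ne (M := fun i => (F i).carrier) hij x

end DirectSum

section OrbifoldAlgebra

variable {k : Type u} [CommRing k] {n : ℕ} {W : Pol k n} (G : Subgroup (symAut k W)) [Fintype G]

/-- The `g`-component of an element of `A_G`, as an element of `I`. -/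
def orbCoord (g : G) (a : (orbAlg G).carrier) : (unitDefect k W).carrier := lin (orbProj G g) a

/-- The element of `A_G` concentrated in the summand `ᵍI`. -/
def orbSingle (g : G) (c : (unitDefect k W).carrier) : (orbAlg G).carrier := lin (orbIncl G g) c

theorem orbCoord_orbSingle (g : G) (c : (unitDefect k W).carrier) :
    orbCoord G g (orbSingle G g c) = c :=
  LF.sumProj_sumIncl (fun g : G => twistedUnit (g : symAut k W)) g c

theorem orbCoord_orbSingle_ne {g h : G} (hgh : h ≠ g) (c : (unitDefect k W).carrier) :
    orbCoord G h (orbSingle G g c) = 0 :=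
  LF.sumProj_sumIncl_ne (fun g : G => twistedUnit (g : symAut k W)) hgh c

theorem orbIncl_orbProj (g : G) : orbIncl G g ≫ orbProj G g = 𝟙 _ :=
  hom_ext fun c => orbCoord_orbSingle G g c

theorem orbIncl_orbProj_ne {g h : G} (hgh : h ≠ g) : orbIncl G g ≫ orbProj G h = 0 :=
  hom_ext fun c => orbCoord_orbSingle_ne G hgh c

theorem orbIncl_orbProj_assoc (g : G) {Z : LF (PolE k n) (potDiff k W W)}
    (f : twistedUnit (g : symAut k W) ⟶ Z) : orbIncl G g ≫ orbProj G g ≫ f = f := by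
  rw [← Category.assoc, orbIncl_orbProj, Category.id_comp]

theorem sum_orbProj_orbIncl : ∑ g, orbProj G g ≫ orbIncl G g = 𝟙 (orbAlg G) := by
  refine hom_ext fun a => funext fun h => ?_
  have h1 : lin (∑ g, orbProj G g ≫ orbIncl G g) a = ∑ g, lin (orbProj G g ≫ orbIncl G g) a := by
    rw [← LinearMap.sum_apply]
    exact LinearMap.congr_fun (map_sum (linAddHom (orbAlg G) (orbAlg G)) _ _) a
  rw [h1]
  refine (Finset.sum_apply h _ _).trans ?_
  rw [Finset.sum_eq_single h]
  · exact orbCoord_orbSingle G h _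
  · exact fun g _ hg => orbCoord_orbSingle_ne G hg.symm _
  · exact fun h' => absurd (Finset.mem_univ _) h'

theorem LF.tensorHom_comp {T S C : Type u} [CommRing T] [CommRing S] [CommRing C] [Algebra k T]
    [Algebra k S] [Algebra k C] {U : T} {V : S} {W : C}
    {D D' D'' : LF (T ⊗[k] S) (potDiff k U V)} {X X' X'' : LF (S ⊗[k] C) (potDiff k V W)}
    (f : D ⟶ D') (f' : D' ⟶ D'') (g : X ⟶ X') (g' : X' ⟶ X'') :
    tensorHom f g ≫ tensorHom f' g' = tensorHom (f ≫ f') (g ≫ g') :=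
  tensor_hom_ext fun _ _ => rfl

theorem LF.tensorHom_comp_assoc {T S C : Type u} [CommRing T] [CommRing S] [CommRing C] [Algebra k T]
    [Algebra k S] [Algebra k C] {U : T} {V : S} {W : C}
    {D D' D'' : LF (T ⊗[k] S) (potDiff k U V)} {X X' X'' : LF (S ⊗[k] C) (potDiff k V W)}
    {Z : LF (T ⊗[k] C) (potDiff k U W)}
    (f : D ⟶ D') (f' : D' ⟶ D'') (g : X ⟶ X') (g' : X' ⟶ X'') (e : tensor D'' X'' ⟶ Z) :
    tensorHom f g ≫ tensorHom f' g' ≫ e = tensorHom (f ≫ f') (g ≫ g') ≫ e := by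
  rw [← Category.assoc, tensorHom_comp]

theorem LF.tensorHom_id {T S C : Type u} [CommRing T] [CommRing S] [CommRing C] [Algebra k T]
    [Algebra k S] [Algebra k C] {U : T} {V : S} {W : C}
    (D : LF (T ⊗[k] S) (potDiff k U V)) (X : LF (S ⊗[k] C) (potDiff k V W)) :
    tensorHom (𝟙 D) (𝟙 X) = 𝟙 _ :=
  tensor_hom_ext fun _ _ => rfl

/-- The component `A_g ⊗ A_h → A_{gh}` of the multiplication of `A_G`, extended by zero. -/
def orbComp (g h : G) : tensor (orbAlg G) (orbAlg G) ⟶ orbAlg G :=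
  tensorHom (orbProj G g) (orbProj G h) ≫ mulComp (g : symAut k W) (h : symAut k W) ≫
    orbIncl G (g * h)

theorem orbComp_pt (g h : G) (a b : (orbAlg G).carrier) :
    lin (orbComp G g h) (pt a b) = orbSingle G (g * h)
      ((invHom (h : symAut k W) (proj W (orbCoord G g a)) ⊗ₜ[k] (1 : Pol k n)) • orbCoord G h b) :=
  rfl

theorem orbComp_assoc (g h p : G) :
    tensorHom (orbComp G g h) (𝟙 (orbAlg G)) ≫ orbComp G (g * h) p =
      (assoc (orbAlg G) (orbAlg G) (orbAlg G)).hom ≫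
        tensorHom (𝟙 (orbAlg G)) (orbComp G h p) ≫ orbComp G g (h * p) := by
  refine tensor_hom_ext_left fun a b c => ?_
  have e1 : lin (tensorHom (orbComp G g h) (𝟙 (orbAlg G)) ≫ orbComp G (g * h) p)
      (pt (D := tensor (orbAlg G) (orbAlg G)) (pt a b) c) =
      lin (orbComp G (g * h) p) (pt (lin (orbComp G g h) (pt a b)) c) := rfl
  have e2 : lin ((assoc (orbAlg G) (orbAlg G) (orbAlg G)).hom ≫
      tensorHom (𝟙 (orbAlg G)) (orbComp G h p) ≫ orbComp G g (h * p))
      (pt (D := tensor (orbAlg G) (orbAlg G)) (pt a b) c) =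
      lin (orbComp G g (h * p)) (pt a (lin (orbComp G h p) (pt b c))) := rfl
  have e3 : invHom ((h * p : G) : symAut k W) (proj W (orbCoord G g a)) =
      invHom (p : symAut k W) (invHom (h : symAut k W) (proj W (orbCoord G g a))) :=
    invHom_mul _ _ _
  rw [e1, e2, orbComp_pt, orbComp_pt, orbComp_pt, orbComp_pt, orbCoord_orbSingle,
    orbCoord_orbSingle, e3, smul_smul, Algebra.TensorProduct.tmul_mul_tmul, mul_one, proj_smul,
    Algebra.TensorProduct.lmul'_apply_tmul, mul_one, map_mul, mul_assoc g h p]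

theorem orbUnit_orbComp (h : G) :
    tensorHom ((twistLOne (unitDefect k W)).inv ≫ orbIncl G 1) (𝟙 (orbAlg G)) ≫ orbComp G 1 h =
      leftUnitor (orbAlg G) ≫ orbProj G h ≫ orbIncl G h := by
  refine tensor_hom_ext fun a b => ?_
  have e1 : lin (tensorHom ((twistLOne (unitDefect k W)).inv ≫ orbIncl G 1) (𝟙 (orbAlg G)) ≫
      orbComp G 1 h) (pt a b) = lin (orbComp G 1 h) (pt (orbSingle G 1 a) b) := rfl
  have e2 : lin (leftUnitor (orbAlg G) ≫ orbProj G h ≫ orbIncl G h) (pt a b) =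
      orbSingle G h ((invHom (h : symAut k W) (proj W a) ⊗ₜ[k] (1 : Pol k n)) • orbCoord G h b) :=
    rfl
  rw [e1, e2, orbComp_pt, orbCoord_orbSingle, one_mul]

theorem orbComp_orbUnit (g : G) :
    tensorHom (𝟙 (orbAlg G)) ((twistLOne (unitDefect k W)).inv ≫ orbIncl G 1) ≫ orbComp G g 1 =
      tensorHom (orbProj G g) (𝟙 (unitDefect k W)) ≫ twistAct (g : symAut k W) (unitDefect k W) ≫
        orbIncl G g := by
  refine tensor_hom_ext fun a b => ?_
  have e1 : lin (tensorHom (𝟙 (orbAlg G)) ((twistLOne (unitDefect k W)).inv ≫ orbIncl G 1) ≫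
      orbComp G g 1) (pt a b) = lin (orbComp G g 1) (pt a (orbSingle G 1 b)) := rfl
  have e2 : lin (tensorHom (orbProj G g) (𝟙 (unitDefect k W)) ≫
      twistAct (g : symAut k W) (unitDefect k W) ≫ orbIncl G g) (pt a b) =
      orbSingle G g ((proj W (orbCoord G g a) ⊗ₜ[k] (1 : Pol k n)) • b) := rfl
  have e3 : invHom ((1 : G) : symAut k W) (proj W (orbCoord G g a)) = proj W (orbCoord G g a) :=
    invHom_one _
  rw [e1, e2, orbComp_pt, orbCoord_orbSingle, e3, mul_one]

theorem cls_orbProj_twistAct [Algebra ℚ k] (g : G) :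
    (cls _ _).map (tensorHom (orbProj G g) (𝟙 (unitDefect k W)) ≫
      twistAct (g : symAut k W) (unitDefect k W) ≫ orbIncl G g) =
    (cls _ _).map (rightUnitor (orbAlg G)) ≫ (cls _ _).map (orbProj G g ≫ orbIncl G g) := by
  have h1 := rightUnitor_naturality ((cls _ _).map (orbProj G g))
  have h2 := congrArg (fun f : (cls _ _).obj (tensor (twistedUnit (g : symAut k W))
    (unitDefect k W)) ⟶ (cls _ _).obj (twistedUnit (g : symAut k W)) =>
      whiskerR ((cls _ _).map (orbProj G g)) (unitDefect k W) ≫ f ≫ (cls _ _).map (orbIncl G g))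
    (cls_rightUnitor_twistedUnit (g : symAut k W))
  refine Eq.trans ?_ (h2.symm.trans ?_)
  · rfl
  · change _ = (cls _ _).map (rightUnitor (orbAlg G)) ≫ (cls _ _).map (orbProj G g) ≫
      (cls _ _).map (orbIncl G g)
    rw [← Category.assoc, h1, Category.assoc]

/-- The algebra `A_G` is strongly graded. -/
def orbGraded [Algebra ℚ k]
    (hμ : ∀ g h : G, IsIso ((cls _ _).map (mulComp (g : symAut k W) (h : symAut k W)))) :
    StronglyGraded G (orbAlg G) where
  e g := (cls _ _).map (orbProj G g ≫ orbIncl G g)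
  m g h := (cls _ _).map (orbComp G g h)
  w g h := (cls _ _).map (orbProj G (g * h)) ≫ @inv _ _ _ _ _ (hμ g h) ≫
    (cls _ _).map (tensorHom (orbIncl G g) (orbIncl G h))
  η := (cls _ _).map ((twistLOne (unitDefect k W)).inv ≫ orbIncl G 1)
  ε := (cls _ _).map (orbProj G 1 ≫ (twistLOne (unitDefect k W)).hom)
  e_e g := by rw [← map_cls_comp, Category.assoc, orbIncl_orbProj_assoc]
  e_ne g h hgh := by
    rw [← map_cls_comp, Category.assoc, ← Category.assoc (orbIncl G g),
      orbIncl_orbProj_ne G hgh.symm, Limits.zero_comp, Limits.comp_zero, Functor.map_zero]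
  e_m_left g h := by
    rw [whiskerR_cls, ← map_cls_comp, orbComp, tensorHom_comp_assoc, Category.id_comp,
      Category.assoc, orbIncl_orbProj, Category.comp_id]
  e_m_right g h := by
    rw [whiskerL_cls, ← map_cls_comp, orbComp, tensorHom_comp_assoc, Category.id_comp,
      Category.assoc, orbIncl_orbProj, Category.comp_id]
  m_e g h := by
    rw [← map_cls_comp, orbComp, Category.assoc, Category.assoc, orbIncl_orbProj_assoc]
  e_w g h := by
    rw [← Category.assoc, ← map_cls_comp, Category.assoc, orbIncl_orbProj, Category.comp_id]
  w_e_left g h := by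
    rw [whiskerR_cls, Category.assoc, Category.assoc, ← map_cls_comp, tensorHom_comp,
      Category.comp_id, orbIncl_orbProj_assoc]
  w_e_right g h := by
    rw [whiskerL_cls, Category.assoc, Category.assoc, ← map_cls_comp, tensorHom_comp,
      Category.comp_id, orbIncl_orbProj_assoc]
  w_m g h := by
    have := hμ g h
    refine comp_inv_comp_comp ((cls _ _).map (orbProj G (g * h)))
      ((cls _ _).map (mulComp (g : symAut k W) (h : symAut k W)))
      ((cls _ _).map (tensorHom (orbIncl G g) (orbIncl G h)))
      ((cls _ _).map (tensorHom (orbProj G g) (orbProj G h)))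
      ((cls _ _).map (orbIncl G (g * h))) ?_
    rw [← map_cls_comp, tensorHom_comp, orbIncl_orbProj, orbIncl_orbProj, tensorHom_id]
    rfl
  m_w g h := by
    have := hμ g h
    refine (comp_comp_inv_comp ((cls _ _).map (tensorHom (orbProj G g) (orbProj G h)))
      ((cls _ _).map (mulComp (g : symAut k W) (h : symAut k W)))
      ((cls _ _).map (orbIncl G (g * h))) ((cls _ _).map (orbProj G (g * h)))
      ((cls _ _).map (tensorHom (orbIncl G g) (orbIncl G h))) ?_).trans ?_
    · rw [← map_cls_comp, orbIncl_orbProj]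
      rfl
    · rw [← map_cls_comp, tensorHom_comp, ← cls_tensorHom]
  m_assoc g h p := by
    rw [whiskerR_cls, whiskerL_cls, ← map_cls_comp, ← map_cls_comp, ← map_cls_comp, orbComp_assoc]
  η_e := by
    have h : ((twistLOne (unitDefect k W)).inv ≫ orbIncl G 1) ≫ orbProj G 1 ≫ orbIncl G 1 =
        (twistLOne (unitDefect k W)).inv ≫ orbIncl G 1 :=
      hom_ext fun c => congrArg (orbSingle G 1) (orbCoord_orbSingle G 1 c)
    rw [← map_cls_comp, h]
  e_ε := by
    have h : (orbProj G 1 ≫ orbIncl G 1) ≫ orbProj G 1 ≫ (twistLOne (unitDefect k W)).hom =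
        orbProj G 1 ≫ (twistLOne (unitDefect k W)).hom :=
      hom_ext fun a => orbCoord_orbSingle G 1 _
    rw [← map_cls_comp, h]
  ε_η := by
    have h : (orbProj G 1 ≫ (twistLOne (unitDefect k W)).hom) ≫
        (twistLOne (unitDefect k W)).inv ≫ orbIncl G 1 = orbProj G 1 ≫ orbIncl G 1 :=
      hom_ext fun _ => rfl
    rw [← map_cls_comp, h]
  η_m h := by rw [whiskerR_cls, ← map_cls_comp, orbUnit_orbComp, map_cls_comp]
  m_η g := by
    rw [whiskerL_cls, ← map_cls_comp, orbComp_orbUnit]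
    exact cls_orbProj_twistAct G g

theorem orbAlg_isSeparableFrobenius [Algebra ℚ k]
    (hμ : ∀ g h : G, IsIso ((cls _ _).map (mulComp (g : symAut k W) (h : symAut k W)))) :
    IsSeparableFrobenius (orbAlgData G) (orbCoalgData G hμ) := by
  have hr : algebraMap ℚ k (1 / (Fintype.card G : ℚ)) * Fintype.card G = 1 := by
    rw [← map_natCast (algebraMap ℚ k), ← map_mul, one_div_mul_cancel, map_one]
    exact Nat.cast_ne_zero.2 Fintype.card_ne_zero
  have key := (orbGraded G hμ).isSeparableFrobenius
    ((Functor.map_sum (cls _ _) _ _).symm.trans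
      (congrArg (cls _ _).map (sum_orbProj_orbIncl G))) _ hr
  have h1 : orbAlgData G = ⟨(orbGraded G hμ).mul, (orbGraded G hμ).η⟩ := by
    have : (orbAlgData G).mul = (orbGraded G hμ).mul := by
      refine (Functor.map_sum (cls _ _) _ _).trans ?_
      exact Finset.sum_congr rfl fun g _ => Functor.map_sum (cls _ _) _ _
    exact congrArg (AlgData.mk · (orbGraded G hμ).η) this
  have h2 : orbCoalgData G hμ = ⟨algebraMap k (PolE k n) (algebraMap ℚ k (1 / (Fintype.card G : ℚ))) •
      (orbGraded G hμ).invSum, Fintype.card G • (orbGraded G hμ).ε⟩ := by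
    have : (orbCoalgData G hμ).counit = Fintype.card G • (orbGraded G hμ).ε :=
      Functor.map_nsmul (cls _ _)
    exact congrArg (CoalgData.mk _) this
  rw [h1, h2]
  exact key

end OrbifoldAlgebra

/-! ### Modules over `A_G` as families of morphisms -/

section OrbifoldModules

variable {k : Type u} [CommRing k] {n : ℕ} {W : Pol k n} (G : Subgroup (symAut k W))
variable {C : Type u} [CommRing C] [Algebra k C] {V : C}

/-- A family `ψ_g : ᵍX ⟶ X` of homotopy classes satisfies `ψ_e = 1` and
`ψ_{gh} = ψ_g ∘ ᵍ(ψ_h)`, up to the identifications `ᵉX ≅ X` and `ᵍʰX ≅ ᵍ(ʰX)`. -/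
structure IsEquivariantFamily (X : LF (Pol k n ⊗[k] C) (potDiff k W V))
    (ψ : ∀ g : G, (cls _ _).obj ((twistL (g : symAut k W)).obj X) ⟶ (cls _ _).obj X) : Prop where
  one : ψ 1 = (cls _ _).map (twistLOne X).hom
  mul : ∀ g h : G, ψ (g * h) = (cls _ _).map (twistLMul (g : symAut k W) (h : symAut k W) X).hom ≫
    twistMap (g : symAut k W) (ψ h) ≫ ψ g

theorem twistMap_twistLMul (g h : symAut k W) {X Y : LF (Pol k n ⊗[k] C) (potDiff k W V)}
    (f : (cls _ _).obj X ⟶ (cls _ _).obj Y) :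
    twistMap (g * h) f ≫ (cls _ _).map (twistLMul g h Y).hom =
      (cls _ _).map (twistLMul g h X).hom ≫ twistMap g (twistMap h f) := by
  obtain ⟨f, rfl⟩ := exists_rep f
  rw [twistMap_cls, twistMap_cls, twistMap_cls, ← map_cls_comp, ← map_cls_comp]
  exact congrArg _ (hom_ext fun _ => rfl)

theorem twistMap_twistLOne {X Y : LF (Pol k n ⊗[k] C) (potDiff k W V)}
    (f : (cls _ _).obj X ⟶ (cls _ _).obj Y) :
    twistMap (1 : symAut k W) f ≫ (cls _ _).map (twistLOne Y).hom =
      (cls _ _).map (twistLOne X).hom ≫ f := by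
  obtain ⟨f, rfl⟩ := exists_rep f
  rw [twistMap_cls, ← map_cls_comp, ← map_cls_comp]
  exact congrArg _ (hom_ext fun _ => rfl)

theorem IsEquivariantFamily.conj {G : Subgroup (symAut k W)} {X Y : LF (Pol k n ⊗[k] C) (potDiff k W V)}
    {ψ : ∀ g : G, (cls _ _).obj ((twistL (g : symAut k W)).obj Y) ⟶ (cls _ _).obj Y}
    (hψ : IsEquivariantFamily G Y ψ) (e : (cls _ _).obj X ≅ (cls _ _).obj Y) :
    IsEquivariantFamily G X fun g => twistMap (g : symAut k W) e.hom ≫ ψ g ≫ e.inv where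
  one := by
    rw [hψ.one]
    have h := congrArg (fun f => f ≫ e.inv) (twistMap_twistLOne e.hom)
    simp only [Category.assoc, Iso.hom_inv_id, Category.comp_id] at h
    exact h
  mul g h := by
    have h1 := twistMap_twistLMul (g : symAut k W) (h : symAut k W) e.hom
    have h2 : twistMap (g : symAut k W) e.inv ≫ twistMap (g : symAut k W) e.hom = 𝟙 _ := by
      rw [← twistMap_comp, e.inv_hom_id]
      exact CategoryTheory.Functor.map_id (HF.res _ _) _
    have h3 : twistMap ((g : symAut k W) * (h : symAut k W)) e.hom ≫
        ((cls _ _).map (twistLMul (g : symAut k W) (h : symAut k W) Y).hom ≫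
          twistMap (g : symAut k W) (ψ h) ≫ ψ g) ≫ e.inv =
        (cls _ _).map (twistLMul (g : symAut k W) (h : symAut k W) X).hom ≫
          twistMap (g : symAut k W) (twistMap (h : symAut k W) e.hom ≫ ψ h ≫ e.inv) ≫
            twistMap (g : symAut k W) e.hom ≫ ψ g ≫ e.inv := by
      rw [twistMap_comp, twistMap_comp, Category.assoc, Category.assoc, Category.assoc,
        Category.assoc, reassoc_of% h2, reassoc_of% h1]
    refine Eq.trans ?_ h3
    rw [← hψ.mul]
    rfl

variable [Fintype G]

/-- The action `A_G ⊗ X ⟶ X` which on `ᵍI ⊗ X` is `ᵍI ⊗ X ⟶ ᵍX ⟶ X`. -/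
def actOf (X : LF (Pol k n ⊗[k] C) (potDiff k W V))
    (ψ : ∀ g : G, (cls _ _).obj ((twistL (g : symAut k W)).obj X) ⟶ (cls _ _).obj X) :
    (cls _ _).obj (tensor (orbAlg G) X) ⟶ (cls _ _).obj X :=
  ∑ g, whiskerR ((cls _ _).map (orbProj G g)) X ≫
    (cls _ _).map (twistAct (g : symAut k W) X) ≫ ψ g

variable {G} {X Y : LF (Pol k n ⊗[k] C) (potDiff k W V)}

theorem whiskerR_orbIncl_actOf
    (ψ : ∀ g : G, (cls _ _).obj ((twistL (g : symAut k W)).obj X) ⟶ (cls _ _).obj X) (g : G) :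
    whiskerR ((cls _ _).map (orbIncl G g)) X ≫ actOf G X ψ =
      (cls _ _).map (twistAct (g : symAut k W) X) ≫ ψ g := by
  rw [actOf, Preadditive.comp_sum, Finset.sum_eq_single g]
  · rw [← Category.assoc, ← whiskerR_comp, ← map_cls_comp, orbIncl_orbProj, map_cls_id,
      whiskerR_id, Category.id_comp]
  · intro h _ hg
    rw [← Category.assoc, ← whiskerR_comp, ← map_cls_comp, orbIncl_orbProj_ne G hg,
      Functor.map_zero, whiskerR_zero, Limits.zero_comp]
  · exact fun h => absurd (Finset.mem_univ g) h

/-- The inclusions `ᵍI ⊗ X ⟶ A_G ⊗ X` are jointly epic. -/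
theorem whiskerR_orbIncl_ext {Z : HF (Pol k n ⊗[k] C) (potDiff k W V)}
    {f f' : (cls _ _).obj (tensor (orbAlg G) X) ⟶ Z}
    (h : ∀ g, whiskerR ((cls _ _).map (orbIncl G g)) X ≫ f =
      whiskerR ((cls _ _).map (orbIncl G g)) X ≫ f') : f = f' := by
  have h1 : ∑ g, whiskerR ((cls _ _).map (orbProj G g)) X ≫
      whiskerR ((cls _ _).map (orbIncl G g)) X = 𝟙 _ := by
    rw [← whiskerR_id, ← map_cls_id, ← sum_orbProj_orbIncl, Functor.map_sum, whiskerR_sum]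
    exact Finset.sum_congr rfl fun g _ => (whiskerR_comp _ _).symm
  rw [← Category.id_comp f, ← Category.id_comp f', ← h1, Preadditive.sum_comp, Preadditive.sum_comp]
  exact Finset.sum_congr rfl fun g _ => by rw [Category.assoc, Category.assoc, h]

/-- The inclusions `(ᵍI ⊗ ʰI) ⊗ X ⟶ (A_G ⊗ A_G) ⊗ X` are jointly epic. -/
theorem whiskerR_orbIncl_orbIncl_ext {Z : HF (Pol k n ⊗[k] C) (potDiff k W V)}
    {f f' : (cls _ _).obj (tensor (tensor (orbAlg G) (orbAlg G)) X) ⟶ Z}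
    (h : ∀ g h, whiskerR ((cls _ _).map (tensorHom (orbIncl G g) (orbIncl G h))) X ≫ f =
      whiskerR ((cls _ _).map (tensorHom (orbIncl G g) (orbIncl G h))) X ≫ f') : f = f' := by
  have h1 : ∑ g, ∑ h, whiskerR ((cls _ _).map (tensorHom (orbProj G g) (orbProj G h))) X ≫
      whiskerR ((cls _ _).map (tensorHom (orbIncl G g) (orbIncl G h))) X = 𝟙 _ := by
    have h2 : ∑ g, (cls _ _).map (orbProj G g ≫ orbIncl G g) = 𝟙 _ := by
      rw [← map_cls_id, ← sum_orbProj_orbIncl, Functor.map_sum]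
    rw [← whiskerR_id, ← whiskerR_id, ← h2, whiskerR_sum, whiskerR_sum]
    refine Finset.sum_congr rfl fun g _ => ?_
    rw [← Category.comp_id (whiskerR _ (orbAlg G)), ← whiskerL_id, ← h2, whiskerL_sum,
      Preadditive.comp_sum, whiskerR_sum]
    refine Finset.sum_congr rfl fun h _ => ?_
    rw [← whiskerR_comp, ← map_cls_comp, tensorHom_comp, cls_tensorHom]
  rw [← Category.id_comp f, ← Category.id_comp f', ← h1, Preadditive.sum_comp, Preadditive.sum_comp]
  refine Finset.sum_congr rfl fun g _ => ?_
  rw [Preadditive.sum_comp, Preadditive.sum_comp]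
  exact Finset.sum_congr rfl fun g' _ => by rw [Category.assoc, Category.assoc, h]

theorem LF.tensorHom_zero_left {T S : Type u} [CommRing T] [CommRing S] [Algebra k T]
    [Algebra k S] {U : T} {V : S} {Z : C}
    {D D' : LF (T ⊗[k] S) (potDiff k U V)} {E E' : LF (S ⊗[k] C) (potDiff k V Z)} (f : E ⟶ E') :
    tensorHom (0 : D ⟶ D') f = 0 :=
  tensor_hom_ext fun _ _ => TensorProduct.zero_tmul _ _

theorem LF.tensorHom_zero_right {T S : Type u} [CommRing T] [CommRing S] [Algebra k T]
    [Algebra k S] {U : T} {V : S} {Z : C}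
    {D D' : LF (T ⊗[k] S) (potDiff k U V)} {E E' : LF (S ⊗[k] C) (potDiff k V Z)} (f : D ⟶ D') :
    tensorHom f (0 : E ⟶ E') = 0 :=
  tensor_hom_ext fun _ _ => TensorProduct.tmul_zero _ _

theorem orbIncl_mul (g h : G) : (cls _ _).map (tensorHom (orbIncl G g) (orbIncl G h)) ≫
    (orbAlgData G).mul = (cls _ _).map (mulComp (g : symAut k W) (h : symAut k W)) ≫
      (cls _ _).map (orbIncl G (g * h)) := by
  have h1 : tensorHom (orbIncl G g) (orbIncl G h) ≫ ∑ g', ∑ h', orbComp G g' h' =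
      mulComp (g : symAut k W) (h : symAut k W) ≫ orbIncl G (g * h) := by
    rw [Preadditive.comp_sum, Finset.sum_eq_single g, Preadditive.comp_sum,
      Finset.sum_eq_single h]
    · rw [orbComp, tensorHom_comp_assoc, orbIncl_orbProj, orbIncl_orbProj, tensorHom_id,
        Category.id_comp]
    · intro h' _ hh
      rw [orbComp, tensorHom_comp_assoc, orbIncl_orbProj_ne G hh, tensorHom_zero_right,
        Limits.zero_comp]
    · exact fun h' => absurd (Finset.mem_univ h) h'
    · intro g' _ hg
      rw [Preadditive.comp_sum]
      refine Finset.sum_eq_zero fun h' _ => ?_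
      rw [orbComp, tensorHom_comp_assoc, orbIncl_orbProj_ne G hg, tensorHom_zero_left,
        Limits.zero_comp]
    · exact fun h' => absurd (Finset.mem_univ g) h'
  exact congrArg (cls _ _).map h1

theorem whiskerR_mul_actOf
    (ψ : ∀ g : G, (cls _ _).obj ((twistL (g : symAut k W)).obj X) ⟶ (cls _ _).obj X) (g h : G) :
    whiskerR ((cls _ _).map (tensorHom (orbIncl G g) (orbIncl G h))) X ≫
        whiskerR (orbAlgData G).mul X ≫ actOf G X ψ =
      (whiskerR ((cls _ _).map (mulComp (g : symAut k W) (h : symAut k W))) X ≫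
        (cls _ _).map (twistAct ((g : symAut k W) * (h : symAut k W)) X)) ≫ ψ (g * h) := by
  rw [← Category.assoc, ← whiskerR_comp, orbIncl_mul, whiskerR_comp, Category.assoc,
    whiskerR_orbIncl_actOf, Category.assoc]
  rfl

theorem assoc_whiskerL_actOf
    (ψ : ∀ g : G, (cls _ _).obj ((twistL (g : symAut k W)).obj X) ⟶ (cls _ _).obj X) (g h : G) :
    whiskerR ((cls _ _).map (tensorHom (orbIncl G g) (orbIncl G h))) X ≫
        (cls _ _).map (assoc (orbAlg G) (orbAlg G) X).hom ≫ whiskerL (orbAlg G) (actOf G X ψ) ≫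
          actOf G X ψ =
      (whiskerR ((cls _ _).map (mulComp (g : symAut k W) (h : symAut k W))) X ≫
        (cls _ _).map (twistAct ((g : symAut k W) * (h : symAut k W)) X)) ≫
        (cls _ _).map (twistLMul (g : symAut k W) (h : symAut k W) X).hom ≫
          twistMap (g : symAut k W) (ψ h) ≫ ψ g := by
  have h1 : (cls _ _).map (twistAct (g : symAut k W) ((twistL (h : symAut k W)).obj X)) ≫
      twistMap (g : symAut k W) (ψ h) = whiskerL (twistedUnit (g : symAut k W)) (ψ h) ≫
        (cls _ _).map (twistAct (g : symAut k W) X) := by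
    obtain ⟨f, hf⟩ := exists_rep (ψ h)
    rw [← hf, twistMap_cls, whiskerL_cls, ← map_cls_comp, ← map_cls_comp, twistAct_naturality]
  have h2 := congrArg (cls _ _).map (twistAct_mul (g : symAut k W) (h : symAut k W) X)
  rw [map_cls_comp, map_cls_comp, map_cls_comp, map_cls_comp, ← whiskerL_cls, ← whiskerR_cls] at h2
  rw [Category.assoc, reassoc_of% h2, reassoc_of% h1]
  rw [cls_tensorHom, whiskerR_comp, Category.assoc]
  have h3 := assoc_naturality_middle (D := orbAlg G) (X := X) ((cls _ _).map (orbIncl G h))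
  have h4 := assoc_naturality_left (E := twistedUnit (h : symAut k W)) (X := X)
    ((cls _ _).map (orbIncl G g))
  have h5 := whiskerL_comp (D := orbAlg G) (whiskerR ((cls _ _).map (orbIncl G h)) X) (actOf G X ψ)
  rw [reassoc_of% h3, reassoc_of% h4, ← reassoc_of% h5, whiskerR_orbIncl_actOf,
    reassoc_of% (interchange ((cls _ _).map (orbIncl G g))
      ((cls _ _).map (twistAct (h : symAut k W) X) ≫ ψ h)), whiskerR_orbIncl_actOf, whiskerL_comp,
    Category.assoc]

theorem mul_actOf_iff [Algebra ℚ k] (hX : X.IsMF)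
    (ψ : ∀ g : G, (cls _ _).obj ((twistL (g : symAut k W)).obj X) ⟶ (cls _ _).obj X) :
    whiskerR (orbAlgData G).mul X ≫ actOf G X ψ = (cls _ _).map (assoc (orbAlg G) (orbAlg G) X).hom ≫
        whiskerL (orbAlg G) (actOf G X ψ) ≫ actOf G X ψ ↔
      ∀ g h : G, ψ (g * h) = (cls _ _).map (twistLMul (g : symAut k W) (h : symAut k W) X).hom ≫
        twistMap (g : symAut k W) (ψ h) ≫ ψ g := by
  have key : ∀ g h : G, IsIso (whiskerR ((cls _ _).map (mulComp (g : symAut k W) (h : symAut k W))) X ≫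
        (cls _ _).map (twistAct ((g : symAut k W) * (h : symAut k W)) X)) := fun g h =>
    have := isIso_cls_mulComp (g : symAut k W) (h : symAut k W)
    IsIso.comp_isIso' (Functor.map_isIso (HF.tensorRight X) _) (isIso_cls_twistAct _ hX)
  constructor
  · intro H g h
    have := key g h
    rw [← cancel_epi (whiskerR ((cls _ _).map (mulComp (g : symAut k W) (h : symAut k W))) X ≫
      (cls _ _).map (twistAct ((g : symAut k W) * (h : symAut k W)) X))]
    exact (whiskerR_mul_actOf ψ g h).symm.trans
      ((congrArg _ H).trans (assoc_whiskerL_actOf ψ g h))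
  · intro H
    refine whiskerR_orbIncl_orbIncl_ext fun g h => ?_
    refine (whiskerR_mul_actOf ψ g h).trans (Eq.trans ?_ (assoc_whiskerL_actOf ψ g h).symm)
    exact congrArg _ (H g h)

theorem one_actOf_iff [Algebra ℚ k] (hX : X.IsMF)
    (ψ : ∀ g : G, (cls _ _).obj ((twistL (g : symAut k W)).obj X) ⟶ (cls _ _).obj X) :
    whiskerR (orbAlgData G).one X ≫ actOf G X ψ = (cls _ _).map (leftUnitor X) ↔
      ψ 1 = (cls _ _).map (twistLOne X).hom := by
  let e := whiskerR ((cls _ _).map (twistLOne (unitDefect k W)).inv) X ≫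
    (cls _ _).map (twistAct (1 : symAut k W) X)
  have he : IsIso e := 
    IsIso.comp_isIso' (Functor.map_isIso (HF.tensorRight X) _) (isIso_cls_twistAct _ hX)
  have h1 : whiskerR (orbAlgData G).one X ≫ actOf G X ψ = e ≫ ψ 1 := by
    have h2 : (orbAlgData G).one = (cls _ _).map (twistLOne (unitDefect k W)).inv ≫
      (cls _ _).map (orbIncl G 1) := rfl
    have h3 := whiskerR_orbIncl_actOf ψ 1
    have h4 := congrArg (fun f => whiskerR ((cls _ _).map (twistLOne (unitDefect k W)).inv) X ≫ f) h3
    rw [h2, whiskerR_comp]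
    simp only [e, Category.assoc]
    exact h4
  have h5 : (cls _ _).map (leftUnitor X) = e ≫ (cls _ _).map (twistLOne X).hom := by
    refine Eq.trans ?_ (Category.assoc _ _ _).symm
    exact congrArg (cls _ _).map (twistAct_one X).symm
  rw [h1, h5]
  exact cancel_epi e

theorem actOf_comm_iff [Algebra ℚ k] (hX : X.IsMF)
    (ψ : ∀ g : G, (cls _ _).obj ((twistL (g : symAut k W)).obj X) ⟶ (cls _ _).obj X)
    (ψ' : ∀ g : G, (cls _ _).obj ((twistL (g : symAut k W)).obj Y) ⟶ (cls _ _).obj Y)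
    (f : (cls _ _).obj X ⟶ (cls _ _).obj Y) :
    whiskerL (orbAlg G) f ≫ actOf G Y ψ' = actOf G X ψ ≫ f ↔
      ∀ g : G, twistMap (g : symAut k W) f ≫ ψ' g = ψ g ≫ f := by
  have h1 : ∀ g : G, whiskerR ((cls _ _).map (orbIncl G g)) X ≫ whiskerL (orbAlg G) f ≫
      actOf G Y ψ' = (cls _ _).map (twistAct (g : symAut k W) X) ≫
        twistMap (g : symAut k W) f ≫ ψ' g := fun g => by
    have h2 : (cls _ _).map (twistAct (g : symAut k W) X) ≫ twistMap (g : symAut k W) f =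
        whiskerL (twistedUnit (g : symAut k W)) f ≫
          (cls _ _).map (twistAct (g : symAut k W) Y) := by
      obtain ⟨f, rfl⟩ := exists_rep f
      rw [twistMap_cls, whiskerL_cls, ← map_cls_comp, ← map_cls_comp, twistAct_naturality]
    rw [reassoc_of% (interchange ((cls _ _).map (orbIncl G g)) f), whiskerR_orbIncl_actOf,
      reassoc_of% h2]
  have h3 : ∀ g : G, whiskerR ((cls _ _).map (orbIncl G g)) X ≫ actOf G X ψ ≫ f =
      (cls _ _).map (twistAct (g : symAut k W) X) ≫ ψ g ≫ f := fun g => by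
    rw [reassoc_of% (whiskerR_orbIncl_actOf ψ g)]
  constructor
  · intro H g
    have := isIso_cls_twistAct (g : symAut k W) hX
    rw [← cancel_epi ((cls _ _).map (twistAct (g : symAut k W) X)), ← h1, ← h3, H]
  · exact fun H => whiskerR_orbIncl_ext fun g => by rw [h1, h3, H]

/-- Every morphism `A_G ⊗ X ⟶ X` comes from a family `ᵍX ⟶ X`, as `ᵍI ⊗ X ≅ ᵍX`. -/
theorem exists_actOf_eq [Algebra ℚ k] (hX : X.IsMF)
    (a : (cls _ _).obj (tensor (orbAlg G) X) ⟶ (cls _ _).obj X) : ∃ ψ, actOf G X ψ = a := by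
  have := fun g : G => isIso_cls_twistAct (g : symAut k W) hX
  refine ⟨fun g => inv ((cls _ _).map (twistAct (g : symAut k W) X)) ≫
    whiskerR ((cls _ _).map (orbIncl G g)) X ≫ a, whiskerR_orbIncl_ext fun g => ?_⟩
  rw [whiskerR_orbIncl_actOf, IsIso.hom_inv_id_assoc]

end OrbifoldModules

/-! ### Factorisations as 1-morphisms from the trivial model -/

section Restriction

variable {Q Z : Type u} [CommRing Q] [CommRing Z] {w : Q} {z : Z}

/-- Restriction of a homotopy class of morphisms. -/
def HF.resMap (f : Z →+* Q) (hf : f z = w) {X Y : LF Q w}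
    (φ : (cls Q w).obj X ⟶ (cls Q w).obj Y) :
    (cls Z z).obj ((resFunctor f hf).obj X) ⟶ (cls Z z).obj ((resFunctor f hf).obj Y) :=
  (HF.res f hf).map φ

theorem HF.resMap_cls (f : Z →+* Q) (hf : f z = w) {X Y : LF Q w} (φ : X ⟶ Y) :
    HF.resMap f hf ((cls Q w).map φ) = (cls Z z).map ((resFunctor f hf).map φ) := rfl

theorem HF.resMap_comp (f : Z →+* Q) (hf : f z = w) {X Y Y' : LF Q w}
    (φ : (cls Q w).obj X ⟶ (cls Q w).obj Y) (φ' : (cls Q w).obj Y ⟶ (cls Q w).obj Y') :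
    HF.resMap f hf (φ ≫ φ') = HF.resMap f hf φ ≫ HF.resMap f hf φ' :=
  Functor.map_comp _ _ _

/-- If `f : Z → Q` is surjective, then `Z`-linear maps of `Q`-modules are `Q`-linear. -/
def LF.unresLin {f : Z →+* Q} (hs : Function.Surjective f) (hf : f z = w) {X Y : LF Q w}
    (l : (LF.res f hf X).carrier →ₗ[Z] (LF.res f hf Y).carrier) : X.carrier →ₗ[Q] Y.carrier where
  toFun x := l x
  map_add' x y := l.map_add x y
  map_smul' r x := by
    obtain ⟨r, rfl⟩ := hs r
    exact l.map_smul r x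

theorem HF.resMap_surjective {f : Z →+* Q} (hs : Function.Surjective f) (hf : f z = w)
    {X Y : LF Q w} : Function.Surjective (HF.resMap f hf (X := X) (Y := Y)) := by
  intro φ
  obtain ⟨φ, rfl⟩ := exists_rep φ
  exact ⟨(cls Q w).map (mkHom (LF.unresLin hs hf (lin φ)) (fun x => lin_par φ x)
    fun x => lin_d φ x), rfl⟩

theorem HF.resMap_injective {f : Z →+* Q} (hs : Function.Surjective f) (hf : f z = w)
    {X Y : LF Q w} : Function.Injective (HF.resMap f hf (X := X) (Y := Y)) := by
  intro φ ψ h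
  obtain ⟨φ, rfl⟩ := exists_rep φ
  obtain ⟨ψ, rfl⟩ := exists_rep ψ
  obtain ⟨l, hp, hd⟩ := (Quotient.functor_map_eq_iff (LF.homotopic Z z) _ _).1 h
  exact CategoryTheory.Quotient.sound _ ⟨LF.unresLin hs hf l, hp, hd⟩

theorem HF.full_res {f : Z →+* Q} (hs : Function.Surjective f) (hf : f z = w) :
    (HF.res f hf : HF Q w ⥤ HF Z z).Full :=
  ⟨fun {_ _} => HF.resMap_surjective hs hf⟩

theorem HF.faithful_res {f : Z →+* Q} (hs : Function.Surjective f) (hf : f z = w) :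
    (HF.res f hf : HF Q w ⥤ HF Z z).Faithful :=
  ⟨fun {_ _} _ _ h => HF.resMap_injective hs hf h⟩

theorem HF.res_isMF {f : Z →+* Q} (hb : Function.Bijective f) (hf : f z = w) {X : HF Q w}
    (hX : HF.isMF X) : HF.isMF ((HF.res f hf).obj X) :=
  (LF.res_isMF_iff f hb hf X.as).2 hX

theorem HF.res_isFiniteRankMF {f : Z →+* Q} (hb : Function.Bijective f) (hf : f z = w) {X : HF Q w}
    (hX : HF.isFiniteRankMF X) : HF.isFiniteRankMF ((HF.res f hf).obj X) :=
  (LF.res_isFiniteRankMF_iff f hb hf X.as).2 hX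

theorem HF.res_isSummandMF {f : Z →+* Q} (hb : Function.Bijective f) (hf : f z = w) {X : HF Q w}
    (hX : HF.isSummandMF X) : HF.isSummandMF ((HF.res f hf).obj X) := by
  obtain ⟨h, Y, hY, ⟨r⟩⟩ := hX
  exact ⟨HF.res_isMF hb hf h, _, HF.res_isFiniteRankMF hb hf hY, ⟨r.map (HF.res f hf)⟩⟩

end Restriction

theorem invHom_bijective {k : Type u} [CommRing k] {S : Type u} [CommRing S] [Algebra k S] {V : S}
    (g : symAut k V) : Function.Bijective (invHom g) :=
  (((g⁻¹ : symAut k V) : S ≃ₐ[k] S)).bijective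

/-- The maps of an equivariant structure are automatically invertible: `φ_g ∘ ᵍ(φ_h)` is
invertible for `h = g⁻¹`. -/
theorem isIso_of_equivariant {k : Type u} [CommRing k] {S : Type u} [CommRing S] [Algebra k S]
    {V : S} {G : Subgroup (symAut k V)} {X : HF S V}
    (φ : ∀ g : G, (HF.twist (g : symAut k V)).obj X ⟶ X)
    (φ_one : φ 1 = (HF.cls _ _).map (LF.twistOne X.as).hom)
    (φ_mul : ∀ g h : G, φ (g * h) =
      (HF.cls _ _).map (LF.twistMul (g : symAut k V) (h : symAut k V) X.as).hom ≫
        (HF.twist (g : symAut k V)).map (φ h) ≫ φ g) (g : G) : IsIso (φ g) := by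
  have h1 : IsIso (φ 1) := by
    rw [φ_one]
    exact Functor.map_isIso (HF.cls S V) (LF.twistOne X.as).hom
  have h2 : ∀ g h : G, g * h = 1 → IsIso ((HF.twist (g : symAut k V)).map (φ h) ≫ φ g) := by
    intro g h hgh
    have h3 := φ_mul g h
    have h4 : IsIso (φ (g * h)) := by rw [hgh]; exact h1
    rw [h3] at h4
    have h5 : IsIso ((HF.cls S V).map
        (LF.twistMul (g : symAut k V) (h : symAut k V) X.as).hom) := Functor.map_isIso _ _
    exact @IsIso.of_isIso_comp_left _ _ _ _ _ _ _ h5 h4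
  have h6 : ∀ g : G, IsSplitEpi (φ g) := fun g => by
    have := h2 g g⁻¹ (mul_inv_cancel g)
    exact IsSplitEpi.mk' ⟨inv ((HF.twist (g : symAut k V)).map (φ g⁻¹) ≫ φ g) ≫
      (HF.twist (g : symAut k V)).map (φ g⁻¹), by rw [Category.assoc, IsIso.inv_hom_id]⟩
  have h7 : IsIso ((HF.twist ((g⁻¹ : G) : symAut k V)).map (φ g)) := by
    have := h2 g⁻¹ g (inv_mul_cancel g)
    have := h6 g
    have : Mono ((HF.twist ((g⁻¹ : G) : symAut k V)).map (φ g)) :=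
      mono_of_mono _ (φ g⁻¹)
    exact isIso_of_mono_of_isSplitEpi _
  have := HF.full_res (invHom_bijective ((g⁻¹ : G) : symAut k V)).2 (invHom_pot _)
  have := HF.faithful_res (invHom_bijective ((g⁻¹ : G) : symAut k V)).2 (invHom_pot _)
  exact isIso_of_reflects_iso (φ g) (HF.twist ((g⁻¹ : G) : symAut k V))

section Trivial

variable {k : Type u} [CommRing k] {n : ℕ} (W : Pol k n)

/-- The ring isomorphism `R ⊗ k ≃ R`. -/
def ridHom (k : Type u) [CommRing k] (n : ℕ) : Pol k n ⊗[k] k →+* Pol k n :=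
  ((Algebra.TensorProduct.rid k k (Pol k n) : Pol k n ⊗[k] k ≃ₐ[k] Pol k n) :
    Pol k n ⊗[k] k →+* Pol k n)

/-- The inverse of `R ⊗ k ≃ R`. -/
def ridInv (k : Type u) [CommRing k] (n : ℕ) : Pol k n →+* Pol k n ⊗[k] k :=
  ((Algebra.TensorProduct.rid k k (Pol k n)).symm : Pol k n →+* Pol k n ⊗[k] k)

theorem ridHom_tmul (r : Pol k n) (c : k) : ridHom k n (r ⊗ₜ c) = c • r :=
  Algebra.TensorProduct.rid_tmul k c r

theorem ridHom_pot : ridHom k n (potDiff k W (0 : k)) = W := by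
  simp [ridHom, potDiff]

theorem ridHom_bijective : Function.Bijective (ridHom k n) :=
  (Algebra.TensorProduct.rid k k (Pol k n)).bijective

theorem ridInv_bijective : Function.Bijective (ridInv k n) :=
  (Algebra.TensorProduct.rid k k (Pol k n)).symm.bijective

theorem ridInv_ridHom (r : Pol k n ⊗[k] k) : ridInv k n (ridHom k n r) = r :=
  (Algebra.TensorProduct.rid k k (Pol k n)).symm_apply_apply r

theorem ridInv_pot : ridInv k n W = potDiff k W (0 : k) := by
  rw [← ridInv_ridHom (potDiff k W (0 : k)), ridHom_pot]

/-- A factorisation of `W` as a 1-morphism `(k, 0) ⟶ (R, W)`. -/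
abbrev LF.trivDefect : LF (Pol k n) W ⥤ LF (Pol k n ⊗[k] k) (potDiff k W (0 : k)) :=
  resFunctor (ridHom k n) (ridHom_pot W)

variable {W}

theorem ridHom_invHomL (g : symAut k W) (r : Pol k n ⊗[k] k) :
    ridHom k n (invHomL k g r) = invHom g (ridHom k n r) := by
  induction r using TensorProduct.induction_on with
  | zero => simp
  | add a b ha hb => simp only [map_add, ha, hb]
  | tmul s c =>
    rw [invHomL_tmul, ridHom_tmul, ridHom_tmul]
    exact (map_smul ((g⁻¹ : symAut k W) : Pol k n ≃ₐ[k] Pol k n) c s).symm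

/-- Twisting commutes with regarding a factorisation as a defect; both sides have the same
underlying set. -/
def LF.twistTriv (g : symAut k W) (X : LF (Pol k n) W) :
    (twistL g).obj ((trivDefect W).obj X) ≅ (trivDefect W).obj ((LF.twist g).obj X) :=
  (resComp _ (invHomL_pot g) _ (ridHom_pot W) ((ridHom k n).comp (invHomL k g))
      ((congrArg (ridHom k n) (invHomL_pot g)).trans (ridHom_pot W)) (fun _ => rfl) X).symm ≪≫
    resComp _ (ridHom_pot W) _ (invHom_pot g) ((ridHom k n).comp (invHomL k g))
      ((congrArg (ridHom k n) (invHomL_pot g)).trans (ridHom_pot W)) (ridHom_invHomL g) X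

/-- Every defect over `R ⊗ k` comes from a factorisation over `R`. -/
def LF.trivDefectIso (Y : LF (Pol k n ⊗[k] k) (potDiff k W (0 : k))) :
    (trivDefect W).obj ((resFunctor (ridInv k n) (ridInv_pot W)).obj Y) ≅ Y :=
  (resComp _ (ridHom_pot W) _ (ridInv_pot W) ((ridInv k n).comp (ridHom k n))
      (ridInv_ridHom _) (fun _ => rfl) Y).symm ≪≫ resId _ (ridInv_ridHom _) ridInv_ridHom Y

theorem twistMap_twistTriv (g : symAut k W) {X Y : LF (Pol k n) W}
    (f : (cls _ _).obj X ⟶ (cls _ _).obj Y) :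
    twistMap g (resMap (ridHom k n) (ridHom_pot W) f) ≫ (cls _ _).map (twistTriv g Y).hom =
      (cls _ _).map (twistTriv g X).hom ≫
        resMap (ridHom k n) (ridHom_pot W) (resMap (invHom g) (invHom_pot g) f) := by
  obtain ⟨f, rfl⟩ := exists_rep f
  rw [resMap_cls, resMap_cls, resMap_cls, twistMap_cls, ← map_cls_comp, ← map_cls_comp]
  exact congrArg _ (hom_ext fun _ => rfl)

variable {G : Subgroup (symAut k W)}

/-- The maps `ᵍX ⟶ X` of an equivariant structure, for `X` regarded as a defect. -/
def trivFamily {X : LF (Pol k n) W}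
    (φ : ∀ g : G, (cls _ _).obj ((LF.twist (g : symAut k W)).obj X) ⟶ (cls _ _).obj X) (g : G) :
    (cls _ _).obj ((twistL (g : symAut k W)).obj ((trivDefect W).obj X)) ⟶
      (cls _ _).obj ((trivDefect W).obj X) :=
  (cls _ _).map (twistTriv (g : symAut k W) X).hom ≫ resMap (ridHom k n) (ridHom_pot W) (φ g)

theorem exists_trivFamily_eq {X : LF (Pol k n) W}
    (ψ : ∀ g : G, (cls _ _).obj ((twistL (g : symAut k W)).obj ((trivDefect W).obj X)) ⟶
      (cls _ _).obj ((trivDefect W).obj X)) :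
    ∃ φ : ∀ g : G, (cls _ _).obj ((LF.twist (g : symAut k W)).obj X) ⟶ (cls _ _).obj X,
      trivFamily φ = ψ := by
  choose φ hφ using fun g : G => resMap_surjective ridHom_bijective.2 (ridHom_pot W)
    ((cls _ _).map (twistTriv (g : symAut k W) X).inv ≫ ψ g)
  refine ⟨φ, funext fun g => ?_⟩
  rw [trivFamily, hφ, ← Category.assoc, ← map_cls_comp, Iso.hom_inv_id, map_cls_id,
    Category.id_comp]

theorem trivFamily_isEquivariantFamily_iff {X : LF (Pol k n) W}
    (φ : ∀ g : G, (cls _ _).obj ((LF.twist (g : symAut k W)).obj X) ⟶ (cls _ _).obj X) :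
    IsEquivariantFamily G ((trivDefect W).obj X) (trivFamily φ) ↔
      φ 1 = (cls _ _).map (twistOne X).hom ∧
      ∀ g h : G, φ (g * h) = (cls _ _).map (twistMul (g : symAut k W) (h : symAut k W) X).hom ≫
        resMap (invHom (g : symAut k W)) (invHom_pot _) (φ h) ≫ φ g := by
  have hi : ∀ g : symAut k W, IsIso ((cls _ _).map (twistTriv g X).hom) := fun g =>
    Functor.map_isIso _ _
  have h1 : trivFamily φ 1 = (cls _ _).map (twistLOne ((trivDefect W).obj X)).hom ↔
      φ 1 = (cls _ _).map (twistOne X).hom := by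
    have e : (cls _ _).map (twistLOne ((trivDefect W).obj X)).hom =
        (cls _ _).map (twistTriv (1 : symAut k W) X).hom ≫
          resMap (ridHom k n) (ridHom_pot W) ((cls _ _).map (twistOne X).hom) := by
      rw [resMap_cls, ← map_cls_comp]
      exact congrArg _ (hom_ext fun _ => rfl)
    rw [e]
    have := hi 1
    exact (cancel_epi ((cls _ _).map (twistTriv (1 : symAut k W) X).hom)).trans
      (resMap_injective ridHom_bijective.2 (ridHom_pot W)).eq_iff
  have h2 : ∀ g h : G, trivFamily φ (g * h) = (cls _ _).map
        (twistLMul (g : symAut k W) (h : symAut k W) ((trivDefect W).obj X)).hom ≫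
          twistMap (g : symAut k W) (trivFamily φ h) ≫ trivFamily φ g ↔
      φ (g * h) = (cls _ _).map (twistMul (g : symAut k W) (h : symAut k W) X).hom ≫
        resMap (invHom (g : symAut k W)) (invHom_pot _) (φ h) ≫ φ g := by
    intro g h
    have e1 : (cls _ _).map
        (twistLMul (g : symAut k W) (h : symAut k W) ((trivDefect W).obj X)).hom ≫
          twistMap (g : symAut k W) ((cls _ _).map (twistTriv (h : symAut k W) X).hom) ≫
            (cls _ _).map (twistTriv (g : symAut k W) ((LF.twist (h : symAut k W)).obj X)).hom =
        (cls _ _).map (twistTriv ((g : symAut k W) * (h : symAut k W)) X).hom ≫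
          resMap (ridHom k n) (ridHom_pot W)
            ((cls _ _).map (twistMul (g : symAut k W) (h : symAut k W) X).hom) := by
      rw [resMap_cls, twistMap_cls, ← map_cls_comp, ← map_cls_comp, ← map_cls_comp]
      exact congrArg _ (hom_ext fun _ => rfl)
    have e2 : (cls _ _).map
        (twistLMul (g : symAut k W) (h : symAut k W) ((trivDefect W).obj X)).hom ≫
          twistMap (g : symAut k W) (trivFamily φ h) ≫ trivFamily φ g =
        (cls _ _).map (twistTriv ((g : symAut k W) * (h : symAut k W)) X).hom ≫
          resMap (ridHom k n) (ridHom_pot W)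
            ((cls _ _).map (twistMul (g : symAut k W) (h : symAut k W) X).hom ≫
              resMap (invHom (g : symAut k W)) (invHom_pot _) (φ h) ≫ φ g) := by
      rw [trivFamily, trivFamily, twistMap_comp, Category.assoc,
        reassoc_of% (twistMap_twistTriv (g : symAut k W) (φ h)), reassoc_of% e1, resMap_comp,
        resMap_comp]
    rw [e2]
    have := hi ((g : symAut k W) * (h : symAut k W))
    exact (cancel_epi ((cls _ _).map (twistTriv ((g : symAut k W) * (h : symAut k W)) X).hom)).trans
      (resMap_injective ridHom_bijective.2 (ridHom_pot W)).eq_iff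
  exact ⟨fun H => ⟨h1.1 H.one, fun g h => (h2 g h).1 (H.mul g h)⟩,
    fun H => ⟨h1.2 H.1, fun g h => (h2 g h).2 (H.2 g h)⟩⟩

theorem trivFamily_comm_iff {X Y : LF (Pol k n) W}
    (φ : ∀ g : G, (cls _ _).obj ((LF.twist (g : symAut k W)).obj X) ⟶ (cls _ _).obj X)
    (φ' : ∀ g : G, (cls _ _).obj ((LF.twist (g : symAut k W)).obj Y) ⟶ (cls _ _).obj Y)
    (f : (cls _ _).obj X ⟶ (cls _ _).obj Y) (g : G) :
    twistMap (g : symAut k W) (resMap (ridHom k n) (ridHom_pot W) f) ≫ trivFamily φ' g =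
        trivFamily φ g ≫ resMap (ridHom k n) (ridHom_pot W) f ↔
      φ g ≫ f = resMap (invHom (g : symAut k W)) (invHom_pot _) f ≫ φ' g := by
  have hi : IsIso ((cls _ _).map (twistTriv (g : symAut k W) X).hom) := Functor.map_isIso _ _
  rw [trivFamily, trivFamily, reassoc_of% (twistMap_twistTriv (g : symAut k W) f), Category.assoc,
    ← resMap_comp, ← resMap_comp]
  exact (cancel_epi ((cls _ _).map (twistTriv (g : symAut k W) X).hom)).trans
    ((resMap_injective ridHom_bijective.2 (ridHom_pot W)).eq_iff.trans eq_comm)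

end Trivial

/-! ### Equivariant factorisations and modules -/

section Equivalence

variable {k : Type u} [CommRing k] {n : ℕ} {W : Pol k n} {G : Subgroup (symAut k W)}

/-- The structure maps of an equivariant object, on representatives. -/
def EquivariantObj.family {P : ObjectProperty (HF (Pol k n) W)} (E : EquivariantObj G P) (g : G) :
    (cls _ _).obj ((LF.twist (g : symAut k W)).obj E.X.as) ⟶ (cls _ _).obj E.X.as :=
  (E.φ g).hom

theorem HF.whiskerL_inv_comp {T S C : Type u} [CommRing T] [CommRing S] [CommRing C] [Algebra k T]
    [Algebra k S] [Algebra k C] {U : T} {V : S} {Z : C} {D : LF (T ⊗[k] S) (potDiff k U V)}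
    {X Y : LF (S ⊗[k] C) (potDiff k V Z)} {M N : HF (T ⊗[k] C) (potDiff k U Z)}
    (e : (cls _ _).obj X ≅ (cls _ _).obj Y) {b : (cls _ _).obj (tensor D Y) ⟶ N}
    {a : (cls _ _).obj (tensor D X) ⟶ M} {i : M ≅ N} (h : whiskerL D e.hom ≫ b = a ≫ i.hom) :
    whiskerL D e.inv ≫ a = b ≫ i.inv := by
  rw [← Category.comp_id a, ← i.hom_inv_id, ← reassoc_of% h, ← Category.assoc, ← whiskerL_comp,
    e.inv_hom_id, whiskerL_id, Category.id_comp]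

theorem trivDefect_isMF {X : HF (Pol k n) W} (hX : isMF X) : ((trivDefect W).obj X.as).IsMF :=
  HF.res_isMF ridHom_bijective (ridHom_pot W) hX

variable [Fintype G]

/-- The action of `A_G` on an equivariant factorisation. -/
def EquivariantObj.act {P : ObjectProperty (HF (Pol k n) W)} (E : EquivariantObj G P) :
    (cls _ _).obj (tensor (orbAlg G) ((trivDefect W).obj E.X.as)) ⟶
      (cls _ _).obj ((trivDefect W).obj E.X.as) :=
  actOf G ((trivDefect W).obj E.X.as) (trivFamily E.family)

variable [Algebra ℚ k] {P : ObjectProperty (HF (Pol k n) W)}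
  {P' : ObjectProperty (HF (Pol k n ⊗[k] k) (potDiff k W (0 : k)))}

/-- The module over `A_G` given by an equivariant factorisation. -/
def EquivariantObj.toLeftMod (hP : ∀ X, P X → P' ((fromTrivial W).obj X))
    (hmf : P ≤ HF.isMF) (E : EquivariantObj G P) : LeftMod (orbAlgData G) P' where
  X := (fromTrivial W).obj E.X
  mem := hP _ E.mem
  act := E.act
  mul_act := (mul_actOf_iff (trivDefect_isMF (hmf _ E.mem)) _).2
    ((trivFamily_isEquivariantFamily_iff E.family).2 ⟨E.φ_one, E.φ_mul⟩).mul
  one_act := (one_actOf_iff (trivDefect_isMF (hmf _ E.mem)) _).2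
    ((trivFamily_isEquivariantFamily_iff E.family).2 ⟨E.φ_one, E.φ_mul⟩).one

theorem EquivariantObj.comm_iff (hmf : P ≤ HF.isMF) (E E' : EquivariantObj G P)
    (f : (cls _ _).obj E.X.as ⟶ (cls _ _).obj E'.X.as) :
    whiskerL (orbAlg G) (resMap (ridHom k n) (ridHom_pot W) f) ≫ E'.act =
        E.act ≫ resMap (ridHom k n) (ridHom_pot W) f ↔
      ∀ g, E.family g ≫ f = resMap (invHom (g : symAut k W)) (invHom_pot _) f ≫ E'.family g :=
  (actOf_comm_iff (trivDefect_isMF (hmf _ E.mem)) _ _ _).trans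
    (forall_congr' fun g => trivFamily_comm_iff E.family E'.family f g)

/-- Equivariant factorisations as modules over `A_G`. -/
def equivariantToLeftMod (G : Subgroup (symAut k W)) [Fintype G]
    (hP : ∀ X, P X → P' ((fromTrivial W).obj X)) (hmf : P ≤ HF.isMF) :
    EquivariantObj G P ⥤ LeftMod (orbAlgData G) P' where
  obj E := E.toLeftMod hP hmf
  map {E E'} f := LeftMod.Hom.mk (M := E.toLeftMod hP hmf) (N := E'.toLeftMod hP hmf)
    ((fromTrivial W).map (EquivariantObj.Hom.hom f))
    ((EquivariantObj.comm_iff hmf E E' _).2 (EquivariantObj.Hom.comm f))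
  map_id _ := LeftMod.Hom.ext (CategoryTheory.Functor.map_id (fromTrivial W) _)
  map_comp _ _ := LeftMod.Hom.ext (Functor.map_comp (fromTrivial W) _ _)

theorem equivariantToLeftMod_faithful (hP : ∀ X, P X → P' ((fromTrivial W).obj X))
    (hmf : P ≤ HF.isMF) : (equivariantToLeftMod G hP hmf).Faithful where
  map_injective {_ _} _ _ h := EquivariantObj.Hom.ext
    (resMap_injective ridHom_bijective.2 (ridHom_pot W) (congrArg LeftMod.Hom.hom h))

theorem equivariantToLeftMod_full (hP : ∀ X, P X → P' ((fromTrivial W).obj X))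
    (hmf : P ≤ HF.isMF) : (equivariantToLeftMod G hP hmf).Full where
  map_surjective {E E'} m := by
    obtain ⟨f, hf⟩ := resMap_surjective ridHom_bijective.2 (ridHom_pot W)
      (X := E.X.as) (Y := E'.X.as) (LeftMod.Hom.hom m)
    have h : whiskerL (orbAlg G) (resMap (ridHom k n) (ridHom_pot W) f) ≫ E'.act =
        E.act ≫ resMap (ridHom k n) (ridHom_pot W) f := by
      rw [hf]
      exact LeftMod.Hom.comm m
    exact ⟨⟨f, (EquivariantObj.comm_iff hmf E E' f).1 h⟩, LeftMod.Hom.ext hf⟩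

theorem equivariantToLeftMod_essSurj (hP : ∀ X, P X → P' ((fromTrivial W).obj X))
    (hP' : ∀ Y, P' Y → P ((HF.res (ridInv k n) (ridInv_pot W)).obj Y))
    (hmf : P ≤ HF.isMF) (hmf' : P' ≤ HF.isMF) : (equivariantToLeftMod G hP hmf).EssSurj where
  mem_essImage M := by
    have hM : M.X.as.IsMF := hmf' _ M.mem
    obtain ⟨ψ, hψ⟩ := exists_actOf_eq (G := G) hM M.act
    have hψ' : IsEquivariantFamily G M.X.as ψ :=
      ⟨(one_actOf_iff hM ψ).1 (by rw [hψ]; exact M.one_act),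
        (mul_actOf_iff hM ψ).1 (by rw [hψ]; exact M.mul_act)⟩
    let X : LF (Pol k n) W := (resFunctor (ridInv k n) (ridInv_pot W)).obj M.X.as
    let e : (cls _ _).obj ((trivDefect W).obj X) ≅ (cls _ _).obj M.X.as :=
      (cls _ _).mapIso (trivDefectIso M.X.as)
    obtain ⟨φ, hφ⟩ := exists_trivFamily_eq (X := X)
      fun g : G => twistMap (g : symAut k W) e.hom ≫ ψ g ≫ e.inv
    have hE := (trivFamily_isEquivariantFamily_iff φ).1 (by rw [hφ]; exact hψ'.conj e)
    have hiso := isIso_of_equivariant (X := (cls _ _).obj X) φ hE.1 hE.2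
    let E : EquivariantObj G P :=
      { X := (cls _ _).obj X
        mem := hP' _ M.mem
        φ := fun g => @asIso _ _ _ _ (φ g) (hiso g)
        φ_one := hE.1
        φ_mul := hE.2 }
    have hXmf : ((trivDefect W).obj X).IsMF := trivDefect_isMF (hmf _ (hP' _ M.mem))
    have hact : E.act = actOf G ((trivDefect W).obj X)
        fun g => twistMap (g : symAut k W) e.hom ≫ ψ g ≫ e.inv := congrArg _ hφ
    have h1 : whiskerL (orbAlg G) e.hom ≫ M.act = E.act ≫ e.hom := by
      rw [hact, ← hψ]
      refine (actOf_comm_iff hXmf _ _ e.hom).2 fun g => ?_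
      rw [Category.assoc, Category.assoc, e.inv_hom_id, Category.comp_id]
    exact ⟨E, ⟨⟨⟨e.hom, h1⟩, ⟨e.inv, whiskerL_inv_comp e (i := e) h1⟩, LeftMod.Hom.ext e.hom_inv_id,
      LeftMod.Hom.ext e.inv_hom_id⟩⟩⟩

theorem exists_equivariant_equivalence (G : Subgroup (symAut k W)) [Fintype G]
    (hP : ∀ X, P X → P' ((fromTrivial W).obj X))
    (hP' : ∀ Y, P' Y → P ((HF.res (ridInv k n) (ridInv_pot W)).obj Y))
    (hmf : P ≤ HF.isMF) (hmf' : P' ≤ HF.isMF) :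
    ∃ F : EquivariantObj G P ≌ LeftMod (orbAlgData G) P',
      Nonempty (F.functor ⋙ LeftMod.forget _ _ ≅ EquivariantObj.forget _ _ ⋙ fromTrivial W) := by
  have h1 := equivariantToLeftMod_faithful (G := G) hP hmf
  have h2 := equivariantToLeftMod_full (G := G) hP hmf
  have h3 := equivariantToLeftMod_essSurj (G := G) hP hP' hmf hmf'
  have h4 : (equivariantToLeftMod G hP hmf).IsEquivalence := {}
  exact ⟨(equivariantToLeftMod G hP hmf).asEquivalence, ⟨Iso.refl _⟩⟩

end Equivalence

end

theorem theorem7p2 {k : Type u} [CommRing k] [IsNoetherianRing k] [Algebra ℚ k] {n : ℕ}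
    (W : Pol k n) (hW : IsPotential k W) (G : Subgroup (symAut k W)) [Fintype G] :
    (orbAlg G).IsFiniteRankMF ∧
    (∃ hμ : ∀ g h : G, IsIso ((HF.cls _ _).map (mulComp (g : symAut k W) (h : symAut k W))),
      IsSeparableFrobenius (orbAlgData G) (orbCoalgData G hμ)) ∧
    (∃ F : EquivariantObj G (HF.isFiniteRankMF (w := W)) ≌
        LeftMod (orbAlgData G) (HF.isFiniteRankMF (w := potDiff k W (0 : k))),
      Nonempty (F.functor ⋙ LeftMod.forget _ _ ≅ EquivariantObj.forget _ _ ⋙ fromTrivial W)) ∧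
    (∃ F : EquivariantObj G (HF.isSummandMF (w := W)) ≌
        LeftMod (orbAlgData G) (HF.isSummandMF (w := potDiff k W (0 : k))),
      Nonempty (F.functor ⋙ LeftMod.forget _ _ ≅ EquivariantObj.forget _ _ ⋙ fromTrivial W)) :=
  ⟨LF.orbAlg_isFiniteRankMF G,
    ⟨fun _ _ => LF.isIso_cls_mulComp _ _, orbAlg_isSeparableFrobenius G _⟩,
    exists_equivariant_equivalence G
      (fun _ hX => HF.res_isFiniteRankMF ridHom_bijective (ridHom_pot W) hX)
      (fun _ hY => HF.res_isFiniteRankMF ridInv_bijective (ridInv_pot W) hY)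
      (fun _ hX => hX.1) (fun _ hY => hY.1),
    exists_equivariant_equivalence G
      (fun _ hX => HF.res_isSummandMF ridHom_bijective (ridHom_pot W) hX)
      (fun _ hY => HF.res_isSummandMF ridInv_bijective (ridInv_pot W) hY)
      (fun _ hX => hX.1) (fun _ hY => hY.1)⟩
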